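/- Let $(K^7,\eta,\xi,J,\Omega)$ be a (non-empty) contact Calabi–Yau $7$-manifold: $(\eta,\xi,J)$ is a Sasakian structure (with $J$ the transverse complex structure, $J\xi=0$) whose transverse Kähler form is $\omega=d\eta$, with transverse metric $g_V=\omega(\cdot,J\cdot)$, and $\Omega$ is a closed transverse $(3,0)$-form with $\frac{\omega^3}{3!}=\frac14\,\mathrm{Re}\,\Omega\wedge\mathrm{Im}\,\Omega$. For $\epsilon>0$ put $e_0=\epsilon\eta$ and let $$\psi_\epsilon=\tfrac12\omega^2-\epsilon\,\eta\wedge\mathrm{Im}\,\Omega$$ be the $4$-form of the $\mathrm{G}_2$-structure $\varphi_\epsilon=\epsilon\eta\wedge\omega+\mathrm{Re}\,\Omega$. Let $e=(e_1,e_2,e_3)^{\mathrm T}$, $Je=(Je_1,Je_2,Je_3)^{\mathrm T}$ be a local transverse $\mathrm{SU}(3)$-coframe, that is, horizontal $1$-forms with $(Je_i)(v)=-e_i(Jv)$, $\omega=\sum_i e_i\wedge Je_i$ and $\Omega=(e_1+iJe_1)\wedge(e_2+iJe_2)\wedge(e_3+iJe_3)$. For a vector $a=(a_1,a_2,a_3)^{\mathrm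 T}$ write $$[a]=\begin{pmatrix}0&a_3&-a_2\\-a_3&0&a_1\\a_2&-a_1&0\end{pmatrix},\qquad \mathcal I=\begin{pmatrix}0&0&0\\0&0&-I\\0&I&0\end{pmatrix},$$ and, in the coframe $(e_0,e,Je)$, put $$B=\begin{pmatrix}0&Je^{\mathrm T}&-e^{\mathrm T}\\-Je&0&-e_0I\\e&e_0I&0\end{pmatrix},\qquad C=\begin{pmatrix}0&Je^{\mathrm T}&-e^{\mathrm T}\\-Je&-[e]&e_0I+[Je]\\e&-e_0I+[Je]&[e]\end{pmatrix}.$$ Let $A$ be the matrix, in this coframe, of the transverse Levi-Civita connection of $g_V$, extended by zero along $e_0$ (when $\pi:K\to V$ is an $S^1$-(orbi)bundle over a Calabi–Yau $3$-orbifold, this is the pullback of the Levi-Civita connection of $V$); that is, the non-zero block of $A$ is the skew-symmetric matrix of $1$-forms $\Gamma$ with $d\binom{e}{Je}=-\Gamma\wedge\binom{e}{Je}$. For $\delta,m\in\mathbb R$ and $k\in\mathbb R\setminus\{0\}$ let $\theta^{\delta,k}_{\epsilon,m}$ be the connection on $TK$ given in such coframes by $$\theta^{\delta,k}_{\epsilon,m}=A+\frac{k\epsilon}{2}B+\frac{k\epsilon\delta}{2}C+\frac{km\epsilon}{2}e_0\,\mathcal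 I .$$ Then its curvature $R^{\delta,k}_{\epsilon,m}=d\theta^{\delta,k}_{\epsilon,m}+\theta^{\delta,k}_{\epsilon,m}\wedge\theta^{\delta,k}_{\epsilon,m}$ satisfies, in every such coframe, $$\begin{aligned}R^{\delta,k}_{\epsilon,m}\wedge\psi_\epsilon={}&\frac{k\epsilon^2\big(6(1-\delta+m)+k(1-\delta)(1+3\delta)\big)}{4}\,\frac{\omega^3}{6}\,\mathcal I\\&+\frac{k^2\epsilon^2}{4}\,e_0\wedge\frac{\omega^2}{2}\wedge\begin{pmatrix}0&p\,e^{\mathrm T}&p\,Je^{\mathrm T}\\-p\,e&q\,[Je]&q\,[e]\\-p\,Je&q\,[e]&-q\,[Je]\end{pmatrix},\end{aligned}$$ where $p=(1+m-5\delta)(1+\delta)$ and $q=\delta^2-2(2+m)\delta-1$. Consequently $\theta^{\delta,k}_{\epsilon,m}$ is never a $\mathrm{G}_2$-instanton, i.e. $R^{\delta,k}_{\epsilon,m}\wedge\psi_\epsilon$ does not vanish identically on $K$. -/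

import Mathlib

open scoped Manifold ContDiff Topology

noncomputable section

/-- Differential `n`-forms with values in `F` on a manifold modelled on `ℝ⁷`
(no regularity is imposed here; see `Form.SmoothOn`). -/
abbrev Form (K : Type*) [TopologicalSpace K] [ChartedSpace (EuclideanSpace ℝ (Fin 7)) K]
    (n : ℕ) (F : Type*) [NormedAddCommGroup F] [NormedSpace ℝ F] :=
  ∀ x : K, TangentSpace (𝓡 7) x [⋀^Fin n]→L[ℝ] F

/-- The wedge product of two alternating maps with values in a commutative algebra, normalised so
that `(α ∧ β)(v) = ∑ sign σ • α (v ∘ σ) * β (v ∘ σ)`, the sum being over the shuffles `σ`. -/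
def wedgeAlt {M 𝔸 : Type*} [AddCommGroup M] [Module ℝ M] [TopologicalSpace M]
    [NormedCommRing 𝔸] [NormedAlgebra ℝ 𝔸] {m n : ℕ}
    (α : M [⋀^Fin m]→L[ℝ] 𝔸) (β : M [⋀^Fin n]→L[ℝ] 𝔸) : M [⋀^Fin (m + n)]→L[ℝ] 𝔸 :=
  { ((LinearMap.mul' ℝ 𝔸).compAlternatingMap
      (α.toAlternatingMap.domCoprod β.toAlternatingMap)).domDomCongr finSumFinEquiv with
    cont := by
      change Continuous fun v : Fin (m + n) → M => LinearMap.mul' ℝ 𝔸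
        ((∑ σ, AlternatingMap.domCoprod.summand α.toAlternatingMap β.toAlternatingMap σ)
          (v ∘ finSumFinEquiv))
      simp only [sum_apply, map_sum]
      refine continuous_finsetSum _ fun σ _ => ?_
      induction σ using Quotient.inductionOn' with
      | h σ =>
        have h : ∀ w : Fin m ⊕ Fin n → M, LinearMap.mul' ℝ 𝔸
            (AlternatingMap.domCoprod.summand α.toAlternatingMap β.toAlternatingMap
              (Quotient.mk'' σ) w) =
            (Equiv.Perm.sign σ : ℤ) •
              (α (fun i => w (σ (Sum.inl i))) * β (fun i => w (σ (Sum.inr i)))) := by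
          intro w
          rw [AlternatingMap.domCoprod.summand_mk'', smul_apply, Units.smul_def, map_zsmul]
          rfl
        simp only [h]
        refine Continuous.zsmul (Continuous.mul ?_ ?_) _
        · exact α.cont.comp (continuous_pi fun i => continuous_apply _)
        · exact β.cont.comp (continuous_pi fun i => continuous_apply _) }

namespace Form

variable {K : Type*} [TopologicalSpace K] [ChartedSpace (EuclideanSpace ℝ (Fin 7)) K]
  {F : Type*} [NormedAddCommGroup F] [NormedSpace ℝ F] {n : ℕ}

/-- The form `α` read in the preferred chart at `x₀`: its pullback by the inverse chart. -/
def inChart (α : Form K n F) (x₀ : K) (y : EuclideanSpace ℝ (Fin 7)) :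
    EuclideanSpace ℝ (Fin 7) [⋀^Fin n]→L[ℝ] F :=
  (α ((extChartAt (𝓡 7) x₀).symm y)).compContinuousLinearMap
    (mfderiv 𝓘(ℝ, EuclideanSpace ℝ (Fin 7)) (𝓡 7) (extChartAt (𝓡 7) x₀).symm y)

/-- `α` is a smooth form on the set `U` (used for open `U`). -/
def SmoothOn (α : Form K n F) (U : Set K) : Prop :=
  ∀ x ∈ U, ContDiffAt ℝ ∞ (α.inChart x) (extChartAt (𝓡 7) x x)

/-- The exterior derivative, computed in the preferred chart at each point. -/
def d (α : Form K n F) : Form K (n + 1) F := fun x =>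
  (extDeriv (α.inChart x) (extChartAt (𝓡 7) x x)).compContinuousLinearMap
    (mfderiv (𝓡 7) 𝓘(ℝ, EuclideanSpace ℝ (Fin 7)) (extChartAt (𝓡 7) x) x)

/-- The wedge product of differential forms. -/
def wedge {𝔸 : Type*} [NormedCommRing 𝔸] [NormedAlgebra ℝ 𝔸] {m n : ℕ}
    (α : Form K m 𝔸) (β : Form K n 𝔸) : Form K (m + n) 𝔸 :=
  fun x => wedgeAlt (α x) (β x)

/-- The real part of a complex-valued form. -/
def re (α : Form K n ℂ) : Form K n ℝ := fun x =>
  Complex.reCLM.compContinuousAlternatingMap (α x)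

/-- The imaginary part of a complex-valued form. -/
def im (α : Form K n ℂ) : Form K n ℝ := fun x =>
  Complex.imCLM.compContinuousAlternatingMap (α x)

/-- A real form seen as a complex-valued form. -/
def toComplex (α : Form K n ℝ) : Form K n ℂ := fun x =>
  Complex.ofRealCLM.compContinuousAlternatingMap (α x)

end Form

infixl:72 " ∧ᶠ " => Form.wedge

/-- A contact Calabi--Yau structure `(η, ξ, J, Ω)` on a `7`-manifold.  `J` is the transverse complex
structure, extended by `J ξ = 0`; the transverse Kähler form is `ω = dη`, the transverse metric is
`g_V = ω(·, J ·)`, and `Ω` is a closed transverse `(3,0)`-form with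
`ω³ / 3! = Re Ω ∧ Im Ω / 4` (so `Ω` vanishes nowhere).  `sasakian` is the vanishing of
`N_J + dη ⊗ ξ`, where `N_J` is the Nijenhuis tensor of `J`. -/
structure ContactCalabiYau (K : Type*) [TopologicalSpace K]
    [ChartedSpace (EuclideanSpace ℝ (Fin 7)) K] [IsManifold (𝓡 7) ∞ K] where
  η : Form K 1 ℝ
  ξ : ∀ x : K, TangentSpace (𝓡 7) x
  J : ∀ x : K, TangentSpace (𝓡 7) x →L[ℝ] TangentSpace (𝓡 7) x
  Ω : Form K 3 ℂ
  smooth_η : η.SmoothOn Set.univ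
  smooth_ξ : ContMDiff (𝓡 7) (𝓡 7).tangent ∞ fun x => (⟨x, ξ x⟩ : TangentBundle (𝓡 7) K)
  smooth_J : ContMDiff (𝓡 7)
    ((𝓡 7).prod 𝓘(ℝ, EuclideanSpace ℝ (Fin 7) →L[ℝ] EuclideanSpace ℝ (Fin 7))) ∞
    fun x => Bundle.TotalSpace.mk' (EuclideanSpace ℝ (Fin 7) →L[ℝ] EuclideanSpace ℝ (Fin 7))
      (E := fun x : K => TangentSpace (𝓡 7) x →L[ℝ] TangentSpace (𝓡 7) x) x (J x)
  smooth_Ω : Ω.SmoothOn Set.univ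
  η_ξ : ∀ x, η x ![ξ x] = 1
  dη_ξ : ∀ x v, η.d x ![ξ x, v] = 0
  J_ξ : ∀ x, J x (ξ x) = 0
  η_J : ∀ x v, η x ![J x v] = 0
  J_sq : ∀ x v, J x (J x v) = -v + η x ![v] • ξ x
  dη_J : ∀ x v w, η.d x ![J x v, J x w] = η.d x ![v, w]
  dη_pos : ∀ x v, η x ![v] = 0 → v ≠ 0 → 0 < η.d x ![v, J x v]
  sasakian : ∀ (X Y : ∀ x : K, TangentSpace (𝓡 7) x) (x : K),
    ContMDiffAt (𝓡 7) (𝓡 7).tangent ∞ (fun x => (⟨x, X x⟩ : TangentBundle (𝓡 7) K)) x →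
    ContMDiffAt (𝓡 7) (𝓡 7).tangent ∞ (fun x => (⟨x, Y x⟩ : TangentBundle (𝓡 7) K)) x →
    VectorField.mlieBracket (𝓡 7) (fun x => J x (X x)) (fun x => J x (Y x)) x
      - J x (VectorField.mlieBracket (𝓡 7) (fun x => J x (X x)) Y x)
      - J x (VectorField.mlieBracket (𝓡 7) X (fun x => J x (Y x)) x)
      + J x (J x (VectorField.mlieBracket (𝓡 7) X Y x))
      + η.d x ![X x, Y x] • ξ x = 0
  Ω_ξ : ∀ x v w, Ω x ![ξ x, v, w] = 0
  Ω_J : ∀ x u v w, Ω x ![J x u, v, w] = Complex.I * Ω x ![u, v, w]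
  dΩ : Ω.d = 0
  volume_eq : (1 / 6 : ℝ) • (η.d ∧ᶠ η.d ∧ᶠ η.d : Form K 6 ℝ)
    = (1 / 4 : ℝ) • (Ω.re ∧ᶠ Ω.im : Form K 6 ℝ)

section

variable {K : Type*} [TopologicalSpace K] [ChartedSpace (EuclideanSpace ℝ (Fin 7)) K]
  [IsManifold (𝓡 7) ∞ K]

namespace ContactCalabiYau

variable (S : ContactCalabiYau K)

/-- The transverse Kähler form `ω = dη`. -/
def omega : Form K 2 ℝ := S.η.d

/-- `ω²` -/
def omega2 : Form K 4 ℝ := S.omega ∧ᶠ S.omega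

/-- `ω³` -/
def omega3 : Form K 6 ℝ := S.omega ∧ᶠ S.omega ∧ᶠ S.omega

/-- `e₀ = ε η` -/
def e₀ (ε : ℝ) : Form K 1 ℝ := ε • S.η

/-- The `4`-form `ψ_ε = ω² / 2 - ε η ∧ Im Ω` of the `G₂`-structure
`φ_ε = ε η ∧ ω + Re Ω`. -/
def ψ (ε : ℝ) : Form K 4 ℝ :=
  (1 / 2 : ℝ) • S.omega2 - ε • (S.η ∧ᶠ S.Ω.im : Form K 4 ℝ)

/-- The action of the transverse complex structure on `1`-forms, `(J α)(v) = -α(J v)`. -/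
def JForm (α : Form K 1 ℝ) : Form K 1 ℝ := fun x => -(α x).compContinuousLinearMap (S.J x)

/-- A local transverse `SU(3)`-coframe `e₁, e₂, e₃, Je₁, Je₂, Je₃` on an open set `U`:
`ω = ∑ eᵢ ∧ Jeᵢ` and `Ω = (e₁ + i Je₁) ∧ (e₂ + i Je₂) ∧ (e₃ + i Je₃)`.
As `g_V = ω(·, J ·)`, the first identity makes it orthonormal for `g_V`, and together with `e₀` it is
an orthonormal coframe for `g_ε = ε² η ⊗ η + g_V`.  Coframes pulled back from a local leaf space of
the Reeb foliation are included; invariance along `ξ` is not demanded. -/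
structure SU3Coframe where
  U : Set K
  isOpen_U : IsOpen U
  e : Fin 3 → Form K 1 ℝ
  smooth_e : ∀ i, (e i).SmoothOn U
  horizontal : ∀ i, ∀ x ∈ U, e i x ![S.ξ x] = 0
  omega_eq : ∀ x ∈ U, S.omega x = (∑ i, e i ∧ᶠ S.JForm (e i) : Form K 2 ℝ) x
  Omega_eq : ∀ x ∈ U, S.Ω x =
    (((e 0).toComplex + Complex.I • (S.JForm (e 0)).toComplex) ∧ᶠ
      ((e 1).toComplex + Complex.I • (S.JForm (e 1)).toComplex) ∧ᶠ
      ((e 2).toComplex + Complex.I • (S.JForm (e 2)).toComplex) : Form K 3 ℂ) x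

end ContactCalabiYau

/-- Indices of the coframe `(e₀, e, Je)`. -/
abbrev Idx := Unit ⊕ (Fin 3 ⊕ Fin 3)

/-- The `7 × 7` matrix with blocks
`(0, r₂ᵀ, r₃ᵀ; c₂, m₂₂, m₂₃; c₃, m₃₂, m₃₃)`. -/
def blocks {α : Type*} [Zero α] (r₂ r₃ c₂ c₃ : Fin 3 → α)
    (m₂₂ m₂₃ m₃₂ m₃₃ : Matrix (Fin 3) (Fin 3) α) : Matrix Idx Idx α :=
  Matrix.fromBlocks 0 (Matrix.of fun _ j => Sum.elim r₂ r₃ j)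
    (Matrix.of fun i _ => Sum.elim c₂ c₃ i) (Matrix.fromBlocks m₂₂ m₂₃ m₃₂ m₃₃)

/-- The matrix `[a]` of a vector `a` of length three. -/
def box {α : Type*} [AddGroup α] (a : Fin 3 → α) : Matrix (Fin 3) (Fin 3) α :=
  !![0, a 2, -a 1; -a 2, 0, a 0; a 1, -a 0, 0]

/-- The matrix of forms `f 𝓘`, where `𝓘 = (0, 0, 0; 0, 0, -I; 0, I, 0)`. -/
def timesI {n : ℕ} (f : Form K n ℝ) : Matrix Idx Idx (Form K n ℝ) :=
  blocks 0 0 0 0 0 (-Matrix.diagonal fun _ => f) (Matrix.diagonal fun _ => f) 0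

/-- Wedge product of matrices of forms. -/
def matWedge {ι : Type*} [Fintype ι] {m n : ℕ} (M : Matrix ι ι (Form K m ℝ))
    (N : Matrix ι ι (Form K n ℝ)) : Matrix ι ι (Form K (m + n) ℝ) :=
  Matrix.of fun i j => ∑ l, M i l ∧ᶠ N l j

/-- The curvature `dθ + θ ∧ θ` of a matrix `θ` of `1`-forms. -/
def curvature {ι : Type*} [Fintype ι] (θ : Matrix ι ι (Form K 1 ℝ)) : Matrix ι ι (Form K 2 ℝ) :=
  θ.map Form.d + matWedge θ θ

namespace ContactCalabiYau.SU3Coframe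

variable {S : ContactCalabiYau K} (c : S.SU3Coframe)

/-- `Je = (Je₁, Je₂, Je₃)` -/
def Je (i : Fin 3) : Form K 1 ℝ := S.JForm (c.e i)

/-- `Γ` is the matrix, in the orthonormal transverse coframe `E = (e, Je)`, of the transverse
Levi-Civita connection, i.e. of the pullback of the Levi-Civita connection of `g_V` on the leaf space
of the Reeb foliation: it is metric (`Γ` is skew) and torsion-free (`dE = -Γ ∧ E`). -/
structure IsTransverseLeviCivita (Γ : Matrix (Fin 3 ⊕ Fin 3) (Fin 3 ⊕ Fin 3) (Form K 1 ℝ)) :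
    Prop where
  smooth : ∀ a b, (Γ a b).SmoothOn c.U
  skew : ∀ a b, ∀ x ∈ c.U, Γ b a x = -Γ a b x
  torsion_free : ∀ a, ∀ x ∈ c.U,
    (Sum.elim c.e c.Je a).d x = -(∑ b, Γ a b ∧ᶠ Sum.elim c.e c.Je b : Form K 2 ℝ) x

/-- The matrix `B = (0, Jeᵀ, -eᵀ; -Je, 0, -e₀ I; e, e₀ I, 0)`. -/
def B (ε : ℝ) : Matrix Idx Idx (Form K 1 ℝ) :=
  blocks c.Je (-c.e) (-c.Je) c.e
    0 (-Matrix.diagonal fun _ => S.e₀ ε)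
    (Matrix.diagonal fun _ => S.e₀ ε) 0

/-- The matrix `C = (0, Jeᵀ, -eᵀ; -Je, -[e], e₀ I + [Je]; e, -e₀ I + [Je], [e])`. -/
def C (ε : ℝ) : Matrix Idx Idx (Form K 1 ℝ) :=
  blocks c.Je (-c.e) (-c.Je) c.e
    (-box c.e) ((Matrix.diagonal fun _ => S.e₀ ε) + box c.Je)
    ((-Matrix.diagonal fun _ => S.e₀ ε) + box c.Je) (box c.e)

/-- The matrix, in the coframe `(e₀, e, Je)`, of the connection `θ^{δ,k}_{ε,m}` on `TK`:
`A + (k ε / 2) B + (k ε δ / 2) C + (k m ε / 2) e₀ 𝓘`, where `A` is the transverse Levi-Civita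
connection matrix `Γ` extended by zero in the direction of `e₀`. -/
def θ (Γ : Matrix (Fin 3 ⊕ Fin 3) (Fin 3 ⊕ Fin 3) (Form K 1 ℝ)) (ε δ m k : ℝ) :
    Matrix Idx Idx (Form K 1 ℝ) :=
  Matrix.fromBlocks 0 0 0 Γ + (k * ε / 2) • c.B ε + (k * ε * δ / 2) • c.C ε
    + (k * m * ε / 2) • timesI (S.e₀ ε)

/-- The matrix of `6`-forms `R ∧ ψ_ε`, where `R` is the curvature of `θ^{δ,k}_{ε,m}`. -/
def curvatureWedgePsi (Γ : Matrix (Fin 3 ⊕ Fin 3) (Fin 3 ⊕ Fin 3) (Form K 1 ℝ)) (ε δ m k : ℝ) :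
    Matrix Idx Idx (Form K 6 ℝ) :=
  (curvature (c.θ Γ ε δ m k)).map fun R => (R ∧ᶠ S.ψ ε : Form K 6 ℝ)

end ContactCalabiYau.SU3Coframe

/-- The connection `θ^{δ,k}_{ε,m}` on `TK` is a `G₂`-instanton: its curvature `R` satisfies
`R ∧ ψ_ε = 0` on `K`, i.e. in every local transverse `SU(3)`-coframe. -/
def ContactCalabiYau.IsG2Instanton (S : ContactCalabiYau K) (ε δ m k : ℝ) : Prop :=
  ∀ (c : S.SU3Coframe) (Γ : Matrix (Fin 3 ⊕ Fin 3) (Fin 3 ⊕ Fin 3) (Form K 1 ℝ)),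
    c.IsTransverseLeviCivita Γ →
      ∀ x ∈ c.U, ∀ a b, c.curvatureWedgePsi Γ ε δ m k a b x = 0

end

end

/-!
Everything is computed in a frame `f₀, …, f₆` dual to the coframe `(e₀, e, Je)`, in which `ω`, `Im Ω`
and `ψ` have constant components.

The transverse Levi-Civita connection `Γ` is metric and torsion-free on the local leaf space, and `ω`
and `Ω` are closed, so `Γ` takes values in `𝔰𝔲(3)` (`isSU3_of_closed`). Hence its curvature `dΓ + Γ ∧ Γ`
is an algebraic curvature tensor, by `d (d E_a) = 0`, with values in `𝔰𝔲(3)`; by pair symmetry it is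
also of type `(1,1)` and traceless as a `2`-form, and its product with `ψ` vanishes
(`psiContraction_eq_zero_of_bianchi`).

The remaining part of the connection is `(kε/2) T` with `T = B + δ C + m e₀ 𝓘`. The components of `T`
are constant and are linear combinations of `e₀ ∧ ω`, `Re Ω` and `ω ⊗ e₀`, hence invariant under
`𝔰𝔲(3)` (`torsionTensor_invariant`). So the mixed terms `dT + Γ ∧ T + T ∧ Γ` reduce to the contribution
of `de₀ = ε ω`, and `R = R_Γ + (a multiple of) ω 𝓘 + (kε/2)² T ∧ T` (`curvature_apply`). The product of
`T ∧ T` with `ψ` is a finite computation with integer tensors (`psiContraction_torsionTensor_sq`), which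
gives the formula for `R ∧ ψ`.

The three coefficients in this formula do not vanish together (`coefficients_ne_zero`). For the last
assertion one further needs some coframe and connection to evaluate the formula on: Gram--Schmidt and a
change of phase give smooth unitary vector fields near any point on which `Ω` equals `1`
(`exists_special_unitary_fields`), thus a transverse `SU(3)`-coframe, and the Koszul formula gives its
transverse Levi-Civita connection (`exists_isTransverseLeviCivita`). The latter is skew in the Reeb
direction because `ω` and `Ω`, hence the transverse metric, are invariant under the Reeb flow
(`skew_of_closed`).
-/

/-! ### Wedge products of alternating maps -/

/-- The alternating sum of `F` over all permutations of its arguments. -/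
def altSum {M 𝔸 : Type*} [AddCommGroup 𝔸] {N : ℕ} (F : (Fin N → M) → 𝔸) (v : Fin N → M) : 𝔸 :=
  ∑ σ : Equiv.Perm (Fin N), (Equiv.Perm.sign σ : ℤ) • F (v ∘ σ)

section wedgeAlgebra

variable {M 𝔸 : Type*}

/-- Laplace expansion of an alternating sum along its first argument. -/
theorem altSum_succ [AddCommGroup 𝔸] {N : ℕ} (F : (Fin (N + 1) → M) → 𝔸) (v : Fin (N + 1) → M) :
    altSum F v = ∑ p : Fin (N + 1), (-1 : ℤ) ^ (p : ℕ) •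
      altSum (fun w => F (Fin.cons (v p) w)) (p.removeNth v) := by
  unfold altSum
  rw [Finset.univ_perm_fin_succ, ← Finset.univ_product_univ]
  simp only [Finset.sum_map, Equiv.toEmbedding_apply, Finset.sum_product]
  refine Finset.sum_congr rfl fun p _ => ?_
  rw [Finset.smul_sum]
  refine Fin.cases ?_ (fun i => ?_) p
  · refine Finset.sum_congr rfl fun σ _ => ?_
    rw [Equiv.Perm.decomposeFin.symm_sign]
    simp only [if_true, one_mul, Fin.val_zero, pow_zero, one_smul]
    congr 2
    ext j
    refine Fin.cases ?_ (fun j => ?_) j <;> simp [Fin.tail]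
  · rw [← Equiv.sum_comp (Equiv.mulLeft i.cycleRange⁻¹)]
    refine Finset.sum_congr rfl fun σ _ => ?_
    rw [Equiv.Perm.decomposeFin.symm_sign, if_neg (Fin.succ_ne_zero i), smul_smul]
    congr 1
    · simp [Fin.sign_cycleRange, pow_succ, ← mul_assoc]
    · congr 1
      ext j
      refine Fin.cases ?_ (fun j => ?_) j
      · simp
      · simp [Fin.removeNth, ← Fin.succAbove_cycleRange]

variable [AddCommGroup M] [Module ℝ M] [TopologicalSpace M] [NormedCommRing 𝔸] [NormedAlgebra ℝ 𝔸]

theorem altSum_const_mul {n : ℕ} (c : 𝔸) (β : M [⋀^Fin n]→L[ℝ] 𝔸) (v : Fin n → M) :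
    altSum (fun w => c * β w) v = (n.factorial : 𝔸) * (c * β v) := by
  unfold altSum
  have : ∀ σ : Equiv.Perm (Fin n), (Equiv.Perm.sign σ : ℤ) • (c * β (v ∘ σ)) = c * β v := by
    intro σ
    have h := β.toAlternatingMap.map_perm v σ
    have h' : β (v ∘ σ) = (Equiv.Perm.sign σ) • β v := h
    rw [h', Units.smul_def, mul_smul_comm, smul_smul]
    norm_cast
    simp
  simp [this, Fintype.card_perm]

theorem altSum_mul_const {n : ℕ} (c : 𝔸) (β : M [⋀^Fin n]→L[ℝ] 𝔸) (v : Fin n → M) :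
    altSum (fun w => β w * c) v = (n.factorial : 𝔸) * (β v * c) := by
  simpa [mul_comm] using altSum_const_mul c β v

/-- The wedge product as an alternating sum over all permutations instead of shuffles, each shuffle
being counted `m! n!` times. -/
theorem factorial_mul_wedgeAlt {m n : ℕ} (α : M [⋀^Fin m]→L[ℝ] 𝔸) (β : M [⋀^Fin n]→L[ℝ] 𝔸)
    (v : Fin (m + n) → M) :
    ((m.factorial * n.factorial : ℕ) : 𝔸) * wedgeAlt α β v =
      altSum (fun w => α (fun i => w (Fin.castAdd n i)) * β (fun i => w (Fin.natAdd m i))) v := by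
  have h := MultilinearMap.domCoprod_alternization_eq α.toAlternatingMap β.toAlternatingMap
  have h2 := congrArg (fun f => LinearMap.mul' ℝ 𝔸 (f (v ∘ finSumFinEquiv))) h
  simp only [AlternatingMap.smul_apply, Fintype.card_fin, map_nsmul] at h2
  rw [nsmul_eq_mul] at h2
  refine Eq.trans h2.symm ?_
  rw [MultilinearMap.alternatization_apply, map_sum]
  unfold altSum
  refine Fintype.sum_equiv (finSumFinEquiv.permCongr) _ _ fun σ => ?_
  rw [Units.smul_def, map_zsmul, Equiv.Perm.sign_permCongr]
  congr 1
  simp [Function.comp_def]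

end wedgeAlgebra

theorem altSum_cast {M 𝔸 : Type*} [AddCommGroup 𝔸] {N N' : ℕ} (h : N = N')
    (F : (Fin N → M) → 𝔸) (v : Fin N → M) :
    altSum F v = altSum (fun w => F (w ∘ Fin.cast h)) (v ∘ Fin.cast h.symm) := by
  subst h; rfl

section wedgeExpansion

variable {M 𝔸 : Type*}

theorem altSum_comp_perm [AddCommGroup 𝔸] {N : ℕ} (τ : Equiv.Perm (Fin N))
    (F : (Fin N → M) → 𝔸) (v : Fin N → M) :
    altSum (fun w => F (w ∘ τ)) v = (Equiv.Perm.sign τ : ℤ) • altSum F v := by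
  unfold altSum
  rw [Finset.smul_sum, ← Equiv.sum_comp (Equiv.mulRight τ⁻¹)]
  refine Finset.sum_congr rfl fun σ _ => ?_
  rw [smul_smul]
  congr 1
  · simp [mul_comm]
  · simp [Function.comp_assoc, ← Equiv.Perm.coe_mul]

/-- Laplace expansion of an alternating sum along its last argument. -/
theorem altSum_succ_last [AddCommGroup 𝔸] {N : ℕ} (F : (Fin (N + 1) → M) → 𝔸)
    (v : Fin (N + 1) → M) :
    altSum F v = ∑ p : Fin (N + 1), (-1 : ℤ) ^ (N + p : ℕ) •
      altSum (fun w => F (Fin.snoc w (v p))) (p.removeNth v) := by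
  have h := altSum_comp_perm (finRotate (N + 1)) F v
  rw [sign_finRotate, altSum_succ] at h
  have h2 : altSum F v = (-1 : ℤ) ^ N • ((-1 : ℤ) ^ N • altSum F v) := by
    rw [smul_smul, ← mul_pow]; simp
  rw [h2]
  simp only [Units.val_neg, Units.val_one, Units.val_pow_eq_pow_val,
    Nat.add_sub_cancel] at h
  rw [← h, Finset.smul_sum]
  refine Finset.sum_congr rfl fun p _ => ?_
  rw [smul_smul, ← pow_add]
  congr 2
  funext w
  congr 1
  ext j
  refine Fin.lastCases ?_ (fun j => ?_) j
  · simp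
  · rw [Function.comp_apply, finRotate_apply, Fin.coeSucc_eq_succ]
    simp

variable [AddCommGroup M] [Module ℝ M] [TopologicalSpace M] [NormedCommRing 𝔸]
  [NormedAlgebra ℝ 𝔸]

theorem natCast_mul_cancel {k : ℕ} (hk : k ≠ 0) {a b : 𝔸} (h : (k : 𝔸) * a = k * b) : a = b := by
  have h' : (k : ℝ) • a = (k : ℝ) • b := by
    simpa [Algebra.smul_def] using h
  exact smul_right_injective 𝔸 (Nat.cast_ne_zero.2 hk) h'

/-- Expansion of `α ∧ β`, for a `1`-form `α`, along the argument of `α`. -/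
theorem wedgeAlt_one_left {n : ℕ} (α : M [⋀^Fin 1]→L[ℝ] 𝔸) (β : M [⋀^Fin n]→L[ℝ] 𝔸)
    (v : Fin (1 + n) → M) (u : Fin (n + 1) → M) (hu : u = v ∘ Fin.cast (add_comm _ _)) :
    wedgeAlt α β v = ∑ p : Fin (n + 1), (-1 : ℤ) ^ (p : ℕ) • (α ![u p] * β (p.removeNth u)) := by
  have h := factorial_mul_wedgeAlt α β v
  rw [altSum_cast (add_comm 1 n), ← hu, altSum_succ] at h
  refine natCast_mul_cancel n.factorial_ne_zero ?_
  rw [Nat.factorial_one, one_mul] at h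
  rw [h, Finset.mul_sum]
  refine Finset.sum_congr rfl fun p _ => ?_
  rw [mul_smul_comm, ← altSum_const_mul]
  congr 2
  funext w
  congr 2
  · ext i
    fin_cases i
    rfl
  · ext i
    have : Fin.cast (add_comm 1 n) (Fin.natAdd 1 i) = i.succ := by ext; simp
    simp [this]

/-- Expansion of `α ∧ β`, for a `1`-form `β`, along the argument of `β`. -/
theorem wedgeAlt_one_right {m : ℕ} (α : M [⋀^Fin m]→L[ℝ] 𝔸) (β : M [⋀^Fin 1]→L[ℝ] 𝔸)
    (v : Fin (m + 1) → M) :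
    wedgeAlt α β v =
      ∑ p : Fin (m + 1), (-1 : ℤ) ^ (m + p : ℕ) • (α (p.removeNth v) * β ![v p]) := by
  have h := factorial_mul_wedgeAlt α β v
  rw [altSum_succ_last] at h
  refine natCast_mul_cancel m.factorial_ne_zero ?_
  rw [Nat.factorial_one, mul_one] at h
  rw [h, Finset.mul_sum]
  refine Finset.sum_congr rfl fun p _ => ?_
  rw [mul_smul_comm, ← altSum_mul_const]
  congr 2
  funext w
  congr 2
  · ext i
    exact Fin.snoc_castSucc (α := fun _ => M) (v p) w i
  · ext i
    fin_cases i
    exact Fin.snoc_last (α := fun _ => M) (v p) w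

/-- Expansion of `α ∧ β`, for a `2`-form `α`, along the arguments of `α`. -/
theorem wedgeAlt_two_left {n : ℕ} (α : M [⋀^Fin 2]→L[ℝ] 𝔸) (β : M [⋀^Fin n]→L[ℝ] 𝔸)
    (v : Fin (2 + n) → M) (u : Fin (n + 1 + 1) → M) (hu : u = v ∘ Fin.cast (add_comm _ _)) :
    ((2 : ℕ) : 𝔸) * wedgeAlt α β v = ∑ p : Fin (n + 1 + 1), ∑ q : Fin (n + 1),
      (-1 : ℤ) ^ (p + q : ℕ) •
        (α ![u p, p.removeNth u q] * β (q.removeNth (p.removeNth u))) := by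
  have h := factorial_mul_wedgeAlt α β v
  rw [altSum_cast (add_comm 2 n), ← hu, altSum_succ] at h
  refine natCast_mul_cancel n.factorial_ne_zero ?_
  rw [Nat.factorial_two, Nat.mul_comm, Nat.cast_mul, mul_assoc] at h
  rw [h, Finset.mul_sum]
  refine Finset.sum_congr rfl fun p _ => ?_
  rw [altSum_succ, Finset.mul_sum, Finset.smul_sum]
  refine Finset.sum_congr rfl fun q _ => ?_
  rw [mul_smul_comm, ← altSum_const_mul, smul_smul, pow_add]
  congr 2
  funext w
  congr 2
  · ext i
    fin_cases i <;> rfl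
  · ext i
    have : Fin.cast (add_comm 2 n) (Fin.natAdd 2 i) = i.succ.succ := by
      ext; simp only [Fin.val_cast, Fin.val_natAdd, Fin.val_succ]; omega
    simp [this]

/-- Expansion of `α ∧ β`, for a `2`-form `β`, along the arguments of `β`. -/
theorem wedgeAlt_two_right {m : ℕ} (α : M [⋀^Fin m]→L[ℝ] 𝔸) (β : M [⋀^Fin 2]→L[ℝ] 𝔸)
    (v : Fin (m + 1 + 1) → M) :
    ((2 : ℕ) : 𝔸) * wedgeAlt α β v = ∑ p : Fin (m + 1 + 1), ∑ q : Fin (m + 1),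
      (-1 : ℤ) ^ (m + 1 + p + (m + q) : ℕ) •
        (α (q.removeNth (p.removeNth v)) * β ![p.removeNth v q, v p]) := by
  have h := factorial_mul_wedgeAlt α β v
  rw [altSum_succ_last (N := m + 1)] at h
  refine natCast_mul_cancel m.factorial_ne_zero ?_
  rw [Nat.factorial_two, Nat.cast_mul, mul_assoc] at h
  rw [h, Finset.mul_sum]
  refine Finset.sum_congr rfl fun p _ => ?_
  rw [altSum_succ_last, Finset.mul_sum, Finset.smul_sum]
  refine Finset.sum_congr rfl fun q _ => ?_
  rw [mul_smul_comm, ← altSum_mul_const, smul_smul, ← pow_add]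
  congr 2
  funext w
  congr 2
  · ext i
    exact (Fin.snoc_castSucc (α := fun _ => M) (v p) _ i.castSucc).trans
      (Fin.snoc_castSucc (α := fun _ => M) _ w i)
  · ext i
    fin_cases i
    · exact (Fin.snoc_castSucc (α := fun _ => M) (v p) _ (Fin.last m)).trans
        (Fin.snoc_last (α := fun _ => M) _ w)
    · exact Fin.snoc_last (α := fun _ => M) (v p) _

/-- Expansion of `α ∧ β`, for a `3`-form `α`, along the arguments of `α`. -/
theorem wedgeAlt_three_left {n : ℕ} (α : M [⋀^Fin 3]→L[ℝ] 𝔸) (β : M [⋀^Fin n]→L[ℝ] 𝔸)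
    (v : Fin (3 + n) → M) (u : Fin (n + 1 + 1 + 1) → M)
    (hu : u = v ∘ Fin.cast (add_comm _ _)) :
    ((6 : ℕ) : 𝔸) * wedgeAlt α β v = ∑ p : Fin (n + 1 + 1 + 1), ∑ q : Fin (n + 1 + 1),
      ∑ r : Fin (n + 1), (-1 : ℤ) ^ (p + q + r : ℕ) •
        (α ![u p, p.removeNth u q, q.removeNth (p.removeNth u) r] *
          β (r.removeNth (q.removeNth (p.removeNth u)))) := by
  have h := factorial_mul_wedgeAlt α β v
  rw [altSum_cast (add_comm 3 n), ← hu, altSum_succ] at h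
  refine natCast_mul_cancel n.factorial_ne_zero ?_
  rw [show Nat.factorial 3 = 6 from rfl, Nat.mul_comm, Nat.cast_mul, mul_assoc] at h
  rw [h, Finset.mul_sum]
  refine Finset.sum_congr rfl fun p _ => ?_
  rw [altSum_succ, Finset.mul_sum, Finset.smul_sum]
  refine Finset.sum_congr rfl fun q _ => ?_
  rw [altSum_succ, Finset.mul_sum, Finset.smul_sum, Finset.smul_sum]
  refine Finset.sum_congr rfl fun r _ => ?_
  rw [mul_smul_comm, ← altSum_const_mul, smul_smul, smul_smul, pow_add, pow_add, mul_assoc]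
  congr 2
  funext w
  congr 2
  · ext i
    fin_cases i <;> rfl
  · ext i
    have : Fin.cast (add_comm 3 n) (Fin.natAdd 3 i) = i.succ.succ.succ := by
      ext; simp only [Fin.val_cast, Fin.val_natAdd, Fin.val_succ]; omega
    simp [this]

theorem ContinuousAlternatingMap.map_swap_two (α : M [⋀^Fin 2]→L[ℝ] 𝔸) (a b : M) :
    α ![b, a] = -α ![a, b] := by
  rw [← show α (![a, b] ∘ Equiv.swap 0 1) = -α ![a, b] from
    α.toAlternatingMap.map_swap ![a, b] (i := 0) (j := 1) (by decide)]
  congr 1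
  ext i
  fin_cases i <;> rfl

theorem ContinuousAlternatingMap.map_swap_three_left (α : M [⋀^Fin 3]→L[ℝ] 𝔸) (a b c : M) :
    α ![b, a, c] = -α ![a, b, c] := by
  rw [← show α (![a, b, c] ∘ Equiv.swap 0 1) = -α ![a, b, c] from
    α.toAlternatingMap.map_swap ![a, b, c] (i := 0) (j := 1) (by decide)]
  congr 1
  ext i
  fin_cases i <;> rfl

theorem ContinuousAlternatingMap.map_swap_three_right (α : M [⋀^Fin 3]→L[ℝ] 𝔸) (a b c : M) :
    α ![a, c, b] = -α ![a, b, c] := by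
  rw [← show α (![a, b, c] ∘ Equiv.swap 1 2) = -α ![a, b, c] from
    α.toAlternatingMap.map_swap ![a, b, c] (i := 1) (j := 2) (by decide)]
  congr 1
  ext i
  fin_cases i <;> rfl

theorem removeNth_eq_vec_one {M : Type*} (p : Fin 2) (u : Fin 2 → M) :
    (p.removeNth u : Fin 1 → M) = ![u (p.succAbove 0)] := by
  ext j; fin_cases j <;> rfl

theorem removeNth_eq_vec_two {M : Type*} (p : Fin 3) (u : Fin 3 → M) :
    (p.removeNth u : Fin 2 → M) = ![u (p.succAbove 0), u (p.succAbove 1)] := by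
  ext j; fin_cases j <;> rfl

theorem removeNth_eq_vec_three {M : Type*} (p : Fin 4) (u : Fin 4 → M) :
    (p.removeNth u : Fin 3 → M) = ![u (p.succAbove 0), u (p.succAbove 1), u (p.succAbove 2)] := by
  ext j; fin_cases j <;> rfl

theorem removeNth_eq_vec_four {M : Type*} (p : Fin 5) (u : Fin 5 → M) :
    (p.removeNth u : Fin 4 → M) =
      ![u (p.succAbove 0), u (p.succAbove 1), u (p.succAbove 2), u (p.succAbove 3)] := by
  ext j; fin_cases j <;> rfl

theorem removeNth_eq_vec_five {M : Type*} (p : Fin 6) (u : Fin 6 → M) :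
    (p.removeNth u : Fin 5 → M) =
      ![u (p.succAbove 0), u (p.succAbove 1), u (p.succAbove 2), u (p.succAbove 3),
        u (p.succAbove 4)] := by
  ext j; fin_cases j <;> rfl

theorem wedgeAlt_one_one (α : M [⋀^Fin 1]→L[ℝ] 𝔸) (β : M [⋀^Fin 1]→L[ℝ] 𝔸)
    (v : Fin (1 + 1) → M) : wedgeAlt α β v =
      α ![v 0] * β ![v 1] - α ![v 1] * β ![v 0] := by
  rw [wedgeAlt_one_left α β v v rfl]
  dsimp only [Nat.reduceAdd]
  simp only [Fin.sum_univ_two, removeNth_eq_vec_one]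
  simp [Fin.succAbove]
  ring

theorem wedgeAlt_one_two (α : M [⋀^Fin 1]→L[ℝ] 𝔸) (β : M [⋀^Fin 2]→L[ℝ] 𝔸)
    (v : Fin (1 + 2) → M) : wedgeAlt α β v =
      α ![v 0] * β ![v 1, v 2] - α ![v 1] * β ![v 0, v 2] + α ![v 2] * β ![v 0, v 1] := by
  rw [wedgeAlt_one_left α β v v rfl]
  dsimp only [Nat.reduceAdd]
  simp only [Fin.sum_univ_three, removeNth_eq_vec_two]
  simp [Fin.succAbove]
  ring

theorem wedgeAlt_one_three (α : M [⋀^Fin 1]→L[ℝ] 𝔸) (β : M [⋀^Fin 3]→L[ℝ] 𝔸)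
    (v : Fin (1 + 3) → M) : wedgeAlt α β v =
      α ![v 0] * β ![v 1, v 2, v 3] - α ![v 1] * β ![v 0, v 2, v 3]
      + α ![v 2] * β ![v 0, v 1, v 3] - α ![v 3] * β ![v 0, v 1, v 2] := by
  rw [wedgeAlt_one_left α β v v rfl]
  dsimp only [Nat.reduceAdd]
  simp only [Fin.sum_univ_four, removeNth_eq_vec_three]
  simp [Fin.succAbove]
  ring

theorem wedgeAlt_one_four (α : M [⋀^Fin 1]→L[ℝ] 𝔸) (β : M [⋀^Fin 4]→L[ℝ] 𝔸)
    (v : Fin (1 + 4) → M) : wedgeAlt α β v =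
      α ![v 0] * β ![v 1, v 2, v 3, v 4] - α ![v 1] * β ![v 0, v 2, v 3, v 4]
      + α ![v 2] * β ![v 0, v 1, v 3, v 4] - α ![v 3] * β ![v 0, v 1, v 2, v 4]
      + α ![v 4] * β ![v 0, v 1, v 2, v 3] := by
  rw [wedgeAlt_one_left α β v v rfl]
  dsimp only [Nat.reduceAdd]
  simp only [Fin.sum_univ_five, removeNth_eq_vec_four]
  simp [Fin.succAbove]
  ring

theorem wedgeAlt_two_two (α : M [⋀^Fin 2]→L[ℝ] 𝔸) (β : M [⋀^Fin 2]→L[ℝ] 𝔸)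
    (v : Fin (2 + 2) → M) : wedgeAlt α β v =
      α ![v 0, v 1] * β ![v 2, v 3] - α ![v 0, v 2] * β ![v 1, v 3]
      + α ![v 0, v 3] * β ![v 1, v 2] + α ![v 1, v 2] * β ![v 0, v 3]
      - α ![v 1, v 3] * β ![v 0, v 2] + α ![v 2, v 3] * β ![v 0, v 1] := by
  refine natCast_mul_cancel two_ne_zero ?_
  rw [wedgeAlt_two_left α β v v rfl]
  dsimp only [Nat.reduceAdd]
  simp only [Fin.sum_univ_four, Fin.sum_univ_three, removeNth_eq_vec_two, Fin.removeNth_apply]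
  have s : ∀ i j, i < j → α ![v j, v i] = -α ![v i, v j] := fun i j _ => α.map_swap_two _ _
  simp [s, Fin.succAbove]
  ring

theorem wedgeAlt_two_four (α : M [⋀^Fin 2]→L[ℝ] 𝔸) (β : M [⋀^Fin 4]→L[ℝ] 𝔸)
    (v : Fin (2 + 4) → M) : wedgeAlt α β v =
      α ![v 0, v 1] * β ![v 2, v 3, v 4, v 5] - α ![v 0, v 2] * β ![v 1, v 3, v 4, v 5]
      + α ![v 0, v 3] * β ![v 1, v 2, v 4, v 5] - α ![v 0, v 4] * β ![v 1, v 2, v 3, v 5]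
      + α ![v 0, v 5] * β ![v 1, v 2, v 3, v 4] + α ![v 1, v 2] * β ![v 0, v 3, v 4, v 5]
      - α ![v 1, v 3] * β ![v 0, v 2, v 4, v 5] + α ![v 1, v 4] * β ![v 0, v 2, v 3, v 5]
      - α ![v 1, v 5] * β ![v 0, v 2, v 3, v 4] + α ![v 2, v 3] * β ![v 0, v 1, v 4, v 5]
      - α ![v 2, v 4] * β ![v 0, v 1, v 3, v 5] + α ![v 2, v 5] * β ![v 0, v 1, v 3, v 4]
      + α ![v 3, v 4] * β ![v 0, v 1, v 2, v 5] - α ![v 3, v 5] * β ![v 0, v 1, v 2, v 4]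
      + α ![v 4, v 5] * β ![v 0, v 1, v 2, v 3] := by
  refine natCast_mul_cancel two_ne_zero ?_
  rw [wedgeAlt_two_left α β v v rfl]
  dsimp only [Nat.reduceAdd]
  simp only [Fin.sum_univ_six, Fin.sum_univ_five, removeNth_eq_vec_four, Fin.removeNth_apply]
  have s : ∀ i j, i < j → α ![v j, v i] = -α ![v i, v j] := fun i j _ => α.map_swap_two _ _
  simp [s, Fin.succAbove]
  ring

theorem wedgeAlt_three_three (α : M [⋀^Fin 3]→L[ℝ] 𝔸) (β : M [⋀^Fin 3]→L[ℝ] 𝔸)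
    (v : Fin (3 + 3) → M) : wedgeAlt α β v =
      α ![v 0, v 1, v 2] * β ![v 3, v 4, v 5] - α ![v 0, v 1, v 3] * β ![v 2, v 4, v 5]
      + α ![v 0, v 1, v 4] * β ![v 2, v 3, v 5] - α ![v 0, v 1, v 5] * β ![v 2, v 3, v 4]
      + α ![v 0, v 2, v 3] * β ![v 1, v 4, v 5] - α ![v 0, v 2, v 4] * β ![v 1, v 3, v 5]
      + α ![v 0, v 2, v 5] * β ![v 1, v 3, v 4] + α ![v 0, v 3, v 4] * β ![v 1, v 2, v 5]
      - α ![v 0, v 3, v 5] * β ![v 1, v 2, v 4] + α ![v 0, v 4, v 5] * β ![v 1, v 2, v 3]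
      - α ![v 1, v 2, v 3] * β ![v 0, v 4, v 5] + α ![v 1, v 2, v 4] * β ![v 0, v 3, v 5]
      - α ![v 1, v 2, v 5] * β ![v 0, v 3, v 4] - α ![v 1, v 3, v 4] * β ![v 0, v 2, v 5]
      + α ![v 1, v 3, v 5] * β ![v 0, v 2, v 4] - α ![v 1, v 4, v 5] * β ![v 0, v 2, v 3]
      + α ![v 2, v 3, v 4] * β ![v 0, v 1, v 5] - α ![v 2, v 3, v 5] * β ![v 0, v 1, v 4]
      + α ![v 2, v 4, v 5] * β ![v 0, v 1, v 3] - α ![v 3, v 4, v 5] * β ![v 0, v 1, v 2] := by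
  refine natCast_mul_cancel (k := 6) (by norm_num) ?_
  rw [wedgeAlt_three_left α β v v rfl]
  dsimp only [Nat.reduceAdd]
  simp only [Fin.sum_univ_six, Fin.sum_univ_five, Fin.sum_univ_four, removeNth_eq_vec_three,
    Fin.removeNth_apply]
  have s : ∀ i j x, i < j → α ![v j, v i, x] = -α ![v i, v j, x] :=
    fun i j x _ => α.map_swap_three_left _ _ _
  have t : ∀ i j x, i < j → α ![x, v j, v i] = -α ![x, v i, v j] :=
    fun i j x _ => α.map_swap_three_right _ _ _
  simp [s, t, Fin.succAbove]
  ring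

theorem wedgeAlt_two_one (α : M [⋀^Fin 2]→L[ℝ] 𝔸) (β : M [⋀^Fin 1]→L[ℝ] 𝔸)
    (v : Fin (2 + 1) → M) : wedgeAlt α β v =
      α ![v 0, v 1] * β ![v 2] - α ![v 0, v 2] * β ![v 1] + α ![v 1, v 2] * β ![v 0] := by
  rw [wedgeAlt_one_right α β v]
  dsimp only [Nat.reduceAdd]
  simp only [Fin.sum_univ_three, removeNth_eq_vec_two]
  simp [Fin.succAbove]
  ring

theorem wedgeAlt_three_one (α : M [⋀^Fin 3]→L[ℝ] 𝔸) (β : M [⋀^Fin 1]→L[ℝ] 𝔸)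
    (v : Fin (3 + 1) → M) : wedgeAlt α β v =
      α ![v 0, v 1, v 2] * β ![v 3] - α ![v 0, v 1, v 3] * β ![v 2]
      + α ![v 0, v 2, v 3] * β ![v 1] - α ![v 1, v 2, v 3] * β ![v 0] := by
  rw [wedgeAlt_one_right α β v]
  dsimp only [Nat.reduceAdd]
  simp only [Fin.sum_univ_four, removeNth_eq_vec_three]
  simp [Fin.succAbove]
  ring

theorem wedgeAlt_five_one (α : M [⋀^Fin 5]→L[ℝ] 𝔸) (β : M [⋀^Fin 1]→L[ℝ] 𝔸)
    (v : Fin (5 + 1) → M) : wedgeAlt α β v =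
      α ![v 0, v 1, v 2, v 3, v 4] * β ![v 5] - α ![v 0, v 1, v 2, v 3, v 5] * β ![v 4]
      + α ![v 0, v 1, v 2, v 4, v 5] * β ![v 3] - α ![v 0, v 1, v 3, v 4, v 5] * β ![v 2]
      + α ![v 0, v 2, v 3, v 4, v 5] * β ![v 1] - α ![v 1, v 2, v 3, v 4, v 5] * β ![v 0] := by
  rw [wedgeAlt_one_right α β v]
  dsimp only [Nat.reduceAdd]
  simp only [Fin.sum_univ_six, removeNth_eq_vec_five]
  simp [Fin.succAbove]
  ring

theorem wedgeAlt_four_two (α : M [⋀^Fin 4]→L[ℝ] 𝔸) (β : M [⋀^Fin 2]→L[ℝ] 𝔸)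
    (v : Fin (4 + 2) → M) : wedgeAlt α β v =
      α ![v 0, v 1, v 2, v 3] * β ![v 4, v 5] - α ![v 0, v 1, v 2, v 4] * β ![v 3, v 5]
      + α ![v 0, v 1, v 2, v 5] * β ![v 3, v 4] + α ![v 0, v 1, v 3, v 4] * β ![v 2, v 5]
      - α ![v 0, v 1, v 3, v 5] * β ![v 2, v 4] + α ![v 0, v 1, v 4, v 5] * β ![v 2, v 3]
      - α ![v 0, v 2, v 3, v 4] * β ![v 1, v 5] + α ![v 0, v 2, v 3, v 5] * β ![v 1, v 4]
      - α ![v 0, v 2, v 4, v 5] * β ![v 1, v 3] + α ![v 0, v 3, v 4, v 5] * β ![v 1, v 2]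
      + α ![v 1, v 2, v 3, v 4] * β ![v 0, v 5] - α ![v 1, v 2, v 3, v 5] * β ![v 0, v 4]
      + α ![v 1, v 2, v 4, v 5] * β ![v 0, v 3] - α ![v 1, v 3, v 4, v 5] * β ![v 0, v 2]
      + α ![v 2, v 3, v 4, v 5] * β ![v 0, v 1] := by
  refine natCast_mul_cancel two_ne_zero ?_
  rw [wedgeAlt_two_right α β v]
  dsimp only [Nat.reduceAdd]
  simp only [Fin.sum_univ_six, Fin.sum_univ_five, removeNth_eq_vec_four, Fin.removeNth_apply]
  have s : ∀ i j, i < j → β ![v j, v i] = -β ![v i, v j] := fun i j _ => β.map_swap_two _ _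
  simp [s, Fin.succAbove]
  ring

end wedgeExpansion

/-! ### Exterior derivative in charts -/

namespace Form

variable {K : Type*} [TopologicalSpace K] [ChartedSpace (EuclideanSpace ℝ (Fin 7)) K]
  {F : Type*} [NormedAddCommGroup F] [NormedSpace ℝ F] {n : ℕ}

/-- `α` is smooth at `x`, read in the preferred chart at `x`. -/
def SmoothAt (α : Form K n F) (x : K) : Prop :=
  ContDiffAt ℝ ∞ (α.inChart x) (extChartAt (𝓡 7) x x)

/-- The transition map from the preferred chart at `x` to the one at `x'`. -/
noncomputable def transition (x x' : K) (y : EuclideanSpace ℝ (Fin 7)) : EuclideanSpace ℝ (Fin 7) :=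
  extChartAt (𝓡 7) x' ((extChartAt (𝓡 7) x).symm y)

theorem inChart_apply (α : Form K n F) (x : K) (y : EuclideanSpace ℝ (Fin 7))
    (v : Fin n → EuclideanSpace ℝ (Fin 7)) :
    α.inChart x y v = α ((extChartAt (𝓡 7) x).symm y) (fun i =>
      mfderiv 𝓘(ℝ, EuclideanSpace ℝ (Fin 7)) (𝓡 7) (extChartAt (𝓡 7) x).symm y (v i)) := rfl

theorem two_le_infty : minSmoothness ℝ 2 ≤ (∞ : WithTop ℕ∞) := by
  rw [minSmoothness_of_isRCLikeNormedField]
  exact WithTop.coe_le_coe.2 le_top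

theorem eventually_mem_target (x : K) :
    ∀ᶠ y in 𝓝 (extChartAt (𝓡 7) x x), y ∈ (extChartAt (𝓡 7) x).target :=
  extChartAt_target_mem_nhds x

theorem tendsto_extChartAt_symm (x : K) :
    Filter.Tendsto (extChartAt (𝓡 7) x).symm (𝓝 (extChartAt (𝓡 7) x x)) (𝓝 x) := by
  have h := (continuousAt_extChartAt_symm (I := 𝓡 7) x).tendsto
  rwa [extChartAt_to_inv] at h

theorem fderiv_transition_self {x : K} {y : EuclideanSpace ℝ (Fin 7)}
    (hy : y ∈ (extChartAt (𝓡 7) x).target) (v : EuclideanSpace ℝ (Fin 7)) :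
    fderiv ℝ (transition x x) y v = v := by
  have h : transition x x =ᶠ[𝓝 y] id := by
    filter_upwards [(isOpen_extChartAt_target (I := 𝓡 7) x).mem_nhds hy] with z hz
    exact (extChartAt (𝓡 7) x).right_inv hz
  rw [h.fderiv_eq, fderiv_id]
  rfl

variable [IsManifold (𝓡 7) ∞ K]

theorem mdifferentiableAt_extChartAt_symm {x : K} {y : EuclideanSpace ℝ (Fin 7)}
    (hy : y ∈ (extChartAt (𝓡 7) x).target) :
    MDifferentiableAt 𝓘(ℝ, EuclideanSpace ℝ (Fin 7)) (𝓡 7) (extChartAt (𝓡 7) x).symm y := by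
  have : IsManifold (𝓡 7) 1 K := .of_le (n := ∞) (by norm_cast)
  have h := mdifferentiableWithinAt_extChartAt_symm (I := 𝓡 7) hy
  rwa [ModelWithCorners.range_eq_univ, mdifferentiableWithinAt_univ] at h

theorem contDiffAt_transition {x x' : K} {y : EuclideanSpace ℝ (Fin 7)}
    (hy : y ∈ (extChartAt (𝓡 7) x).target)
    (hy' : (extChartAt (𝓡 7) x).symm y ∈ (extChartAt (𝓡 7) x').source) :
    ContDiffAt ℝ ∞ (transition x x') y := by
  have h := contDiffWithinAt_ext_coord_change (I := 𝓡 7) (n := ∞) x' x (y := y) ?_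
  · rwa [ModelWithCorners.range_eq_univ, contDiffWithinAt_univ] at h
  · simp only [PartialEquiv.trans_source, PartialEquiv.symm_source]
    exact ⟨hy, hy'⟩

/-- The derivatives of the inverse charts at `x` and `x'` differ by that of the transition map. -/
theorem mfderiv_extChartAt_symm_eq {x x' : K} {y : EuclideanSpace ℝ (Fin 7)}
    (hy : y ∈ (extChartAt (𝓡 7) x).target)
    (hy' : (extChartAt (𝓡 7) x).symm y ∈ (extChartAt (𝓡 7) x').source)
    (v : EuclideanSpace ℝ (Fin 7)) :
    mfderiv 𝓘(ℝ, EuclideanSpace ℝ (Fin 7)) (𝓡 7) (extChartAt (𝓡 7) x).symm y v =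
      mfderiv 𝓘(ℝ, EuclideanSpace ℝ (Fin 7)) (𝓡 7) (extChartAt (𝓡 7) x').symm (transition x x' y)
        (fderiv ℝ (transition x x') y v) := by
  have hτ := contDiffAt_transition hy hy'
  have h1 : (extChartAt (𝓡 7) x).symm =ᶠ[𝓝 y]
      (extChartAt (𝓡 7) x').symm ∘ transition x x' := by
    have := (continuousAt_extChartAt_symm'' (I := 𝓡 7) hy).preimage_mem_nhds
      ((isOpen_extChartAt_source (I := 𝓡 7) x').mem_nhds hy')
    filter_upwards [this] with z hz
    exact ((extChartAt (𝓡 7) x').left_inv hz).symm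
  have hty : transition x x' y ∈ (extChartAt (𝓡 7) x').target := (extChartAt (𝓡 7) x').map_source hy'
  rw [h1.mfderiv_eq]
  erw [mfderiv_comp (I' := 𝓘(ℝ, EuclideanSpace ℝ (Fin 7))) y (mdifferentiableAt_extChartAt_symm hty)
    ((hτ.differentiableAt (by simp)).mdifferentiableAt)]
  rw [mfderiv_eq_fderiv]
  rfl

theorem mfderiv_extChartAt_comp_symm {x x' : K} {y : EuclideanSpace ℝ (Fin 7)}
    (hy : y ∈ (extChartAt (𝓡 7) x).target)
    (hy' : (extChartAt (𝓡 7) x).symm y ∈ (extChartAt (𝓡 7) x').source)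
    (v : EuclideanSpace ℝ (Fin 7)) :
    mfderiv (𝓡 7) 𝓘(ℝ, EuclideanSpace ℝ (Fin 7)) (extChartAt (𝓡 7) x')
      ((extChartAt (𝓡 7) x).symm y)
      (mfderiv 𝓘(ℝ, EuclideanSpace ℝ (Fin 7)) (𝓡 7) (extChartAt (𝓡 7) x).symm y v) =
        fderiv ℝ (transition x x') y v := by
  have : IsManifold (𝓡 7) 1 K := .of_le (n := ∞) (by norm_cast)
  have h : transition x x' = extChartAt (𝓡 7) x' ∘ (extChartAt (𝓡 7) x).symm := rfl
  rw [← mfderiv_eq_fderiv, h, mfderiv_comp (I' := 𝓡 7) y (mdifferentiableAt_extChartAt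
    (by rwa [extChartAt_source] at hy')) (mdifferentiableAt_extChartAt_symm hy)]
  rfl

theorem mfderiv_extChartAt_self (x : K) (v : EuclideanSpace ℝ (Fin 7)) :
    mfderiv (𝓡 7) 𝓘(ℝ, EuclideanSpace ℝ (Fin 7)) (extChartAt (𝓡 7) x) x v = v := by
  have : IsManifold (𝓡 7) 1 K := .of_le (n := ∞) (by norm_cast)
  have h : mfderiv (𝓡 7) 𝓘(ℝ, EuclideanSpace ℝ (Fin 7)) (extChartAt (𝓡 7) x) x =
      mfderiv (𝓡 7) (𝓡 7) (chartAt (EuclideanSpace ℝ (Fin 7)) x) x :=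
    (hasMFDerivAt_extChartAt (I := 𝓡 7) (mem_chart_source _ x)).mfderiv
  rw [h, mfderiv_chartAt_eq_tangentCoordChange (I := 𝓡 7) (mem_chart_source _ x)]
  exact tangentCoordChange_self (I := 𝓡 7) (mem_extChartAt_source x)

theorem mfderiv_extChartAt_symm_self (x : K) (v : EuclideanSpace ℝ (Fin 7)) :
    mfderiv 𝓘(ℝ, EuclideanSpace ℝ (Fin 7)) (𝓡 7) (extChartAt (𝓡 7) x).symm
      (extChartAt (𝓡 7) x x) v = v := by
  have hy := mem_extChartAt_target (I := 𝓡 7) x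
  have hx : (extChartAt (𝓡 7) x).symm (extChartAt (𝓡 7) x x) = x := extChartAt_to_inv x
  have h := mfderiv_extChartAt_comp_symm (x' := x) hy
    (by rw [hx]; exact mem_extChartAt_source x) v
  rw [fderiv_transition_self hy] at h
  have h2 : ∀ z : K, z = x → ∀ w : EuclideanSpace ℝ (Fin 7),
      mfderiv (𝓡 7) 𝓘(ℝ, EuclideanSpace ℝ (Fin 7)) (extChartAt (𝓡 7) x) z w = w := by
    rintro z rfl w
    exact mfderiv_extChartAt_self z w
  exact (h2 _ hx _).symm.trans h

theorem inChart_self (α : Form K n F) (x : K) (v : Fin n → EuclideanSpace ℝ (Fin 7)) :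
    α.inChart x (extChartAt (𝓡 7) x x) v = α x v := by
  have h2 : ∀ z : K, z = x → ∀ w : Fin n → EuclideanSpace ℝ (Fin 7), α z w = α x w := by
    rintro z rfl w
    rfl
  refine Eq.trans ?_ (h2 _ (extChartAt_to_inv (I := 𝓡 7) x) v)
  exact (inChart_apply α x _ v).trans
    (congrArg _ (funext fun i => mfderiv_extChartAt_symm_self x (v i)))

theorem d_apply (α : Form K n F) (x : K) (v : Fin (n + 1) → EuclideanSpace ℝ (Fin 7)) :
    α.d x v = extDeriv (α.inChart x) (extChartAt (𝓡 7) x x) v :=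
  congrArg (extDeriv (α.inChart x) (extChartAt (𝓡 7) x x))
    (funext fun i => mfderiv_extChartAt_self x (v i))

/-- Two chart expressions of a form differ by pullback along the transition map. -/
theorem inChart_eq_pullback (α : Form K n F) {x x' : K} {y : EuclideanSpace ℝ (Fin 7)}
    (hy : y ∈ (extChartAt (𝓡 7) x).target)
    (hy' : (extChartAt (𝓡 7) x).symm y ∈ (extChartAt (𝓡 7) x').source) :
    α.inChart x y = (α.inChart x' (transition x x' y)).compContinuousLinearMap
      (fderiv ℝ (transition x x') y) := by
  have h2 : ∀ z z' : K, z = z' → ∀ w : Fin n → EuclideanSpace ℝ (Fin 7), α z w = α z' w := by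
    rintro z z' rfl w
    rfl
  ext v
  refine Eq.trans ?_ (h2 _ _ ((extChartAt (𝓡 7) x').left_inv hy').symm _)
  exact (inChart_apply α x y v).trans
    (congrArg _ (funext fun i => mfderiv_extChartAt_symm_eq hy hy' (v i)))

theorem eventually_inChart_eq_pullback (α : Form K n F) {x x' : K} {y : EuclideanSpace ℝ (Fin 7)}
    (hy : y ∈ (extChartAt (𝓡 7) x).target)
    (hy' : (extChartAt (𝓡 7) x).symm y ∈ (extChartAt (𝓡 7) x').source) :
    α.inChart x =ᶠ[𝓝 y] fun z => (α.inChart x' (transition x x' z)).compContinuousLinearMap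
      (fderiv ℝ (transition x x') z) := by
  have h := (continuousAt_extChartAt_symm'' (I := 𝓡 7) hy).preimage_mem_nhds
      ((isOpen_extChartAt_source (I := 𝓡 7) x').mem_nhds hy')
  filter_upwards [h, (isOpen_extChartAt_target (I := 𝓡 7) x).mem_nhds hy] with z hz hz'
  exact inChart_eq_pullback α hz' hz

/-- The chart expression of `dα` is the exterior derivative of the chart expression of `α`. -/
theorem inChart_d (α : Form K n F) {x : K} {y : EuclideanSpace ℝ (Fin 7)}
    (hy : y ∈ (extChartAt (𝓡 7) x).target) (hα : α.SmoothAt ((extChartAt (𝓡 7) x).symm y)) :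
    α.d.inChart x y = extDeriv (α.inChart x) y := by
  set x' := (extChartAt (𝓡 7) x).symm y with hx'
  have hy' : (extChartAt (𝓡 7) x).symm y ∈ (extChartAt (𝓡 7) x').source :=
    mem_extChartAt_source x'
  rw [(eventually_inChart_eq_pullback α hy hy').extDeriv_eq]
  have ht : transition x x' y = extChartAt (𝓡 7) x' x' := rfl
  rw [extDeriv_pullback (r := ∞) (by rw [ht]; exact hα.differentiableAt (by simp))
    (contDiffAt_transition hy hy') two_le_infty]
  ext v
  exact congrArg (extDeriv (α.inChart x') (extChartAt (𝓡 7) x' x'))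
    (funext fun i => mfderiv_extChartAt_comp_symm hy hy' (v i))

theorem eventually_inChart_d {α : Form K n F} {x : K} (hα : ∀ᶠ z in 𝓝 x, α.SmoothAt z) :
    α.d.inChart x =ᶠ[𝓝 (extChartAt (𝓡 7) x x)] extDeriv (α.inChart x) := by
  filter_upwards [(tendsto_extChartAt_symm x).eventually hα, eventually_mem_target x] with y hy hy'
  exact inChart_d α hy' hy

omit [IsManifold (𝓡 7) ∞ K] in
theorem inChart_congr {α β : Form K n F} {x : K} (h : ∀ᶠ z in 𝓝 x, α z = β z) :
    α.inChart x =ᶠ[𝓝 (extChartAt (𝓡 7) x x)] β.inChart x := by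
  filter_upwards [(tendsto_extChartAt_symm x).eventually h] with y hy
  unfold inChart
  rw [hy]

omit [IsManifold (𝓡 7) ∞ K] in
theorem d_congr {α β : Form K n F} {x : K} (h : ∀ᶠ z in 𝓝 x, α z = β z) : α.d x = β.d x := by
  unfold d
  rw [(inChart_congr h).extDeriv_eq]

theorem d_d {α : Form K n F} {x : K} (hα : ∀ᶠ z in 𝓝 x, α.SmoothAt z) : α.d.d x = 0 := by
  refine ContinuousAlternatingMap.ext fun v => (d_apply α.d x v).trans ?_
  rw [(eventually_inChart_d hα).extDeriv_eq,
    extDeriv_extDeriv_apply hα.self_of_nhds two_le_infty]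
  rfl

end Form

/-! ### Leibniz rules -/

section pullback

variable {M M' 𝔸 : Type*} [AddCommGroup M] [Module ℝ M] [TopologicalSpace M]
  [AddCommGroup M'] [Module ℝ M'] [TopologicalSpace M'] [NormedCommRing 𝔸] [NormedAlgebra ℝ 𝔸]

theorem wedgeAlt_compContinuousLinearMap {m n : ℕ} (α : M [⋀^Fin m]→L[ℝ] 𝔸)
    (β : M [⋀^Fin n]→L[ℝ] 𝔸) (T : M' →L[ℝ] M) :
    (wedgeAlt α β).compContinuousLinearMap T =
      wedgeAlt (α.compContinuousLinearMap T) (β.compContinuousLinearMap T) := by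
  ext v
  refine natCast_mul_cancel (mul_ne_zero m.factorial_ne_zero n.factorial_ne_zero) ?_
  rw [factorial_mul_wedgeAlt]
  exact factorial_mul_wedgeAlt α β _

end pullback

section smoothness

variable {E V F : Type*} [NormedAddCommGroup E] [NormedSpace ℝ E] [NormedAddCommGroup V]
  [NormedSpace ℝ V] [FiniteDimensional ℝ V] [NormedAddCommGroup F] [NormedSpace ℝ F]
  [FiniteDimensional ℝ F] {n : ℕ}

/-- A family of alternating maps on a finite-dimensional space is smooth as soon as all its
values on fixed vectors are. -/
theorem contDiffAt_of_apply {f : E → V [⋀^Fin n]→L[ℝ] F} {y : E}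
    (h : ∀ v, ContDiffAt ℝ ∞ (fun z => f z v) y) : ContDiffAt ℝ ∞ f y := by
  let b := Module.finBasis ℝ V
  let L : (V [⋀^Fin n]→L[ℝ] F) →ₗ[ℝ] ((Fin n → Fin (Module.finrank ℝ V)) → F) :=
    { toFun := fun g s => g (b ∘ s)
      map_add' := fun _ _ => rfl
      map_smul' := fun _ _ => rfl }
  have hL : LinearMap.ker L = ⊥ := by
    refine LinearMap.ker_eq_bot.2 fun g g' hg => ?_
    have : g.toAlternatingMap = g'.toAlternatingMap :=
      Module.Basis.ext_alternating b fun s _ => congrFun hg s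
    ext v
    exact congrArg (fun k : V [⋀^Fin n]→ₗ[ℝ] F => k v) this
  obtain ⟨R, hR⟩ := L.exists_leftInverse_of_injective hL
  have h1 : ContDiffAt ℝ ∞ (fun z => L (f z)) y := contDiffAt_pi.2 fun s => h _
  have h2 : f = fun z => LinearMap.toContinuousLinearMap R (L (f z)) := by
    funext z
    exact (LinearMap.congr_fun hR (f z)).symm
  rw [h2]
  exact (LinearMap.toContinuousLinearMap R).contDiff.contDiffAt.comp y h1

omit [FiniteDimensional ℝ V] [FiniteDimensional ℝ F] in
theorem ContDiffAt.apply_const {f : E → V [⋀^Fin n]→L[ℝ] F} {y : E} (h : ContDiffAt ℝ ∞ f y)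
    (v : Fin n → V) : ContDiffAt ℝ ∞ (fun z => f z v) y :=
  (ContinuousAlternatingMap.apply ℝ V F v).contDiff.contDiffAt.comp y h

end smoothness

namespace Form

variable {K : Type*} [TopologicalSpace K] [ChartedSpace (EuclideanSpace ℝ (Fin 7)) K]
  {F : Type*} [NormedAddCommGroup F] [NormedSpace ℝ F] {n : ℕ}
  {𝔸 : Type*} [NormedCommRing 𝔸] [NormedAlgebra ℝ 𝔸]

theorem inChart_wedge {m n : ℕ} (α : Form K m 𝔸) (β : Form K n 𝔸) (x : K)
    (y : EuclideanSpace ℝ (Fin 7)) :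
    (α ∧ᶠ β).inChart x y = wedgeAlt (α.inChart x y) (β.inChart x y) :=
  wedgeAlt_compContinuousLinearMap _ _ _

theorem SmoothAt.add {α β : Form K n F} {x : K} (hα : α.SmoothAt x) (hβ : β.SmoothAt x) :
    (α + β).SmoothAt x := ContDiffAt.add hα hβ

theorem SmoothAt.const_smul {α : Form K n F} {x : K} (c : ℝ) (hα : α.SmoothAt x) :
    (c • α).SmoothAt x := ContDiffAt.const_smul c hα

theorem SmoothAt.neg {α : Form K n F} {x : K} (hα : α.SmoothAt x) :
    (-α).SmoothAt x := ContDiffAt.neg hα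

theorem SmoothAt.zero {x : K} : (0 : Form K n F).SmoothAt x := contDiffAt_const (c := 0)

theorem SmoothAt.sum {ι : Type*} {s : Finset ι} {α : ι → Form K n F} {x : K}
    (h : ∀ i ∈ s, (α i).SmoothAt x) : (∑ i ∈ s, α i).SmoothAt x := by
  classical
  induction s using Finset.induction_on with
  | empty => exact SmoothAt.zero
  | insert i s hi ih =>
    rw [Finset.sum_insert hi]
    exact (h i (by simp)).add (ih fun j hj => h j (by simp [hj]))

theorem SmoothAt.wedge [FiniteDimensional ℝ 𝔸] {m n : ℕ} {α : Form K m 𝔸} {β : Form K n 𝔸} {x : K}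
    (hα : α.SmoothAt x) (hβ : β.SmoothAt x) : (α ∧ᶠ β).SmoothAt x := by
  refine contDiffAt_of_apply fun v => ?_
  have h : ∀ z, (α ∧ᶠ β).inChart x z v =
      ((m.factorial * n.factorial : ℕ) : ℝ)⁻¹ • ∑ σ : Equiv.Perm (Fin (m + n)),
        ((Equiv.Perm.sign σ : ℤ) : ℝ) • (α.inChart x z (fun i => v (σ (Fin.castAdd n i))) *
          β.inChart x z (fun i => v (σ (Fin.natAdd m i)))) := by
    intro z
    have hne : ((m.factorial * n.factorial : ℕ) : ℝ) ≠ 0 :=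
      Nat.cast_ne_zero.2 (mul_ne_zero m.factorial_ne_zero n.factorial_ne_zero)
    rw [inChart_wedge, eq_inv_smul_iff₀ hne, Algebra.smul_def, map_natCast, factorial_mul_wedgeAlt]
    simp only [altSum, Function.comp_apply, Int.cast_smul_eq_zsmul]
  simp only [h]
  refine ContDiffAt.const_smul _ (ContDiffAt.sum fun σ _ => ContDiffAt.const_smul _ ?_)
  exact (ContDiffAt.apply_const hα _).mul (ContDiffAt.apply_const hβ _)

theorem SmoothAt.differentiableAt {α : Form K n F} {x : K} (hα : α.SmoothAt x) :
    DifferentiableAt ℝ (α.inChart x) (extChartAt (𝓡 7) x x) :=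
  ContDiffAt.differentiableAt hα (by simp)

theorem SmoothAt.differentiableAt_apply {α : Form K n F} {x : K} (hα : α.SmoothAt x)
    (w : Fin n → EuclideanSpace ℝ (Fin 7)) :
    DifferentiableAt ℝ (fun y => α.inChart x y w) (extChartAt (𝓡 7) x x) :=
  (ContinuousAlternatingMap.apply ℝ _ F w).differentiableAt.comp _ hα.differentiableAt

theorem d_add {α β : Form K n F} {x : K} (hα : α.SmoothAt x) (hβ : β.SmoothAt x) :
    (α + β).d x = α.d x + β.d x := by
  have h := extDeriv_add hα.differentiableAt hβ.differentiableAt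
  exact congrArg (fun f => f.compContinuousLinearMap
    (mfderiv (𝓡 7) 𝓘(ℝ, EuclideanSpace ℝ (Fin 7)) (extChartAt (𝓡 7) x) x)) h

theorem d_smul (c : ℝ) (α : Form K n F) (x : K) : (c • α).d x = c • α.d x := by
  have h := extDeriv_smul (x := extChartAt (𝓡 7) x x) c (α.inChart x)
  exact congrArg (fun f => f.compContinuousLinearMap
    (mfderiv (𝓡 7) 𝓘(ℝ, EuclideanSpace ℝ (Fin 7)) (extChartAt (𝓡 7) x) x)) h

theorem d_neg (α : Form K n F) (x : K) : (-α).d x = -α.d x := by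
  have h := d_smul (-1) α x
  simpa only [neg_one_smul] using h

theorem d_zero (x : K) : (0 : Form K n F).d x = 0 := by
  have h := d_smul 0 (0 : Form K n F) x
  simpa only [zero_smul] using h

theorem d_sum {ι : Type*} {s : Finset ι} {α : ι → Form K n F} {x : K}
    (h : ∀ i ∈ s, (α i).SmoothAt x) : (∑ i ∈ s, α i).d x = ∑ i ∈ s, (α i).d x := by
  classical
  induction s using Finset.induction_on with
  | empty => exact d_zero x
  | insert i s hi ih =>
    rw [Finset.sum_insert hi, Finset.sum_insert hi, d_add (h i (by simp))
      (SmoothAt.sum fun j hj => h j (by simp [hj])), ih fun j hj => h j (by simp [hj])]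

/-- The derivative of the component `α(w)` of `α`, in the chart at `x`, in the direction `u`. -/
noncomputable def D (α : Form K n F) (x : K) (u : TangentSpace (𝓡 7) x)
    (w : Fin n → TangentSpace (𝓡 7) x) : F :=
  fderiv ℝ (fun y => α.inChart x y w) (extChartAt (𝓡 7) x x) u

variable [IsManifold (𝓡 7) ∞ K]

theorem d_eq_sum {α : Form K n F} {x : K} (hα : α.SmoothAt x)
    (v : Fin (n + 1) → TangentSpace (𝓡 7) x) :
    α.d x v = ∑ i, (-1) ^ i.val • α.D x (v i) (i.removeNth v) :=
  (d_apply α x v).trans (extDeriv_apply hα.differentiableAt v)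

theorem d_one {α : Form K 1 F} {x : K} (hα : α.SmoothAt x)
    (v : Fin (1 + 1) → TangentSpace (𝓡 7) x) :
    α.d x v = α.D x (v 0) ![v 1] - α.D x (v 1) ![v 0] := by
  rw [d_eq_sum hα]
  dsimp only [Nat.reduceAdd]
  simp only [Fin.sum_univ_two, removeNth_eq_vec_one]
  simp [sub_eq_add_neg]

theorem d_two {α : Form K 2 F} {x : K} (hα : α.SmoothAt x)
    (v : Fin (2 + 1) → TangentSpace (𝓡 7) x) :
    α.d x v = α.D x (v 0) ![v 1, v 2] - α.D x (v 1) ![v 0, v 2] + α.D x (v 2) ![v 0, v 1] := by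
  rw [d_eq_sum hα]
  dsimp only [Nat.reduceAdd]
  simp only [Fin.sum_univ_three, removeNth_eq_vec_two]
  simp [sub_eq_add_neg, Fin.succAbove]

theorem d_three {α : Form K 3 F} {x : K} (hα : α.SmoothAt x)
    (v : Fin (3 + 1) → TangentSpace (𝓡 7) x) :
    α.d x v = α.D x (v 0) ![v 1, v 2, v 3] - α.D x (v 1) ![v 0, v 2, v 3]
      + α.D x (v 2) ![v 0, v 1, v 3] - α.D x (v 3) ![v 0, v 1, v 2] := by
  rw [d_eq_sum hα]
  dsimp only [Nat.reduceAdd]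
  simp only [Fin.sum_univ_four, removeNth_eq_vec_three]
  simp [sub_eq_add_neg, Fin.succAbove]

theorem D_wedge_one_one {α β : Form K 1 𝔸} {x : K} (hα : α.SmoothAt x) (hβ : β.SmoothAt x)
    (u : TangentSpace (𝓡 7) x) (w : Fin (1 + 1) → TangentSpace (𝓡 7) x) :
    (α ∧ᶠ β).D x u w = (α.D x u ![w 0] * β x ![w 1] + α x ![w 0] * β.D x u ![w 1])
      - (α.D x u ![w 1] * β x ![w 0] + α x ![w 1] * β.D x u ![w 0]) := by
  -- The values of the forms at `x` are those of their chart expressions at the image of `x`; the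
  -- identity is proved in the model space, where the product rule for `fderiv` applies.
  have key : ∀ (u : EuclideanSpace ℝ (Fin 7)) (w : Fin 2 → EuclideanSpace ℝ (Fin 7))
      (a b : EuclideanSpace ℝ (Fin 7) [⋀^Fin 1]→L[ℝ] 𝔸) (y : EuclideanSpace ℝ (Fin 7)),
      y = extChartAt (𝓡 7) x x →
      (∀ v, α.inChart x y v = a v) → (∀ v, β.inChart x y v = b v) →
      fderiv ℝ (fun y => (α ∧ᶠ β).inChart x y w) y u =
        (fderiv ℝ (fun y => α.inChart x y ![w 0]) y u * b ![w 1]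
          + a ![w 0] * fderiv ℝ (fun y => β.inChart x y ![w 1]) y u)
        - (fderiv ℝ (fun y => α.inChart x y ![w 1]) y u * b ![w 0]
          + a ![w 1] * fderiv ℝ (fun y => β.inChart x y ![w 0]) y u) := by
    rintro u w a b y rfl ha hb
    have hα' := fun w => hα.differentiableAt_apply w
    have hβ' := fun w => hβ.differentiableAt_apply w
    simp only [inChart_wedge, wedgeAlt_one_one]
    rw [fderiv_fun_sub ((hα' _).fun_mul (hβ' _)) ((hα' _).fun_mul (hβ' _)),
      fderiv_fun_mul (hα' _) (hβ' _), fderiv_fun_mul (hα' _) (hβ' _)]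
    simp only [sub_apply, add_apply, smul_apply, ha, hb, smul_eq_mul]
    ring
  exact key u w (α x) (β x) _ rfl (inChart_self α x) (inChart_self β x)

theorem D_wedge_two_one {α : Form K 2 𝔸} {β : Form K 1 𝔸} {x : K} (hα : α.SmoothAt x)
    (hβ : β.SmoothAt x)
    (u : TangentSpace (𝓡 7) x) (w : Fin (2 + 1) → TangentSpace (𝓡 7) x) :
    (α ∧ᶠ β).D x u w =
      (α.D x u ![w 0, w 1] * β x ![w 2] + α x ![w 0, w 1] * β.D x u ![w 2])
      - (α.D x u ![w 0, w 2] * β x ![w 1] + α x ![w 0, w 2] * β.D x u ![w 1])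
      + (α.D x u ![w 1, w 2] * β x ![w 0] + α x ![w 1, w 2] * β.D x u ![w 0]) := by
  have key : ∀ (u : EuclideanSpace ℝ (Fin 7)) (w : Fin 3 → EuclideanSpace ℝ (Fin 7))
      (a : EuclideanSpace ℝ (Fin 7) [⋀^Fin 2]→L[ℝ] 𝔸)
      (b : EuclideanSpace ℝ (Fin 7) [⋀^Fin 1]→L[ℝ] 𝔸) (y : EuclideanSpace ℝ (Fin 7)),
      y = extChartAt (𝓡 7) x x →
      (∀ v, α.inChart x y v = a v) → (∀ v, β.inChart x y v = b v) →
      fderiv ℝ (fun y => (α ∧ᶠ β).inChart x y w) y u =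
        (fderiv ℝ (fun y => α.inChart x y ![w 0, w 1]) y u * b ![w 2]
          + a ![w 0, w 1] * fderiv ℝ (fun y => β.inChart x y ![w 2]) y u)
        - (fderiv ℝ (fun y => α.inChart x y ![w 0, w 2]) y u * b ![w 1]
          + a ![w 0, w 2] * fderiv ℝ (fun y => β.inChart x y ![w 1]) y u)
        + (fderiv ℝ (fun y => α.inChart x y ![w 1, w 2]) y u * b ![w 0]
          + a ![w 1, w 2] * fderiv ℝ (fun y => β.inChart x y ![w 0]) y u) := by
    rintro u w a b y rfl ha hb
    have hα' := fun w => hα.differentiableAt_apply w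
    have hβ' := fun w => hβ.differentiableAt_apply w
    simp only [inChart_wedge, wedgeAlt_two_one]
    rw [fderiv_fun_add (((hα' _).fun_mul (hβ' _)).fun_sub ((hα' _).fun_mul (hβ' _)))
        ((hα' _).fun_mul (hβ' _)),
      fderiv_fun_sub ((hα' _).fun_mul (hβ' _)) ((hα' _).fun_mul (hβ' _)),
      fderiv_fun_mul (hα' _) (hβ' _),
      fderiv_fun_mul (hα' _) (hβ' _), fderiv_fun_mul (hα' _) (hβ' _)]
    simp only [sub_apply, add_apply, smul_apply, ha, hb, smul_eq_mul]
    ring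
  exact key u w (α x) (β x) _ rfl (inChart_self α x) (inChart_self β x)

/-- The Leibniz rule for the product of two `1`-forms. -/
theorem d_wedge_one_one [FiniteDimensional ℝ 𝔸] {α β : Form K 1 𝔸} {x : K} (hα : α.SmoothAt x)
    (hβ : β.SmoothAt x) :
    (α ∧ᶠ β).d x = wedgeAlt (α.d x) (β x) - wedgeAlt (α x) (β.d x) := by
  refine ContinuousAlternatingMap.ext fun v => (d_two (hα.wedge hβ) v).trans ?_
  rw [ContinuousAlternatingMap.sub_apply, wedgeAlt_two_one]
  erw [wedgeAlt_one_two]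
  simp only [D_wedge_one_one hα hβ, d_one hα, d_one hβ, Matrix.cons_val_zero, Matrix.cons_val_one]
  ring

/-- The Leibniz rule for the product of a `2`-form and a `1`-form. -/
theorem d_wedge_two_one [FiniteDimensional ℝ 𝔸] {α : Form K 2 𝔸} {β : Form K 1 𝔸} {x : K}
    (hα : α.SmoothAt x) (hβ : β.SmoothAt x) :
    (α ∧ᶠ β).d x = wedgeAlt (α.d x) (β x) + wedgeAlt (α x) (β.d x) := by
  refine ContinuousAlternatingMap.ext fun v => (d_three (hα.wedge hβ) v).trans ?_
  rw [ContinuousAlternatingMap.add_apply, wedgeAlt_three_one]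
  erw [wedgeAlt_two_two]
  simp only [D_wedge_two_one hα hβ, d_two hα, d_one hβ, Matrix.cons_val_zero, Matrix.cons_val_one,
    Matrix.cons_val]
  ring

/-! ### Real and complex valued forms -/

omit [IsManifold (𝓡 7) ∞ K] in
theorem SmoothAt.toComplex {α : Form K n ℝ} {x : K} (hα : α.SmoothAt x) :
    α.toComplex.SmoothAt x :=
  contDiffAt_of_apply fun v =>
    Complex.ofRealCLM.contDiff.contDiffAt.comp _ (ContDiffAt.apply_const hα v)

omit [IsManifold (𝓡 7) ∞ K] in
theorem SmoothAt.re {α : Form K n ℂ} {x : K} (hα : α.SmoothAt x) : α.re.SmoothAt x :=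
  contDiffAt_of_apply fun v =>
    Complex.reCLM.contDiff.contDiffAt.comp _ (ContDiffAt.apply_const hα v)

omit [IsManifold (𝓡 7) ∞ K] in
theorem D_toComplex {α : Form K n ℝ} {x : K} (hα : α.SmoothAt x)
    (u : TangentSpace (𝓡 7) x) (w : Fin n → TangentSpace (𝓡 7) x) :
    α.toComplex.D x u w = (α.D x u w : ℂ) := by
  have h := Complex.ofRealCLM.hasFDerivAt.comp (extChartAt (𝓡 7) x x)
    (hα.differentiableAt_apply w).hasFDerivAt
  exact congrArg (fun f : EuclideanSpace ℝ (Fin 7) →L[ℝ] ℂ => f u) h.fderiv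

theorem d_toComplex {α : Form K n ℝ} {x : K} (hα : α.SmoothAt x)
    (v : Fin (n + 1) → TangentSpace (𝓡 7) x) :
    α.toComplex.d x v = (α.d x v : ℂ) := by
  refine (d_eq_sum hα.toComplex v).trans ?_
  refine Eq.trans ?_ (congrArg Complex.ofReal (d_eq_sum hα v)).symm
  simp only [D_toComplex hα, Complex.ofReal_sum]
  refine Finset.sum_congr rfl fun i _ => ?_
  simp

omit [IsManifold (𝓡 7) ∞ K] in
theorem SmoothAt.I_smul {α : Form K n ℂ} {x : K} (hα : α.SmoothAt x) :
    (Complex.I • α).SmoothAt x := ContDiffAt.const_smul Complex.I hα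

theorem d_I_smul {α : Form K n ℂ} {x : K} (hα : α.SmoothAt x)
    (v : Fin (n + 1) → TangentSpace (𝓡 7) x) :
    (Complex.I • α).d x v = Complex.I * α.d x v := by
  refine (d_eq_sum hα.I_smul v).trans ?_
  refine Eq.trans ?_ (congrArg (Complex.I * ·) (d_eq_sum hα v)).symm
  rw [Finset.mul_sum]
  refine Finset.sum_congr rfl fun i _ => ?_
  have h : (Complex.I • α).D x (v i) (i.removeNth v) =
      Complex.I * α.D x (v i) (i.removeNth v) :=
    congrArg (fun f : EuclideanSpace ℝ (Fin 7) →L[ℝ] ℂ => f (v i))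
      (fderiv_const_smul (hα.differentiableAt_apply (i.removeNth v)) Complex.I)
  rw [h, mul_smul_comm]

end Form

/-! ### Smooth vector fields and contractions -/

/-- The evaluation of a smooth family of alternating maps on smooth families of vectors is
smooth. -/
theorem ContDiffAt.alternating_apply {E V F : Type*} [NormedAddCommGroup E] [NormedSpace ℝ E]
    [NormedAddCommGroup V] [NormedSpace ℝ V] [FiniteDimensional ℝ V] [NormedAddCommGroup F]
    [NormedSpace ℝ F] {n : ℕ} {f : E → V [⋀^Fin n]→L[ℝ] F} {g : Fin n → E → V} {y : E}
    (hf : ContDiffAt ℝ ∞ f y) (hg : ∀ j, ContDiffAt ℝ ∞ (g j) y) :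
    ContDiffAt ℝ ∞ (fun z => f z (fun j => g j z)) y := by
  let b := Module.finBasis ℝ V
  have h : ∀ z, f z (fun j => g j z) = ∑ s : Fin n → Fin (Module.finrank ℝ V),
      (∏ j, b.repr (g j z) (s j)) • f z (fun j => b (s j)) := by
    intro z
    conv_lhs => rw [show (fun j => g j z) = fun j => ∑ i, b.repr (g j z) i • b i from
      funext fun j => (b.sum_repr (g j z)).symm]
    refine ((f z).toMultilinearMap.map_sum _).trans (Finset.sum_congr rfl fun s _ => ?_)
    exact (f z).toMultilinearMap.map_smul_univ _ _
  simp only [h]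
  refine ContDiffAt.sum fun s _ => ContDiffAt.smul (contDiffAt_prod fun j _ => ?_)
    (hf.apply_const _)
  exact (LinearMap.toContinuousLinearMap (b.coord (s j))).contDiff.contDiffAt.comp y (hg j)

namespace Form

variable {K : Type*} [TopologicalSpace K] [ChartedSpace (EuclideanSpace ℝ (Fin 7)) K]
  {F : Type*} [NormedAddCommGroup F] [NormedSpace ℝ F] {n : ℕ}

/-- The vector field `X` read in the preferred chart at `x`. -/
noncomputable def vfInChart (X : ∀ x : K, TangentSpace (𝓡 7) x) (x : K)
    (y : EuclideanSpace ℝ (Fin 7)) : EuclideanSpace ℝ (Fin 7) :=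
  mfderiv (𝓡 7) 𝓘(ℝ, EuclideanSpace ℝ (Fin 7)) (extChartAt (𝓡 7) x)
    ((extChartAt (𝓡 7) x).symm y) (X ((extChartAt (𝓡 7) x).symm y))

/-- The vector field `X` is smooth at `x`, read in the preferred chart at `x`. -/
def VfSmoothAt (X : ∀ x : K, TangentSpace (𝓡 7) x) (x : K) : Prop :=
  ContDiffAt ℝ ∞ (vfInChart X x) (extChartAt (𝓡 7) x x)

/-- The function `g` is smooth at `x`, read in the preferred chart at `x`. -/
def FunSmoothAt {G : Type*} [NormedAddCommGroup G] [NormedSpace ℝ G] (g : K → G) (x : K) : Prop :=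
  ContDiffAt ℝ ∞ (fun y => g ((extChartAt (𝓡 7) x).symm y)) (extChartAt (𝓡 7) x x)

/-- The field of endomorphisms `J` read in the preferred chart at `x`. -/
noncomputable def endInChart (J : ∀ x : K, TangentSpace (𝓡 7) x →L[ℝ] TangentSpace (𝓡 7) x) (x : K)
    (y : EuclideanSpace ℝ (Fin 7)) : EuclideanSpace ℝ (Fin 7) →L[ℝ] EuclideanSpace ℝ (Fin 7) :=
  (mfderiv (𝓡 7) 𝓘(ℝ, EuclideanSpace ℝ (Fin 7)) (extChartAt (𝓡 7) x)
    ((extChartAt (𝓡 7) x).symm y)).comp ((J ((extChartAt (𝓡 7) x).symm y)).comp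
      (mfderiv 𝓘(ℝ, EuclideanSpace ℝ (Fin 7)) (𝓡 7) (extChartAt (𝓡 7) x).symm y))

/-- The field of endomorphisms `J` is smooth at `x`, read in the preferred chart at `x`. -/
def EndSmoothAt (J : ∀ x : K, TangentSpace (𝓡 7) x →L[ℝ] TangentSpace (𝓡 7) x) (x : K) : Prop :=
  ContDiffAt ℝ ∞ (endInChart J x) (extChartAt (𝓡 7) x x)

theorem ContMDiffAt.funSmoothAt {G : Type*} [NormedAddCommGroup G] [NormedSpace ℝ G] {g : K → G}
    {x : K} (h : ContMDiffAt (𝓡 7) 𝓘(ℝ, G) ∞ g x) : FunSmoothAt g x := by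
  have h2 := (contMDiffAt_iff.1 h).2
  rwa [ModelWithCorners.range_eq_univ, contDiffWithinAt_univ] at h2

variable [IsManifold (𝓡 7) ∞ K]

omit [IsManifold (𝓡 7) ∞ K] in
theorem eventually_symm_mem_source (x : K) :
    ∀ᶠ y in 𝓝 (extChartAt (𝓡 7) x x),
      (extChartAt (𝓡 7) x).symm y ∈ (chartAt (EuclideanSpace ℝ (Fin 7)) x).source :=
  (tendsto_extChartAt_symm x).eventually ((chartAt _ x).open_source.mem_nhds (mem_chart_source _ x))

theorem endSmoothAt_of_contMDiffAt
    {J : ∀ x : K, TangentSpace (𝓡 7) x →L[ℝ] TangentSpace (𝓡 7) x} {x : K}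
    (h : ContMDiffAt (𝓡 7)
      ((𝓡 7).prod 𝓘(ℝ, EuclideanSpace ℝ (Fin 7) →L[ℝ] EuclideanSpace ℝ (Fin 7))) ∞
      (fun x => Bundle.TotalSpace.mk' (EuclideanSpace ℝ (Fin 7) →L[ℝ] EuclideanSpace ℝ (Fin 7))
      (E := fun x : K => TangentSpace (𝓡 7) x →L[ℝ] TangentSpace (𝓡 7) x) x (J x)) x) :
    EndSmoothAt J x := by
  have : IsManifold (𝓡 7) 1 K := .of_le (n := ∞) (by norm_cast)
  have h2 := ContMDiffAt.funSmoothAt ((contMDiffAt_hom_bundle _).1 h).2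
  refine ContDiffAt.congr_of_eventuallyEq h2 ?_
  filter_upwards [eventually_symm_mem_source x, eventually_mem_target x] with y hy hy'
  have h3 := inTangentCoordinates_eq_mfderiv_comp (I := 𝓡 7) (I' := 𝓡 7) (f := fun z : K => z)
    (g := fun z : K => z) (ϕ := J) (x₀ := x) hy hy
  refine Eq.trans ?_ h3.symm
  rw [ModelWithCorners.range_eq_univ, mfderivWithin_univ]
  have h4 : extChartAt (𝓡 7) x ((extChartAt (𝓡 7) x).symm y) = y :=
    (extChartAt (𝓡 7) x).right_inv hy'
  unfold endInChart
  ext1 v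
  have h5 : ∀ y', y' = y → ∀ v w : EuclideanSpace ℝ (Fin 7), w =
      mfderiv 𝓘(ℝ, EuclideanSpace ℝ (Fin 7)) (𝓡 7) (extChartAt (𝓡 7) x).symm y v → w =
      mfderiv 𝓘(ℝ, EuclideanSpace ℝ (Fin 7)) (𝓡 7) (extChartAt (𝓡 7) x).symm y' v := by
    rintro y' rfl v w h; exact h
  exact congrArg (fun w : EuclideanSpace ℝ (Fin 7) =>
    mfderiv (𝓡 7) 𝓘(ℝ, EuclideanSpace ℝ (Fin 7)) (extChartAt (𝓡 7) x)
    ((extChartAt (𝓡 7) x).symm y) (J ((extChartAt (𝓡 7) x).symm y) w)) (h5 _ h4 v _ rfl)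

theorem vfSmoothAt_of_contMDiffAt {X : ∀ x : K, TangentSpace (𝓡 7) x} {x : K}
    (h : ContMDiffAt (𝓡 7) (𝓡 7).tangent ∞ (fun x => (⟨x, X x⟩ : TangentBundle (𝓡 7) K)) x) :
    VfSmoothAt X x := by
  have : IsManifold (𝓡 7) 1 K := .of_le (n := ∞) (by norm_cast)
  have h2 := ContMDiffAt.funSmoothAt ((Bundle.contMDiffAt_section x).1 h)
  refine ContDiffAt.congr_of_eventuallyEq h2 ?_
  filter_upwards [eventually_symm_mem_source x] with y hy
  have h3 : mfderiv (𝓡 7) 𝓘(ℝ, EuclideanSpace ℝ (Fin 7)) (extChartAt (𝓡 7) x)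
      ((extChartAt (𝓡 7) x).symm y) = mfderiv (𝓡 7) (𝓡 7) (chartAt (EuclideanSpace ℝ (Fin 7)) x)
      ((extChartAt (𝓡 7) x).symm y) := (hasMFDerivAt_extChartAt (I := 𝓡 7) hy).mfderiv
  unfold vfInChart
  rw [h3, mfderiv_chartAt_eq_tangentCoordChange hy]
  rfl

theorem mfderiv_symm_comp_extChartAt {x : K} {y : EuclideanSpace ℝ (Fin 7)}
    (hy : y ∈ (extChartAt (𝓡 7) x).target) (v : TangentSpace (𝓡 7) ((extChartAt (𝓡 7) x).symm y)) :
    mfderiv 𝓘(ℝ, EuclideanSpace ℝ (Fin 7)) (𝓡 7) (extChartAt (𝓡 7) x).symm y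
      (mfderiv (𝓡 7) 𝓘(ℝ, EuclideanSpace ℝ (Fin 7)) (extChartAt (𝓡 7) x)
        ((extChartAt (𝓡 7) x).symm y) v) = v := by
  have : IsManifold (𝓡 7) 1 K := .of_le (n := ∞) (by norm_cast)
  have h := mfderivWithin_extChartAt_symm_comp_mfderiv_extChartAt (I := 𝓡 7) hy
  rw [ModelWithCorners.range_eq_univ, mfderivWithin_univ] at h
  exact congrArg (fun f => f v) h

theorem FunSmoothAt.apply {m : ℕ} {α : Form K m F} {X : Fin m → ∀ x : K, TangentSpace (𝓡 7) x}
    {x : K} (hα : α.SmoothAt x) (hX : ∀ j, VfSmoothAt (X j) x) :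
    FunSmoothAt (fun z => α z (fun j => X j z)) x := by
  refine ContDiffAt.congr_of_eventuallyEq (ContDiffAt.alternating_apply hα hX) ?_
  filter_upwards [eventually_mem_target x] with y hy
  exact congrArg (α ((extChartAt (𝓡 7) x).symm y))
    (funext fun j => (mfderiv_symm_comp_extChartAt hy _).symm)

/-- The contraction of a form with a vector field. -/
noncomputable def contract (X : ∀ x : K, TangentSpace (𝓡 7) x) (α : Form K (n + 1) F) :
    Form K n F :=
  fun x => ContinuousAlternatingMap.curryLeft (E := EuclideanSpace ℝ (Fin 7)) (α x) (X x)

theorem SmoothAt.contract [FiniteDimensional ℝ F] {X : ∀ x : K, TangentSpace (𝓡 7) x}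
    {α : Form K (n + 1) F} {x : K} (hX : VfSmoothAt X x) (hα : α.SmoothAt x) :
    (contract X α).SmoothAt x := by
  refine contDiffAt_of_apply fun v => ?_
  have hX' : ∀ j, ContDiffAt ℝ ∞ ((Fin.cons (vfInChart X x) (fun j _ => v j) :
      Fin (n + 1) → EuclideanSpace ℝ (Fin 7) → EuclideanSpace ℝ (Fin 7)) j)
      (extChartAt (𝓡 7) x x) := by
    refine Fin.cases ?_ fun j => ?_
    · exact hX
    · exact contDiffAt_const
  refine ContDiffAt.congr_of_eventuallyEq (ContDiffAt.alternating_apply hα hX') ?_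
  filter_upwards [eventually_mem_target x] with y hy
  refine congrArg (α ((extChartAt (𝓡 7) x).symm y)) (funext fun j => ?_)
  refine Fin.cases ?_ (fun j => ?_) j
  · exact (mfderiv_symm_comp_extChartAt hy _).symm
  · rfl

omit [IsManifold (𝓡 7) ∞ K] in
theorem SmoothAt.fun_smul {α : Form K n F} {g : K → ℝ} {x : K} (hg : FunSmoothAt g x)
    (hα : α.SmoothAt x) : SmoothAt (fun z => g z • α z) x :=
  ContDiffAt.smul hg hα

theorem SmoothAt.d {α : Form K n F} {x : K} (hα : ∀ᶠ z in 𝓝 x, α.SmoothAt z) :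
    α.d.SmoothAt x := by
  refine ContDiffAt.congr_of_eventuallyEq ?_ (eventually_inChart_d hα)
  have h : ContDiffAt ℝ ∞ (fderiv ℝ (α.inChart x)) (extChartAt (𝓡 7) x x) :=
    ContDiffAt.fderiv_right (m := ∞) hα.self_of_nhds (by simp)
  exact (ContinuousAlternatingMap.alternatizeUncurryFinCLM ℝ (EuclideanSpace ℝ (Fin 7))
    F).contDiff.contDiffAt.comp _ h

theorem VfSmoothAt.end_apply {J : ∀ x : K, TangentSpace (𝓡 7) x →L[ℝ] TangentSpace (𝓡 7) x}
    {X : ∀ x : K, TangentSpace (𝓡 7) x} {x : K} (hJ : EndSmoothAt J x) (hX : VfSmoothAt X x) :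
    VfSmoothAt (fun z => J z (X z)) x := by
  refine ContDiffAt.congr_of_eventuallyEq (ContDiffAt.clm_apply hJ hX) ?_
  filter_upwards [eventually_mem_target x] with y hy
  exact congrArg (fun w => mfderiv (𝓡 7) 𝓘(ℝ, EuclideanSpace ℝ (Fin 7)) (extChartAt (𝓡 7) x)
    ((extChartAt (𝓡 7) x).symm y) (J ((extChartAt (𝓡 7) x).symm y) w))
    (mfderiv_symm_comp_extChartAt hy _).symm

omit [IsManifold (𝓡 7) ∞ K] in
theorem VfSmoothAt.add {X Y : ∀ x : K, TangentSpace (𝓡 7) x} {x : K} (hX : VfSmoothAt X x)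
    (hY : VfSmoothAt Y x) : VfSmoothAt (fun z => X z + Y z) x := by
  refine ContDiffAt.congr_of_eventuallyEq (ContDiffAt.add hX hY) (.of_forall fun y => ?_)
  exact map_add (mfderiv (𝓡 7) 𝓘(ℝ, EuclideanSpace ℝ (Fin 7)) (extChartAt (𝓡 7) x)
    ((extChartAt (𝓡 7) x).symm y)) _ _

omit [IsManifold (𝓡 7) ∞ K] in
theorem VfSmoothAt.fun_smul {X : ∀ x : K, TangentSpace (𝓡 7) x} {g : K → ℝ} {x : K}
    (hg : FunSmoothAt g x) (hX : VfSmoothAt X x) : VfSmoothAt (fun z => g z • X z) x := by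
  refine ContDiffAt.congr_of_eventuallyEq (ContDiffAt.smul hg hX) (.of_forall fun y => ?_)
  exact map_smul (mfderiv (𝓡 7) 𝓘(ℝ, EuclideanSpace ℝ (Fin 7)) (extChartAt (𝓡 7) x)
    ((extChartAt (𝓡 7) x).symm y)) _ _

/-- The vector field which is constant, equal to `v`, in the preferred chart at `x₀`. -/
noncomputable def constVf (x₀ : K) (v : EuclideanSpace ℝ (Fin 7)) (x : K) : TangentSpace (𝓡 7) x :=
  show EuclideanSpace ℝ (Fin 7) from
    mfderiv 𝓘(ℝ, EuclideanSpace ℝ (Fin 7)) (𝓡 7) (extChartAt (𝓡 7) x₀).symm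
      (extChartAt (𝓡 7) x₀ x) v

theorem constVf_self (x₀ : K) (v : EuclideanSpace ℝ (Fin 7)) : constVf x₀ v x₀ = v :=
  mfderiv_extChartAt_symm_self x₀ v

theorem VfSmoothAt.constVf {x₀ x : K} (hx : x ∈ (extChartAt (𝓡 7) x₀).source)
    (v : EuclideanSpace ℝ (Fin 7)) : VfSmoothAt (constVf x₀ v) x := by
  have hy := mem_extChartAt_target (I := 𝓡 7) x
  have hx' : (extChartAt (𝓡 7) x).symm (extChartAt (𝓡 7) x x) = x := extChartAt_to_inv x
  have h1 : ContDiffAt ℝ ∞ (transition x x₀) (extChartAt (𝓡 7) x x) :=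
    contDiffAt_transition hy (by rwa [hx'])
  have hxx : transition x x₀ (extChartAt (𝓡 7) x x) = extChartAt (𝓡 7) x₀ x :=
    congrArg (extChartAt (𝓡 7) x₀) hx'
  have h2 : ContDiffAt ℝ ∞ (transition x₀ x) (transition x x₀ (extChartAt (𝓡 7) x x)) := by
    rw [hxx]
    refine contDiffAt_transition ((extChartAt (𝓡 7) x₀).map_source hx) ?_
    rw [(extChartAt (𝓡 7) x₀).left_inv hx]
    exact mem_extChartAt_source x
  have h3 : ContDiffAt ℝ ∞ (fun y => fderiv ℝ (transition x₀ x) (transition x x₀ y) v)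
      (extChartAt (𝓡 7) x x) :=
    ((h2.fderiv_right (m := ∞) (by simp)).comp _ h1).clm_apply contDiffAt_const
  refine ContDiffAt.congr_of_eventuallyEq h3 ?_
  have hs := (tendsto_extChartAt_symm x).eventually
    ((isOpen_extChartAt_source (I := 𝓡 7) x₀).mem_nhds hx)
  have hs' := (tendsto_extChartAt_symm x).eventually
    ((isOpen_extChartAt_source (I := 𝓡 7) x).mem_nhds (mem_extChartAt_source x))
  filter_upwards [hs, hs'] with y hy₀ hy₁
  have h4 := (extChartAt (𝓡 7) x₀).left_inv hy₀
  have h5 : ∀ z z' : K, z = z' → ∀ w : EuclideanSpace ℝ (Fin 7),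
      mfderiv (𝓡 7) 𝓘(ℝ, EuclideanSpace ℝ (Fin 7)) (extChartAt (𝓡 7) x) z' w =
      mfderiv (𝓡 7) 𝓘(ℝ, EuclideanSpace ℝ (Fin 7)) (extChartAt (𝓡 7) x) z w := by
    rintro z z' rfl w; rfl
  refine Eq.trans (h5 _ _ h4 _) ?_
  exact mfderiv_extChartAt_comp_symm ((extChartAt (𝓡 7) x₀).map_source hy₀) (by rwa [h4]) v

omit [IsManifold (𝓡 7) ∞ K] in
theorem FunSmoothAt.continuousAt {G : Type*} [NormedAddCommGroup G] [NormedSpace ℝ G] {g : K → G}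
    {x : K} (h : FunSmoothAt g x) : ContinuousAt g x := by
  have h1 : ContinuousAt (fun z => g ((extChartAt (𝓡 7) x).symm (extChartAt (𝓡 7) x z))) x :=
    ContinuousAt.comp (f := extChartAt (𝓡 7) x)
      (g := fun y => g ((extChartAt (𝓡 7) x).symm y)) (ContDiffAt.continuousAt h) (continuousAt_extChartAt x)
  refine h1.congr ?_
  filter_upwards [(isOpen_extChartAt_source (I := 𝓡 7) x).mem_nhds (mem_extChartAt_source x)]
    with z hz
  rw [(extChartAt (𝓡 7) x).left_inv hz]

end Form

namespace ContactCalabiYau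

variable {K : Type*} [TopologicalSpace K] [ChartedSpace (EuclideanSpace ℝ (Fin 7)) K]
  [IsManifold (𝓡 7) ∞ K] (S : ContactCalabiYau K)

theorem endSmoothAt_J (x : K) : Form.EndSmoothAt S.J x :=
  Form.endSmoothAt_of_contMDiffAt (S.smooth_J x)

theorem vfSmoothAt_ξ (x : K) : Form.VfSmoothAt S.ξ x :=
  Form.vfSmoothAt_of_contMDiffAt (S.smooth_ξ x)

theorem JForm_apply (α : Form K 1 ℝ) (x : K) (v : Fin 1 → TangentSpace (𝓡 7) x) :
    S.JForm α x v = -α x ![S.J x (v 0)] := by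
  refine congrArg Neg.neg (congrArg (α x) (funext fun j => ?_))
  fin_cases j
  rfl

theorem smoothAt_JForm {α : Form K 1 ℝ} {x : K} (hα : α.SmoothAt x) :
    (S.JForm α).SmoothAt x := by
  refine contDiffAt_of_apply fun v => ?_
  have h := ContDiffAt.alternating_apply (g := fun j y => Form.endInChart S.J x y (v j)) hα
    (fun j => ContDiffAt.clm_apply (S.endSmoothAt_J x) contDiffAt_const)
  refine ContDiffAt.congr_of_eventuallyEq h.neg ?_
  filter_upwards [Form.eventually_mem_target x] with y hy
  refine congrArg Neg.neg (congrArg (α ((extChartAt (𝓡 7) x).symm y)) (funext fun j => ?_))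
  exact (Form.mfderiv_symm_comp_extChartAt hy _).symm

end ContactCalabiYau

/-! ### Components in a dual frame -/

section frame

variable {M : Type*} [AddCommGroup M] [Module ℝ M] [TopologicalSpace M]

/-- A `6`-form on a `7`-dimensional space is determined by its values on the six-element
subsequences of a basis. -/
theorem ContinuousAlternatingMap.ext_six (f : Module.Basis (Fin 7) ℝ M)
    {α β : M [⋀^Fin 6]→L[ℝ] ℝ}
    (h : ∀ c : Fin 7, α (fun i => f (c.succAbove i)) = β (fun i => f (c.succAbove i))) : α = β := by
  have h2 : α.toAlternatingMap = β.toAlternatingMap := by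
    refine Module.Basis.ext_alternating f fun s hs => ?_
    obtain ⟨c, hc⟩ : ∃ c : Fin 7, ∀ i, s i ≠ c := by
      by_contra! hne
      have h1 : Function.Surjective s := hne
      have := Fintype.card_le_of_surjective s h1
      simp at this
    choose σ hσ using fun i => Fin.exists_succAbove_eq (hc i)
    have hσi : Function.Injective σ := fun i j hij => hs (by rw [← hσ i, ← hσ j, hij])
    let τ : Equiv.Perm (Fin 6) := Equiv.ofBijective σ (Finite.injective_iff_bijective.1 hσi)
    have hs2 : (fun i => f (s i)) = (fun i => f (c.succAbove i)) ∘ τ := by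
      funext i
      exact congrArg f (hσ i).symm
    rw [hs2, AlternatingMap.map_perm, AlternatingMap.map_perm]
    exact congrArg _ (h c)
  ext v
  exact congrArg (fun k : M [⋀^Fin 6]→ₗ[ℝ] ℝ => k v) h2

/-- The Kronecker symbol: the value of the `i`-th coframe element on the `j`-th frame element. -/
noncomputable def kron (i j : Fin 7) : ℝ := if i = j then 1 else 0

/-- The components of `∑ eᵢ ∧ Jeᵢ` in the frame dual to `(e₀, e, Je)`. -/
noncomputable def omegaCoeff (i j : Fin 7) : ℝ :=
  (kron 1 i * kron 4 j - kron 1 j * kron 4 i) + (kron 2 i * kron 5 j - kron 2 j * kron 5 i)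
    + (kron 3 i * kron 6 j - kron 3 j * kron 6 i)

/-- The determinant of the components of three frame elements along three coframe elements. -/
noncomputable def kronDet (a b c i j k : Fin 7) : ℝ :=
  (kron a i * kron b j - kron a j * kron b i) * kron c k
    - (kron a i * kron b k - kron a k * kron b i) * kron c j
    + (kron a j * kron b k - kron a k * kron b j) * kron c i

/-- The components of the imaginary part of `(e₁ + i Je₁) ∧ (e₂ + i Je₂) ∧ (e₃ + i Je₃)` in the
frame dual to `(e₀, e, Je)`. -/
noncomputable def imOmegaCoeff (i j k : Fin 7) : ℝ :=
  kronDet 4 2 3 i j k + kronDet 1 5 3 i j k + kronDet 1 2 6 i j k - kronDet 4 5 6 i j k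

variable {f : Fin 7 → M} {w : M [⋀^Fin 2]→L[ℝ] ℝ} {h : M [⋀^Fin 1]→L[ℝ] ℝ}
  {t : M [⋀^Fin 3]→L[ℝ] ℝ} {ε : ℝ}

/-- The component of `R ∧ ψ` on all frame elements except the one with the given index, for a
`2`-form `R` with components `r`. -/
def psiContraction (r : Fin 7 → Fin 7 → ℝ) : Fin 7 → ℝ :=
  ![-(r 1 4 + r 2 5 + r 3 6), -r 0 4 + r 2 3 - r 5 6, r 0 5 + r 1 3 - r 4 6,
    -r 0 6 + r 1 2 - r 4 5, -r 0 1 + r 2 6 - r 3 5, r 0 2 + r 1 6 - r 3 4, -r 0 3 + r 1 5 - r 2 4]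

/-- The components of `ψ` in such a frame. -/
theorem psi_apply (hw : ∀ i j, w ![f i, f j] = omegaCoeff i j) (hh : ∀ i, ε * h ![f i] = kron 0 i)
    (ht : ∀ i j k, t ![f i, f j, f k] = imOmegaCoeff i j k) (i j k l : Fin 7) :
    ((1 / 2 : ℝ) • wedgeAlt w w - ε • wedgeAlt h t) ![f i, f j, f k, f l] =
      (omegaCoeff i j * omegaCoeff k l - omegaCoeff i k * omegaCoeff j l
        + omegaCoeff i l * omegaCoeff j k)
      - (kron 0 i * imOmegaCoeff j k l - kron 0 j * imOmegaCoeff i k l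
        + kron 0 k * imOmegaCoeff i j l - kron 0 l * imOmegaCoeff i j k) := by
  have h1 := wedgeAlt_two_two w w ![f i, f j, f k, f l]
  have h2 := wedgeAlt_one_three h t ![f i, f j, f k, f l]
  simp only [Matrix.cons_val, hw, ht] at h1 h2
  have h3 : ((1 / 2 : ℝ) • wedgeAlt w w - ε • wedgeAlt h t) ![f i, f j, f k, f l] =
    (1 / 2 : ℝ) * wedgeAlt w w ![f i, f j, f k, f l] - ε * wedgeAlt h t ![f i, f j, f k, f l] := rfl
  rw [h3, h1, h2, ← hh i, ← hh j, ← hh k, ← hh l]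
  ring

/-- The components of `R ∧ ψ` in a frame in which `ω`, `e₀` and `Im Ω` have their standard
components. -/
theorem wedge_psi_apply (R : M [⋀^Fin 2]→L[ℝ] ℝ)
    (hw : ∀ i j, w ![f i, f j] = omegaCoeff i j) (hh : ∀ i, ε * h ![f i] = kron 0 i)
    (ht : ∀ i j k, t ![f i, f j, f k] = imOmegaCoeff i j k) (c : Fin 7) :
    wedgeAlt R ((1 / 2 : ℝ) • wedgeAlt w w - ε • wedgeAlt h t) (fun i => f (c.succAbove i)) =
      psiContraction (fun i j => R ![f i, f j]) c := by
  rw [wedgeAlt_two_four]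
  simp only [psi_apply hw hh ht]
  fin_cases c <;>
  simp [Fin.succAbove, psiContraction, omegaCoeff, imOmegaCoeff, kronDet, kron] <;> ring

/-- The components of `½ ω ∧ ω` in the frame. -/
theorem half_wedge_self_apply (hw : ∀ i j, w ![f i, f j] = omegaCoeff i j) (i j k l : Fin 7) :
    ((1 / 2 : ℝ) • wedgeAlt w w) ![f i, f j, f k, f l] =
      omegaCoeff i j * omegaCoeff k l - omegaCoeff i k * omegaCoeff j l
        + omegaCoeff i l * omegaCoeff j k := by
  have h1 := wedgeAlt_two_two w w ![f i, f j, f k, f l]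
  simp only [Matrix.cons_val, hw] at h1
  have h3 : ((1 / 2 : ℝ) • wedgeAlt w w) ![f i, f j, f k, f l] =
    (1 / 2 : ℝ) * wedgeAlt w w ![f i, f j, f k, f l] := rfl
  rw [h3, h1]
  ring

theorem omega_cubed_apply (hw : ∀ i j, w ![f i, f j] = omegaCoeff i j) (c : Fin 7) :
    ((1 / 6 : ℝ) • wedgeAlt (wedgeAlt w w) w) (fun i => f (c.succAbove i)) = -kron 0 c := by
  have h0 : ((1 / 6 : ℝ) • wedgeAlt (wedgeAlt w w) w) (fun i => f (c.succAbove i)) =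
    (1 / 3 : ℝ) * wedgeAlt ((1 / 2 : ℝ) • wedgeAlt w w) w (fun i => f (c.succAbove i)) := by
    rw [wedgeAlt_four_two]
    have h1 := wedgeAlt_four_two (wedgeAlt w w) w (fun i => f (c.succAbove i))
    have h3 : ((1 / 6 : ℝ) • wedgeAlt (wedgeAlt w w) w) (fun i => f (c.succAbove i)) =
      (1 / 6 : ℝ) * wedgeAlt (wedgeAlt w w) w (fun i => f (c.succAbove i)) := rfl
    rw [h3, h1]
    simp only [ContinuousAlternatingMap.smul_apply, smul_eq_mul]
    ring
  rw [h0, wedgeAlt_four_two]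
  simp only [half_wedge_self_apply hw, hw]
  fin_cases c <;>
  simp [Fin.succAbove, omegaCoeff, kron]
  norm_num

theorem e0_omega_sq_apply (hw : ∀ i j, w ![f i, f j] = omegaCoeff i j)
    (hh : ∀ i, ε * h ![f i] = kron 0 i) (E : M [⋀^Fin 1]→L[ℝ] ℝ) (c : Fin 7) :
    wedgeAlt (wedgeAlt (ε • h) ((1 / 2 : ℝ) • wedgeAlt w w)) E (fun i => f (c.succAbove i)) =
      (![0, -E ![f 4], E ![f 5], -E ![f 6], -E ![f 1], E ![f 2], -E ![f 3]] : Fin 7 → ℝ) c := by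
  rw [wedgeAlt_five_one]
  have h4 : ∀ i, (ε • h) ![f i] = kron 0 i := hh
  simp only [wedgeAlt_one_four, Matrix.cons_val, half_wedge_self_apply hw, h4]
  fin_cases c <;>
  simp [Fin.succAbove, omegaCoeff, kron]

end frame

/-! ### Dual frames of an `SU(3)`-coframe -/

section frame

variable {K : Type*} [TopologicalSpace K] [ChartedSpace (EuclideanSpace ℝ (Fin 7)) K]
  [IsManifold (𝓡 7) ∞ K]

/-- A `1`-form at a point as a linear functional. -/
noncomputable def ContinuousAlternatingMap.toFunctional {M : Type*} [AddCommGroup M] [Module ℝ M]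
    [TopologicalSpace M] (α : M [⋀^Fin 1]→L[ℝ] ℝ) : M →ₗ[ℝ] ℝ where
  toFun v := α ![v]
  map_add' v w := by
    have hu : ∀ u : M, Function.update ![v] 0 u = ![u] := fun u =>
      funext fun i => by rw [Subsingleton.elim i 0]; simp
    have h := α.map_update_add ![v] 0 v w
    rwa [hu, hu, hu] at h
  map_smul' r v := by
    have hu : ∀ u : M, Function.update ![v] 0 u = ![u] := fun u =>
      funext fun i => by rw [Subsingleton.elim i 0]; simp
    have h := α.map_update_smul ![v] 0 r v
    rwa [hu, hu] at h

/-- The numbering of the coframe `(e₀, e, Je)` by `0, …, 6`. -/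
def Idx.toFin : Idx → Fin 7 := Sum.elim (fun _ => 0) (Sum.elim ![1, 2, 3] ![4, 5, 6])

theorem Idx.toFin_surjective : Function.Surjective Idx.toFin := by decide

theorem Idx.toFin_injective : Function.Injective Idx.toFin := by decide

namespace ContactCalabiYau

variable {S : ContactCalabiYau K}

namespace SU3Coframe

variable (c : S.SU3Coframe) {ε : ℝ} {x : K}

/-- The coframe `(e₀, e, Je)`. -/
noncomputable def coframe (ε : ℝ) : Idx → Form K 1 ℝ :=
  Sum.elim (fun _ => S.e₀ ε) (Sum.elim c.e c.Je)

theorem omega_apply (hx : x ∈ c.U) (v w : TangentSpace (𝓡 7) x) :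
    S.omega x ![v, w] =
      ∑ i, (c.e i x ![v] * c.Je i x ![w] - c.e i x ![w] * c.Je i x ![v]) := by
  rw [c.omega_eq x hx]
  have h : (∑ i, c.e i ∧ᶠ S.JForm (c.e i) : Form K 2 ℝ) x ![v, w] =
      ∑ i, wedgeAlt (c.e i x) (c.Je i x) ![v, w] := by
    rw [Finset.sum_apply, ContinuousAlternatingMap.sum_apply]
    rfl
  rw [h]
  exact Finset.sum_congr rfl fun i _ => (wedgeAlt_one_one _ _ _)

theorem Omega_apply (hx : x ∈ c.U) (u v w : TangentSpace (𝓡 7) x) :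
    S.Ω x ![u, v, w] =
      let t (i : Fin 3) (v : TangentSpace (𝓡 7) x) : ℂ :=
        c.e i x ![v] + Complex.I * c.Je i x ![v]
      (t 0 u * t 1 v - t 0 v * t 1 u) * t 2 w - (t 0 u * t 1 w - t 0 w * t 1 u) * t 2 v
        + (t 0 v * t 1 w - t 0 w * t 1 v) * t 2 u := by
  rw [c.Omega_eq x hx]
  refine (wedgeAlt_two_one _ _ _).trans ?_
  have h : ∀ v w : TangentSpace (𝓡 7) x, wedgeAlt
      (((c.e 0).toComplex + Complex.I • (S.JForm (c.e 0)).toComplex) x)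
      (((c.e 1).toComplex + Complex.I • (S.JForm (c.e 1)).toComplex) x) ![v, w] = 
      (c.e 0 x ![v] + Complex.I * c.Je 0 x ![v]) * (c.e 1 x ![w] + Complex.I * c.Je 1 x ![w]) -
      (c.e 0 x ![w] + Complex.I * c.Je 0 x ![w]) * (c.e 1 x ![v] + Complex.I * c.Je 1 x ![v]) :=
    fun v w => wedgeAlt_one_one _ _ _
  exact congrArg₂ (· + ·) (congrArg₂ (· - ·) (congrArg (· * _) (h u v)) (congrArg (· * _) (h u w)))
    (congrArg (· * _) (h v w))

/-- The vectors `f` are dual to the coframe `(e₀, e, Je)` at `x`, numbered by `Idx.toFin`. Such a frame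
is automatically a basis, see `IsDualFrame.eq_basis`. -/
def IsDualFrame (ε : ℝ) (x : K) (f : Fin 7 → TangentSpace (𝓡 7) x) : Prop :=
  ∀ (a : Idx) (j : Fin 7), c.coframe ε a x ![f j] = kron a.toFin j

theorem exists_isDualFrame (hε : 0 < ε) (hx : x ∈ c.U) :
    ∃ f : Module.Basis (Fin 7) ℝ (TangentSpace (𝓡 7) x), c.IsDualFrame ε x f := by
  let idx : Fin 7 → Idx := Function.surjInv Idx.toFin_surjective
  let L : TangentSpace (𝓡 7) x →ₗ[ℝ] (Fin 7 → ℝ) :=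
    LinearMap.pi fun i => (c.coframe ε (idx i) x).toFunctional
  have hL : ∀ v a, L v a.toFin = c.coframe ε a x ![v] := fun v a => by
    have : idx a.toFin = a := Idx.toFin_injective (Function.surjInv_eq _ _)
    change c.coframe ε (idx a.toFin) x ![v] = _
    rw [this]
  have hinj : Function.Injective L := by
    rw [injective_iff_map_eq_zero]
    intro v hv
    have h0 : ∀ a, c.coframe ε a x ![v] = 0 := fun a => by rw [← hL, hv]; rfl
    by_contra hne
    have hη : S.η x ![v] = 0 := by
      have : ε * S.η x ![v] = 0 := h0 (Sum.inl ())
      exact (mul_eq_zero.1 this).resolve_left hε.ne'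
    -- `ω(v, Jv) > 0` for horizontal `v ≠ 0`, while `ω` is built from the coframe.
    have hpos : 0 < S.omega x ![v, S.J x v] := S.dη_pos x v hη hne
    rw [c.omega_apply hx] at hpos
    have he : ∀ i, c.e i x ![v] = 0 := fun i => h0 (Sum.inr (Sum.inl i))
    have hJe : ∀ i, c.Je i x ![v] = 0 := fun i => h0 (Sum.inr (Sum.inr i))
    simp [he, hJe] at hpos
  have hfin : Module.finrank ℝ (TangentSpace (𝓡 7) x) = Module.finrank ℝ (Fin 7 → ℝ) := by
    rw [Module.finrank_fin_fun]
    exact finrank_euclideanSpace_fin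
  have : FiniteDimensional ℝ (TangentSpace (𝓡 7) x) :=
    inferInstanceAs (FiniteDimensional ℝ (EuclideanSpace ℝ (Fin 7)))
  let e := LinearEquiv.ofInjectiveOfFinrankEq L hinj hfin
  refine ⟨Module.Basis.ofEquivFun e, fun a j => ?_⟩
  rw [← hL, Module.Basis.coe_ofEquivFun]
  have : L (e.symm (Pi.single j 1)) = Pi.single j 1 := e.apply_symm_apply _
  have h2 := congrFun this a.toFin
  refine h2.trans ?_
  simp [kron, Pi.single_apply]

namespace IsDualFrame

variable {c} {f : Fin 7 → TangentSpace (𝓡 7) x} (hf : c.IsDualFrame ε x f)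
include hf

theorem eta_apply (j : Fin 7) : ε * S.η x ![f j] = kron 0 j := hf (Sum.inl ()) j

theorem e_apply (i : Fin 3) (j : Fin 7) :
    c.e i x ![f j] = kron ((![1, 2, 3] : Fin 3 → Fin 7) i) j :=
  hf (Sum.inr (Sum.inl i)) j

theorem Je_apply (i : Fin 3) (j : Fin 7) :
    c.Je i x ![f j] = kron ((![4, 5, 6] : Fin 3 → Fin 7) i) j :=
  hf (Sum.inr (Sum.inr i)) j

theorem omega_apply (hx : x ∈ c.U) (i j : Fin 7) : S.omega x ![f i, f j] = omegaCoeff i j := by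
  rw [c.omega_apply hx]
  simp only [hf.e_apply, hf.Je_apply, Fin.sum_univ_three, omegaCoeff, Matrix.cons_val]

theorem im_Omega_apply (hx : x ∈ c.U) (i j k : Fin 7) :
    S.Ω.im x ![f i, f j, f k] = imOmegaCoeff i j k := by
  change (S.Ω x ![f i, f j, f k]).im = _
  rw [c.Omega_apply hx]
  simp only [hf.e_apply, hf.Je_apply, imOmegaCoeff, kronDet, Matrix.cons_val, Complex.add_im,
    Complex.sub_im, Complex.mul_im, Complex.add_re, Complex.sub_re, Complex.mul_re, Complex.I_re,
    Complex.I_im, Complex.ofReal_re, Complex.ofReal_im]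
  ring

end IsDualFrame

end SU3Coframe

end ContactCalabiYau

end frame

/-! ### Holonomy in `SU(3)` -/

section holonomy

/-- The components `dE_a(f_i, f_j) = -∑ (Γ_ab ∧ E_b)(f_i, f_j)` determined by the components
`G a b i = Γ_ab(f_i)` of a connection. -/
def torsionCoeff (G : Fin 7 → Fin 7 → Fin 7 → ℝ) (a i j : Fin 7) : ℝ := G a i j - G a j i

/-- The components of `d(e_a + i Je_a)`. -/
noncomputable def complexTorsionCoeff (G : Fin 7 → Fin 7 → Fin 7 → ℝ) (a i j : Fin 7) : ℂ :=
  torsionCoeff G a i j + Complex.I * torsionCoeff G (a + 3) i j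

/-- The components of `e_a + i Je_a`. -/
noncomputable def complexKron (a i : Fin 7) : ℂ := kron a i + Complex.I * kron (a + 3) i

/-- The components of `d (∑ eᵢ ∧ Jeᵢ)`. -/
noncomputable def dOmegaCoeff (T : Fin 7 → Fin 7 → Fin 7 → ℝ) (i j k : Fin 7) : ℝ :=
  ∑ a : Fin 3, let a' : Fin 7 := ![1, 2, 3] a
    ((T a' i j * kron (a' + 3) k - T a' i k * kron (a' + 3) j + T a' j k * kron (a' + 3) i)
    - (kron a' i * T (a' + 3) j k - kron a' j * T (a' + 3) i k + kron a' k * T (a' + 3) i j))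

/-- The components of `α ∧ θ ∧ θ'` for a `2`-form `α` and `1`-forms `θ`, `θ'`. -/
def wedgeCoeff (α : Fin 7 → Fin 7 → ℂ) (θ θ' : Fin 7 → ℂ) (i j k l : Fin 7) : ℂ :=
  α i j * (θ k * θ' l - θ l * θ' k) - α i k * (θ j * θ' l - θ l * θ' j)
    + α i l * (θ j * θ' k - θ k * θ' j) + α j k * (θ i * θ' l - θ l * θ' i)
    - α j l * (θ i * θ' k - θ k * θ' i) + α k l * (θ i * θ' j - θ j * θ' i)

/-- The components of `d ((e₁ + i Je₁) ∧ (e₂ + i Je₂) ∧ (e₃ + i Je₃))`. -/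
noncomputable def dUpsilonCoeff (T : Fin 7 → Fin 7 → Fin 7 → ℂ) (i j k l : Fin 7) : ℂ :=
  wedgeCoeff (T 1) (complexKron 2) (complexKron 3) i j k l
    - wedgeCoeff (T 2) (complexKron 1) (complexKron 3) i j k l
    + wedgeCoeff (T 3) (complexKron 1) (complexKron 2) i j k l

/-- A real `7 × 7` matrix, given by its entries in the numbering `0, …, 6` of `(e₀, e, Je)`, which
lies in `𝔰𝔲(3) ⊆ 𝔰𝔬(6) ⊆ 𝔰𝔬(7)`. -/
structure IsSU3 (A : Fin 7 → Fin 7 → ℝ) : Prop where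
  skew : ∀ a b, A b a = -A a b
  zero : ∀ b, A 0 b = 0
  symm : (A 1 5 = A 2 4 ∧ A 1 6 = A 3 4) ∧ A 2 6 = A 3 5
  diag : (A 1 2 = A 4 5 ∧ A 1 3 = A 4 6) ∧ A 2 3 = A 5 6
  trace : A 1 4 + A 2 5 + A 3 6 = 0

variable {G : Fin 7 → Fin 7 → Fin 7 → ℝ}

/-! Each relation defining `𝔰𝔲(3)`, for the matrix `G · · i`, is a combination of the components of
`dω = 0` and `dΩ = 0` quoted in its proof. -/

set_option linter.unusedSimpArgs false

/-- The case `i = 0` of `isSU3_of_closed`: along the Reeb field only the components of `dω` and `dΩ`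
with first index `0` enter. -/
theorem isSU3_apply_zero (hskew : ∀ a b i, G b a i = -G a b i) (h0 : ∀ a i, G 0 a i = 0)
    (hω : ∀ i j k, dOmegaCoeff (torsionCoeff G) i j k = 0)
    (hΩ : ∀ i j k l, dUpsilonCoeff (complexTorsionCoeff G) i j k l = 0) :
    IsSU3 fun a b => G a b 0 := by
  have hG : ∀ a b i, b < a → G a b i = -G b a i := fun a b i _ => hskew b a i
  have hG' : ∀ a i, G a a i = 0 := fun a i => self_eq_neg.1 (hskew a a i)
  refine ⟨fun a b => hskew a b 0, fun a => h0 a 0, ⟨⟨?_, ?_⟩, ?_⟩, ⟨⟨?_, ?_⟩, ?_⟩, ?_⟩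
  · have h1 := hω 0 1 2
    simp [dOmegaCoeff, Fin.sum_univ_three, torsionCoeff, kron, hG, hG', h0] at h1
    linarith
  · have h1 := hω 0 1 3
    simp [dOmegaCoeff, Fin.sum_univ_three, torsionCoeff, kron, hG, hG', h0] at h1
    linarith
  · have h1 := hω 0 2 3
    simp [dOmegaCoeff, Fin.sum_univ_three, torsionCoeff, kron, hG, hG', h0] at h1
    linarith
  · have h1 := hω 0 1 5
    simp [dOmegaCoeff, Fin.sum_univ_three, torsionCoeff, kron, hG, hG', h0] at h1
    linarith
  · have h1 := hω 0 1 6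
    simp [dOmegaCoeff, Fin.sum_univ_three, torsionCoeff, kron, hG, hG', h0] at h1
    linarith
  · have h1 := hω 0 2 6
    simp [dOmegaCoeff, Fin.sum_univ_three, torsionCoeff, kron, hG, hG', h0] at h1
    linarith
  · have h1 := congrArg Complex.im (hΩ 0 1 2 3)
    simp [dUpsilonCoeff, wedgeCoeff, complexTorsionCoeff,
      complexKron, torsionCoeff, kron, hG, hG', h0] at h1
    linarith

theorem isSU3_apply_one (hskew : ∀ a b i, G b a i = -G a b i) (h0 : ∀ a i, G 0 a i = 0)
    (hω : ∀ i j k, dOmegaCoeff (torsionCoeff G) i j k = 0)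
    (hΩ : ∀ i j k l, dUpsilonCoeff (complexTorsionCoeff G) i j k l = 0) :
    IsSU3 fun a b => G a b 1 := by
  have hG : ∀ a b i, b < a → G a b i = -G b a i := fun a b i _ => hskew b a i
  have hG' : ∀ a i, G a a i = 0 := fun a i => self_eq_neg.1 (hskew a a i)
  refine ⟨fun a b => hskew a b 1, fun a => h0 a 1, ⟨⟨?_, ?_⟩, ?_⟩, ⟨⟨?_, ?_⟩, ?_⟩, ?_⟩
  · have h1 := hω 1 4 5
    have h2 := congrArg Complex.re (hΩ 1 2 3 5)
    have h3 := congrArg Complex.im (hΩ 2 3 4 5)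
    simp [dOmegaCoeff, Fin.sum_univ_three, dUpsilonCoeff, wedgeCoeff, complexTorsionCoeff,
      complexKron, torsionCoeff, kron, hG, hG'] at h1 h2 h3
    linarith
  · have h1 := hω 1 4 6
    have h2 := congrArg Complex.re (hΩ 1 2 3 6)
    have h3 := congrArg Complex.im (hΩ 2 3 4 6)
    simp [dOmegaCoeff, Fin.sum_univ_three, dUpsilonCoeff, wedgeCoeff, complexTorsionCoeff,
      complexKron, torsionCoeff, kron, hG, hG'] at h1 h2 h3
    linarith
  · have h1 := hω 1 2 3
    have h2 := hω 1 5 6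
    have h3 := congrArg Complex.im (hΩ 2 3 5 6)
    simp [dOmegaCoeff, Fin.sum_univ_three, dUpsilonCoeff, wedgeCoeff, complexTorsionCoeff,
      complexKron, torsionCoeff, kron, hG, hG'] at h1 h2 h3
    linarith
  · have h1 := hω 1 2 4
    have h2 := congrArg Complex.im (hΩ 1 2 3 5)
    have h3 := congrArg Complex.re (hΩ 2 3 4 5)
    simp [dOmegaCoeff, Fin.sum_univ_three, dUpsilonCoeff, wedgeCoeff, complexTorsionCoeff,
      complexKron, torsionCoeff, kron, hG, hG'] at h1 h2 h3
    linarith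
  · have h1 := hω 1 3 4
    have h2 := congrArg Complex.im (hΩ 1 2 3 6)
    have h3 := congrArg Complex.re (hΩ 2 3 4 6)
    simp [dOmegaCoeff, Fin.sum_univ_three, dUpsilonCoeff, wedgeCoeff, complexTorsionCoeff,
      complexKron, torsionCoeff, kron, hG, hG'] at h1 h2 h3
    linarith
  · have h1 := hω 1 2 6
    have h2 := hω 1 3 5
    have h3 := congrArg Complex.re (hΩ 2 3 5 6)
    simp [dOmegaCoeff, Fin.sum_univ_three, dUpsilonCoeff, wedgeCoeff, complexTorsionCoeff,
      complexKron, torsionCoeff, kron, hG, hG'] at h1 h2 h3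
    linarith
  · have h1 := hω 2 4 5
    have h2 := hω 3 4 6
    have h3 := congrArg Complex.re (hΩ 1 2 3 4)
    have h4 := congrArg Complex.re (hΩ 1 4 5 6)
    simp [dOmegaCoeff, Fin.sum_univ_three, dUpsilonCoeff, wedgeCoeff, complexTorsionCoeff,
      complexKron, torsionCoeff, kron, hG, hG'] at h1 h2 h3 h4
    linarith

theorem isSU3_apply_two (hskew : ∀ a b i, G b a i = -G a b i) (h0 : ∀ a i, G 0 a i = 0)
    (hω : ∀ i j k, dOmegaCoeff (torsionCoeff G) i j k = 0)
    (hΩ : ∀ i j k l, dUpsilonCoeff (complexTorsionCoeff G) i j k l = 0) :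
    IsSU3 fun a b => G a b 2 := by
  have hG : ∀ a b i, b < a → G a b i = -G b a i := fun a b i _ => hskew b a i
  have hG' : ∀ a i, G a a i = 0 := fun a i => self_eq_neg.1 (hskew a a i)
  refine ⟨fun a b => hskew a b 2, fun a => h0 a 2, ⟨⟨?_, ?_⟩, ?_⟩, ⟨⟨?_, ?_⟩, ?_⟩, ?_⟩
  · have h1 := hω 2 4 5
    have h2 := congrArg Complex.re (hΩ 1 2 3 4)
    have h3 := congrArg Complex.im (hΩ 1 3 4 5)
    simp [dOmegaCoeff, Fin.sum_univ_three, dUpsilonCoeff, wedgeCoeff, complexTorsionCoeff,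
      complexKron, torsionCoeff, kron, hG, hG'] at h1 h2 h3
    linarith
  · have h1 := hω 1 2 3
    have h2 := hω 2 4 6
    have h3 := congrArg Complex.im (hΩ 1 3 4 6)
    simp [dOmegaCoeff, Fin.sum_univ_three, dUpsilonCoeff, wedgeCoeff, complexTorsionCoeff,
      complexKron, torsionCoeff, kron, hG, hG'] at h1 h2 h3
    linarith
  · have h1 := hω 2 5 6
    have h2 := congrArg Complex.re (hΩ 1 2 3 6)
    have h3 := congrArg Complex.im (hΩ 1 3 5 6)
    simp [dOmegaCoeff, Fin.sum_univ_three, dUpsilonCoeff, wedgeCoeff, complexTorsionCoeff,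
      complexKron, torsionCoeff, kron, hG, hG'] at h1 h2 h3
    linarith
  · have h1 := hω 1 2 5
    have h2 := congrArg Complex.im (hΩ 1 2 3 4)
    have h3 := congrArg Complex.re (hΩ 1 3 4 5)
    simp [dOmegaCoeff, Fin.sum_univ_three, dUpsilonCoeff, wedgeCoeff, complexTorsionCoeff,
      complexKron, torsionCoeff, kron, hG, hG'] at h1 h2 h3
    linarith
  · have h1 := hω 1 2 6
    have h2 := hω 2 3 4
    have h3 := congrArg Complex.re (hΩ 1 3 4 6)
    simp [dOmegaCoeff, Fin.sum_univ_three, dUpsilonCoeff, wedgeCoeff, complexTorsionCoeff,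
      complexKron, torsionCoeff, kron, hG, hG'] at h1 h2 h3
    linarith
  · have h1 := hω 2 3 5
    have h2 := congrArg Complex.im (hΩ 1 2 3 6)
    have h3 := congrArg Complex.re (hΩ 1 3 5 6)
    simp [dOmegaCoeff, Fin.sum_univ_three, dUpsilonCoeff, wedgeCoeff, complexTorsionCoeff,
      complexKron, torsionCoeff, kron, hG, hG'] at h1 h2 h3
    linarith
  · have h1 := hω 1 4 5
    have h2 := hω 3 5 6
    have h3 := congrArg Complex.re (hΩ 1 2 3 5)
    have h4 := congrArg Complex.re (hΩ 2 4 5 6)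
    simp [dOmegaCoeff, Fin.sum_univ_three, dUpsilonCoeff, wedgeCoeff, complexTorsionCoeff,
      complexKron, torsionCoeff, kron, hG, hG'] at h1 h2 h3 h4
    linarith

theorem isSU3_apply_three (hskew : ∀ a b i, G b a i = -G a b i) (h0 : ∀ a i, G 0 a i = 0)
    (hω : ∀ i j k, dOmegaCoeff (torsionCoeff G) i j k = 0)
    (hΩ : ∀ i j k l, dUpsilonCoeff (complexTorsionCoeff G) i j k l = 0) :
    IsSU3 fun a b => G a b 3 := by
  have hG : ∀ a b i, b < a → G a b i = -G b a i := fun a b i _ => hskew b a i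
  have hG' : ∀ a i, G a a i = 0 := fun a i => self_eq_neg.1 (hskew a a i)
  refine ⟨fun a b => hskew a b 3, fun a => h0 a 3, ⟨⟨?_, ?_⟩, ?_⟩, ⟨⟨?_, ?_⟩, ?_⟩, ?_⟩
  · have h1 := hω 1 2 3
    have h2 := hω 3 4 5
    have h3 := congrArg Complex.im (hΩ 1 2 4 5)
    simp [dOmegaCoeff, Fin.sum_univ_three, dUpsilonCoeff, wedgeCoeff, complexTorsionCoeff,
      complexKron, torsionCoeff, kron, hG, hG'] at h1 h2 h3
    linarith
  · have h1 := hω 3 4 6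
    have h2 := congrArg Complex.re (hΩ 1 2 3 4)
    have h3 := congrArg Complex.im (hΩ 1 2 4 6)
    simp [dOmegaCoeff, Fin.sum_univ_three, dUpsilonCoeff, wedgeCoeff, complexTorsionCoeff,
      complexKron, torsionCoeff, kron, hG, hG'] at h1 h2 h3
    linarith
  · have h1 := hω 3 5 6
    have h2 := congrArg Complex.re (hΩ 1 2 3 5)
    have h3 := congrArg Complex.im (hΩ 1 2 5 6)
    simp [dOmegaCoeff, Fin.sum_univ_three, dUpsilonCoeff, wedgeCoeff, complexTorsionCoeff,
      complexKron, torsionCoeff, kron, hG, hG'] at h1 h2 h3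
    linarith
  · have h1 := hω 1 3 5
    have h2 := hω 2 3 4
    have h3 := congrArg Complex.re (hΩ 1 2 4 5)
    simp [dOmegaCoeff, Fin.sum_univ_three, dUpsilonCoeff, wedgeCoeff, complexTorsionCoeff,
      complexKron, torsionCoeff, kron, hG, hG'] at h1 h2 h3
    linarith
  · have h1 := hω 1 3 6
    have h2 := congrArg Complex.im (hΩ 1 2 3 4)
    have h3 := congrArg Complex.re (hΩ 1 2 4 6)
    simp [dOmegaCoeff, Fin.sum_univ_three, dUpsilonCoeff, wedgeCoeff, complexTorsionCoeff,
      complexKron, torsionCoeff, kron, hG, hG'] at h1 h2 h3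
    linarith
  · have h1 := hω 2 3 6
    have h2 := congrArg Complex.im (hΩ 1 2 3 5)
    have h3 := congrArg Complex.re (hΩ 1 2 5 6)
    simp [dOmegaCoeff, Fin.sum_univ_three, dUpsilonCoeff, wedgeCoeff, complexTorsionCoeff,
      complexKron, torsionCoeff, kron, hG, hG'] at h1 h2 h3
    linarith
  · have h1 := hω 1 4 6
    have h2 := hω 2 5 6
    have h3 := congrArg Complex.re (hΩ 1 2 3 6)
    have h4 := congrArg Complex.re (hΩ 3 4 5 6)
    simp [dOmegaCoeff, Fin.sum_univ_three, dUpsilonCoeff, wedgeCoeff, complexTorsionCoeff,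
      complexKron, torsionCoeff, kron, hG, hG'] at h1 h2 h3 h4
    linarith

theorem isSU3_apply_four (hskew : ∀ a b i, G b a i = -G a b i) (h0 : ∀ a i, G 0 a i = 0)
    (hω : ∀ i j k, dOmegaCoeff (torsionCoeff G) i j k = 0)
    (hΩ : ∀ i j k l, dUpsilonCoeff (complexTorsionCoeff G) i j k l = 0) :
    IsSU3 fun a b => G a b 4 := by
  have hG : ∀ a b i, b < a → G a b i = -G b a i := fun a b i _ => hskew b a i
  have hG' : ∀ a i, G a a i = 0 := fun a i => self_eq_neg.1 (hskew a a i)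
  refine ⟨fun a b => hskew a b 4, fun a => h0 a 4, ⟨⟨?_, ?_⟩, ?_⟩, ⟨⟨?_, ?_⟩, ?_⟩, ?_⟩
  · have h1 := hω 1 2 4
    have h2 := congrArg Complex.im (hΩ 1 2 3 5)
    have h3 := congrArg Complex.re (hΩ 2 3 4 5)
    simp [dOmegaCoeff, Fin.sum_univ_three, dUpsilonCoeff, wedgeCoeff, complexTorsionCoeff,
      complexKron, torsionCoeff, kron, hG, hG'] at h1 h2 h3
    linarith
  · have h1 := hω 1 3 4
    have h2 := congrArg Complex.im (hΩ 1 2 3 6)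
    have h3 := congrArg Complex.re (hΩ 2 3 4 6)
    simp [dOmegaCoeff, Fin.sum_univ_three, dUpsilonCoeff, wedgeCoeff, complexTorsionCoeff,
      complexKron, torsionCoeff, kron, hG, hG'] at h1 h2 h3
    linarith
  · have h1 := hω 2 3 4
    have h2 := hω 4 5 6
    have h3 := congrArg Complex.re (hΩ 2 3 5 6)
    simp [dOmegaCoeff, Fin.sum_univ_three, dUpsilonCoeff, wedgeCoeff, complexTorsionCoeff,
      complexKron, torsionCoeff, kron, hG, hG'] at h1 h2 h3
    linarith
  · have h1 := hω 1 4 5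
    have h2 := congrArg Complex.re (hΩ 1 2 3 5)
    have h3 := congrArg Complex.im (hΩ 2 3 4 5)
    simp [dOmegaCoeff, Fin.sum_univ_three, dUpsilonCoeff, wedgeCoeff, complexTorsionCoeff,
      complexKron, torsionCoeff, kron, hG, hG'] at h1 h2 h3
    linarith
  · have h1 := hω 1 4 6
    have h2 := congrArg Complex.re (hΩ 1 2 3 6)
    have h3 := congrArg Complex.im (hΩ 2 3 4 6)
    simp [dOmegaCoeff, Fin.sum_univ_three, dUpsilonCoeff, wedgeCoeff, complexTorsionCoeff,
      complexKron, torsionCoeff, kron, hG, hG'] at h1 h2 h3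
    linarith
  · have h1 := hω 2 4 6
    have h2 := hω 3 4 5
    have h3 := congrArg Complex.im (hΩ 2 3 5 6)
    simp [dOmegaCoeff, Fin.sum_univ_three, dUpsilonCoeff, wedgeCoeff, complexTorsionCoeff,
      complexKron, torsionCoeff, kron, hG, hG'] at h1 h2 h3
    linarith
  · have h1 := hω 1 2 5
    have h2 := hω 1 3 6
    have h3 := congrArg Complex.im (hΩ 1 2 3 4)
    have h4 := congrArg Complex.im (hΩ 1 4 5 6)
    simp [dOmegaCoeff, Fin.sum_univ_three, dUpsilonCoeff, wedgeCoeff, complexTorsionCoeff,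
      complexKron, torsionCoeff, kron, hG, hG'] at h1 h2 h3 h4
    linarith

theorem isSU3_apply_five (hskew : ∀ a b i, G b a i = -G a b i) (h0 : ∀ a i, G 0 a i = 0)
    (hω : ∀ i j k, dOmegaCoeff (torsionCoeff G) i j k = 0)
    (hΩ : ∀ i j k l, dUpsilonCoeff (complexTorsionCoeff G) i j k l = 0) :
    IsSU3 fun a b => G a b 5 := by
  have hG : ∀ a b i, b < a → G a b i = -G b a i := fun a b i _ => hskew b a i
  have hG' : ∀ a i, G a a i = 0 := fun a i => self_eq_neg.1 (hskew a a i)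
  refine ⟨fun a b => hskew a b 5, fun a => h0 a 5, ⟨⟨?_, ?_⟩, ?_⟩, ⟨⟨?_, ?_⟩, ?_⟩, ?_⟩
  · have h1 := hω 1 2 5
    have h2 := congrArg Complex.im (hΩ 1 2 3 4)
    have h3 := congrArg Complex.re (hΩ 1 3 4 5)
    simp [dOmegaCoeff, Fin.sum_univ_three, dUpsilonCoeff, wedgeCoeff, complexTorsionCoeff,
      complexKron, torsionCoeff, kron, hG, hG'] at h1 h2 h3
    linarith
  · have h1 := hω 1 3 5
    have h2 := hω 4 5 6
    have h3 := congrArg Complex.re (hΩ 1 3 4 6)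
    simp [dOmegaCoeff, Fin.sum_univ_three, dUpsilonCoeff, wedgeCoeff, complexTorsionCoeff,
      complexKron, torsionCoeff, kron, hG, hG'] at h1 h2 h3
    linarith
  · have h1 := hω 2 3 5
    have h2 := congrArg Complex.im (hΩ 1 2 3 6)
    have h3 := congrArg Complex.re (hΩ 1 3 5 6)
    simp [dOmegaCoeff, Fin.sum_univ_three, dUpsilonCoeff, wedgeCoeff, complexTorsionCoeff,
      complexKron, torsionCoeff, kron, hG, hG'] at h1 h2 h3
    linarith
  · have h1 := hω 2 4 5
    have h2 := congrArg Complex.re (hΩ 1 2 3 4)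
    have h3 := congrArg Complex.im (hΩ 1 3 4 5)
    simp [dOmegaCoeff, Fin.sum_univ_three, dUpsilonCoeff, wedgeCoeff, complexTorsionCoeff,
      complexKron, torsionCoeff, kron, hG, hG'] at h1 h2 h3
    linarith
  · have h1 := hω 1 5 6
    have h2 := hω 3 4 5
    have h3 := congrArg Complex.im (hΩ 1 3 4 6)
    simp [dOmegaCoeff, Fin.sum_univ_three, dUpsilonCoeff, wedgeCoeff, complexTorsionCoeff,
      complexKron, torsionCoeff, kron, hG, hG'] at h1 h2 h3
    linarith
  · have h1 := hω 2 5 6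
    have h2 := congrArg Complex.re (hΩ 1 2 3 6)
    have h3 := congrArg Complex.im (hΩ 1 3 5 6)
    simp [dOmegaCoeff, Fin.sum_univ_three, dUpsilonCoeff, wedgeCoeff, complexTorsionCoeff,
      complexKron, torsionCoeff, kron, hG, hG'] at h1 h2 h3
    linarith
  · have h1 := hω 1 2 4
    have h2 := hω 2 3 6
    have h3 := congrArg Complex.im (hΩ 1 2 3 5)
    have h4 := congrArg Complex.im (hΩ 2 4 5 6)
    simp [dOmegaCoeff, Fin.sum_univ_three, dUpsilonCoeff, wedgeCoeff, complexTorsionCoeff,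
      complexKron, torsionCoeff, kron, hG, hG'] at h1 h2 h3 h4
    linarith

theorem isSU3_apply_six (hskew : ∀ a b i, G b a i = -G a b i) (h0 : ∀ a i, G 0 a i = 0)
    (hω : ∀ i j k, dOmegaCoeff (torsionCoeff G) i j k = 0)
    (hΩ : ∀ i j k l, dUpsilonCoeff (complexTorsionCoeff G) i j k l = 0) :
    IsSU3 fun a b => G a b 6 := by
  have hG : ∀ a b i, b < a → G a b i = -G b a i := fun a b i _ => hskew b a i
  have hG' : ∀ a i, G a a i = 0 := fun a i => self_eq_neg.1 (hskew a a i)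
  refine ⟨fun a b => hskew a b 6, fun a => h0 a 6, ⟨⟨?_, ?_⟩, ?_⟩, ⟨⟨?_, ?_⟩, ?_⟩, ?_⟩
  · have h1 := hω 1 2 6
    have h2 := hω 4 5 6
    have h3 := congrArg Complex.re (hΩ 1 2 4 5)
    simp [dOmegaCoeff, Fin.sum_univ_three, dUpsilonCoeff, wedgeCoeff, complexTorsionCoeff,
      complexKron, torsionCoeff, kron, hG, hG'] at h1 h2 h3
    linarith
  · have h1 := hω 1 3 6
    have h2 := congrArg Complex.im (hΩ 1 2 3 4)
    have h3 := congrArg Complex.re (hΩ 1 2 4 6)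
    simp [dOmegaCoeff, Fin.sum_univ_three, dUpsilonCoeff, wedgeCoeff, complexTorsionCoeff,
      complexKron, torsionCoeff, kron, hG, hG'] at h1 h2 h3
    linarith
  · have h1 := hω 2 3 6
    have h2 := congrArg Complex.im (hΩ 1 2 3 5)
    have h3 := congrArg Complex.re (hΩ 1 2 5 6)
    simp [dOmegaCoeff, Fin.sum_univ_three, dUpsilonCoeff, wedgeCoeff, complexTorsionCoeff,
      complexKron, torsionCoeff, kron, hG, hG'] at h1 h2 h3
    linarith
  · have h1 := hω 1 5 6
    have h2 := hω 2 4 6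
    have h3 := congrArg Complex.im (hΩ 1 2 4 5)
    simp [dOmegaCoeff, Fin.sum_univ_three, dUpsilonCoeff, wedgeCoeff, complexTorsionCoeff,
      complexKron, torsionCoeff, kron, hG, hG'] at h1 h2 h3
    linarith
  · have h1 := hω 3 4 6
    have h2 := congrArg Complex.re (hΩ 1 2 3 4)
    have h3 := congrArg Complex.im (hΩ 1 2 4 6)
    simp [dOmegaCoeff, Fin.sum_univ_three, dUpsilonCoeff, wedgeCoeff, complexTorsionCoeff,
      complexKron, torsionCoeff, kron, hG, hG'] at h1 h2 h3
    linarith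
  · have h1 := hω 3 5 6
    have h2 := congrArg Complex.re (hΩ 1 2 3 5)
    have h3 := congrArg Complex.im (hΩ 1 2 5 6)
    simp [dOmegaCoeff, Fin.sum_univ_three, dUpsilonCoeff, wedgeCoeff, complexTorsionCoeff,
      complexKron, torsionCoeff, kron, hG, hG'] at h1 h2 h3
    linarith
  · have h1 := hω 1 3 4
    have h2 := hω 2 3 5
    have h3 := congrArg Complex.im (hΩ 1 2 3 6)
    have h4 := congrArg Complex.im (hΩ 3 4 5 6)
    simp [dOmegaCoeff, Fin.sum_univ_three, dUpsilonCoeff, wedgeCoeff, complexTorsionCoeff,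
      complexKron, torsionCoeff, kron, hG, hG'] at h1 h2 h3 h4
    linarith

/-- A metric connection which is torsion-free on the leaf space and for which `ω` and `Ω` are closed
has values in `𝔰𝔲(3)`: the Levi-Civita connection of a Calabi--Yau threefold has holonomy in
`SU(3)`. -/
theorem isSU3_of_closed (hskew : ∀ a b i, G b a i = -G a b i) (h0 : ∀ a i, G 0 a i = 0)
    (hω : ∀ i j k, dOmegaCoeff (torsionCoeff G) i j k = 0)
    (hΩ : ∀ i j k l, dUpsilonCoeff (complexTorsionCoeff G) i j k l = 0) (i : Fin 7) :
    IsSU3 fun a b => G a b i := by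
  fin_cases i
  exacts [isSU3_apply_zero hskew h0 hω hΩ, isSU3_apply_one hskew h0 hω hΩ,
    isSU3_apply_two hskew h0 hω hΩ, isSU3_apply_three hskew h0 hω hΩ,
    isSU3_apply_four hskew h0 hω hΩ, isSU3_apply_five hskew h0 hω hΩ,
    isSU3_apply_six hskew h0 hω hΩ]

end holonomy

/-! ### Invariant tensors and their products with `ψ` -/

section pointwise

/-- An algebraic curvature tensor with values in `𝔰𝔲(3)` is traceless against `ω` and of type
`(1,1)` also in its form indices, so that its wedge product with `ψ` vanishes. -/
theorem psiContraction_eq_zero_of_bianchi {r : Fin 7 → Fin 7 → Fin 7 → Fin 7 → ℝ}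
    (hsu : ∀ i j, IsSU3 fun a b => r a b i j) (hr : ∀ a b i j, r a b j i = -r a b i j)
    (hB : ∀ a i j k, r a k i j - r a j i k + r a i j k = 0) (a b c : Fin 7) :
    psiContraction (r a b) c = 0 := by
  -- The first Bianchi identity gives the symmetry under exchange of the two pairs of indices.
  have hpair : ∀ a b i j, r a b i j = r i j a b := by
    intro a b i j
    have hs : ∀ a b i j, r b a i j = -r a b i j := fun a b i j => (hsu i j).skew a b
    linarith [hB a b i j, hB b i j a, hB i j a b, hB j a b i, hs a b i j, hr b j a i, hr b i a j,
      hs b i j a, hs a i j b, hr a i b j, hs i j a b, hs b j a i, hs a j b i]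
  have h := hsu a b
  have hz : ∀ j, r a b 0 j = 0 := fun j => by rw [hpair]; exact h.zero j
  obtain ⟨⟨h1, h2⟩, h3⟩ := h.symm
  obtain ⟨⟨h4, h5⟩, h6⟩ := h.diag
  have h7 := h.trace
  rw [← hpair a b] at h1 h2 h3 h4 h5 h6 h7
  rw [← hpair a b] at h1 h2 h3 h4 h5 h6 h7
  rw [← hpair a b] at h7
  fin_cases c <;> simp [psiContraction, hz] <;> linarith

/-- `𝔰𝔲(3)` is closed under commutators. -/
theorem IsSU3.commutator {A B : Fin 7 → Fin 7 → ℝ} (hA : IsSU3 A) (hB : IsSU3 B) :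
    IsSU3 fun a b => ∑ l, (A a l * B l b - B a l * A l b) := by
  have sA : ∀ a b, b < a → A a b = -A b a := fun a b _ => hA.skew b a
  have sB : ∀ a b, b < a → B a b = -B b a := fun a b _ => hB.skew b a
  have zA : ∀ a, A a a = 0 := fun a => self_eq_neg.1 (hA.skew a a)
  have zB : ∀ a, B a a = 0 := fun a => self_eq_neg.1 (hB.skew a a)
  obtain ⟨⟨a1, a2⟩, a3⟩ := hA.symm
  obtain ⟨⟨a4, a5⟩, a6⟩ := hA.diag
  obtain ⟨⟨b1, b2⟩, b3⟩ := hB.symm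
  obtain ⟨⟨b4, b5⟩, b6⟩ := hB.diag
  have a7 : A 3 6 = -A 1 4 - A 2 5 := by linarith [hA.trace]
  have b7 : B 3 6 = -B 1 4 - B 2 5 := by linarith [hB.trace]
  refine ⟨fun a b => ?_, fun b => ?_, ⟨⟨?_, ?_⟩, ?_⟩, ⟨⟨?_, ?_⟩, ?_⟩, ?_⟩
  · rw [← Finset.sum_neg_distrib]
    refine Finset.sum_congr rfl fun l _ => ?_
    rw [hA.skew l b, hB.skew a l, hB.skew l b, hA.skew a l]
    ring
  · simp [hA.zero, hB.zero]
  all_goals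
    simp [Fin.sum_univ_seven, sA, sB, zA, zB, hA.zero, hB.zero, a1, a2, a3, a4, a5, a6, a7,
      b1, b2, b3, b4, b5, b6, b7]
    try ring

/-- A sum over `Fin 7`, written out so that closed instances are cheap to evaluate. -/
def sumSeven (u : Fin 7 → ℤ) : ℤ := u 0 + u 1 + u 2 + u 3 + u 4 + u 5 + u 6

theorem sumSeven_eq (u : Fin 7 → ℤ) : sumSeven u = ∑ c, u c := (Fin.sum_univ_seven _).symm

/-- The Kronecker symbol as an integer. -/
def kronInt (i j : Fin 7) : ℤ := if i = j then 1 else 0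

/-- The components of `ω` as integers. -/
def omegaInt (i j : Fin 7) : ℤ :=
  (kronInt 1 i * kronInt 4 j - kronInt 1 j * kronInt 4 i)
    + (kronInt 2 i * kronInt 5 j - kronInt 2 j * kronInt 5 i)
    + (kronInt 3 i * kronInt 6 j - kronInt 3 j * kronInt 6 i)

/-- The components of the wedge product of three elements of the coframe. -/
def detInt (a b c i j k : Fin 7) : ℤ :=
  (kronInt a i * kronInt b j - kronInt a j * kronInt b i) * kronInt c k
    - (kronInt a i * kronInt b k - kronInt a k * kronInt b i) * kronInt c j
    + (kronInt a j * kronInt b k - kronInt a k * kronInt b j) * kronInt c i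

/-- The components of `Re Ω`. -/
def reOmegaInt (i j k : Fin 7) : ℤ :=
  detInt 1 2 3 i j k - detInt 1 5 6 i j k - detInt 4 2 6 i j k - detInt 4 5 3 i j k

/-- The components of `Im Ω`. -/
def imOmegaInt (i j k : Fin 7) : ℤ :=
  detInt 4 2 3 i j k + detInt 1 5 3 i j k + detInt 1 2 6 i j k - detInt 4 5 6 i j k

/-- The components of the matrix `(0, Jeᵀ, -eᵀ; -Je, 0, 0; e, 0, 0)`. -/
def etaOmegaInt (a b j : Fin 7) : ℤ := kronInt 0 a * omegaInt b j - kronInt 0 b * omegaInt a j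

/-- The components of `e₀ 𝓘`; the matrix `𝓘` is minus that of `ω`. -/
def etaIInt (a b j : Fin 7) : ℤ := -omegaInt a b * kronInt 0 j

/-- The components of the matrix `(0, eᵀ, Jeᵀ; -e, 0, 0; -Je, 0, 0)`. -/
def etaMetricInt (a b j : Fin 7) : ℤ := kronInt 0 a * kronInt b j - kronInt 0 b * kronInt a j

/-- The components of the matrix of `2`-forms `X ∧ Y`. -/
def bracketInt (X Y : Fin 7 → Fin 7 → Fin 7 → ℤ) (a b i j : Fin 7) : ℤ :=
  sumSeven fun l => X a l i * Y l b j - X a l j * Y l b i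

/-- `psiContraction` for integer components. -/
def psiContractionInt (r : Fin 7 → Fin 7 → ℤ) : Fin 7 → ℤ :=
  ![-(r 1 4 + r 2 5 + r 3 6), -r 0 4 + r 2 3 - r 5 6, r 0 5 + r 1 3 - r 4 6,
    -r 0 6 + r 1 2 - r 4 5, -r 0 1 + r 2 6 - r 3 5, r 0 2 + r 1 6 - r 3 4, -r 0 3 + r 1 5 - r 2 4]

/-- The components of `e₀ ∧ ½ ω² ∧ α` for a `1`-form `α` with components `u`, by the omitted
index. -/
def e0OmegaSq {R : Type*} [Ring R] (u : Fin 7 → R) : Fin 7 → R :=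
  ![0, -u 4, u 5, -u 6, -u 1, u 2, -u 3]

/-- The first of six finite identities computing `X ∧ Y ∧ ψ` for pairs of the three invariant
tensors; they produce the coefficients of `R ∧ ψ`. -/
theorem psiContractionInt_eta_eta : ∀ a b c,
    psiContractionInt (bracketInt etaOmegaInt etaOmegaInt a b) c =
      omegaInt a b * kronInt 0 c - e0OmegaSq (imOmegaInt a b) c := by decide +kernel

theorem psiContractionInt_re_re : ∀ a b c,
    psiContractionInt (bracketInt reOmegaInt reOmegaInt a b) c =
      -4 * (omegaInt a b * kronInt 0 c) := by decide +kernel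

theorem psiContractionInt_I_I : ∀ a b c,
    psiContractionInt (bracketInt etaIInt etaIInt a b) c = 0 := by decide +kernel

theorem psiContractionInt_eta_re : ∀ a b c,
    psiContractionInt (bracketInt etaOmegaInt reOmegaInt a b) c
      + psiContractionInt (bracketInt reOmegaInt etaOmegaInt a b) c =
      4 * e0OmegaSq (etaMetricInt a b) c := by decide +kernel

theorem psiContractionInt_eta_I : ∀ a b c,
    psiContractionInt (bracketInt etaOmegaInt etaIInt a b) c
      + psiContractionInt (bracketInt etaIInt etaOmegaInt a b) c =
      e0OmegaSq (etaMetricInt a b) c := by decide +kernel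

theorem psiContractionInt_re_I : ∀ a b c,
    psiContractionInt (bracketInt reOmegaInt etaIInt a b) c
      + psiContractionInt (bracketInt etaIInt reOmegaInt a b) c =
      2 * e0OmegaSq (imOmegaInt a b) c := by decide +kernel

/-- The elementary skew matrix with entry `1` at `(k, l)`. -/
def elemSkew (k l a b : Fin 7) : ℤ := kronInt k a * kronInt l b - kronInt l a * kronInt k b

/-- A basis of `𝔰𝔲(3) ⊆ 𝔰𝔬(7)`. -/
def su3Basis : Fin 8 → Fin 7 → Fin 7 → ℤ :=
  ![elemSkew 1 2 + elemSkew 4 5, elemSkew 1 3 + elemSkew 4 6, elemSkew 2 3 + elemSkew 5 6,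
    elemSkew 1 5 + elemSkew 2 4, elemSkew 1 6 + elemSkew 3 4, elemSkew 2 6 + elemSkew 3 5,
    elemSkew 1 4 - elemSkew 3 6, elemSkew 2 5 - elemSkew 3 6]

/-- Every element of `𝔰𝔲(3)` is a combination of `su3Basis`, which reduces invariance to a finite
check over `ℤ`. -/
theorem IsSU3.exists_eq_sum_basis {g : Fin 7 → Fin 7 → ℝ} (hg : IsSU3 g) :
    ∃ γ : Fin 8 → ℝ, ∀ a b, g a b = ∑ s, γ s * su3Basis s a b := by
  refine ⟨![g 1 2, g 1 3, g 2 3, g 1 5, g 1 6, g 2 6, g 1 4, g 2 5], fun a b => ?_⟩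
  have sg : ∀ a b, b < a → g a b = -g b a := fun a b _ => hg.skew b a
  have zg : ∀ a, g a a = 0 := fun a => self_eq_neg.1 (hg.skew a a)
  obtain ⟨⟨a1, a2⟩, a3⟩ := hg.symm
  obtain ⟨⟨a4, a5⟩, a6⟩ := hg.diag
  have a7 : g 3 6 = -g 1 4 - g 2 5 := by linarith [hg.trace]
  rw [Fin.sum_univ_eight]
  fin_cases a <;> fin_cases b <;>
    simp [su3Basis, elemSkew, kronInt, sg, zg, hg.zero, a1, a2, a3, a4, a5, a6, a7] <;> ring

/-- The infinitesimal action of the matrix `g` on the tensor `X` vanishes. -/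
def IsInvariantInt (X : Fin 7 → Fin 7 → Fin 7 → ℤ) (g : Fin 7 → Fin 7 → ℤ) : Prop :=
  ∀ a b i, sumSeven (fun c => X a b c * g c i) = sumSeven fun c => g a c * X c b i - X a c i * g c b

instance (X : Fin 7 → Fin 7 → Fin 7 → ℤ) (g : Fin 7 → Fin 7 → ℤ) :
    Decidable (IsInvariantInt X g) := inferInstanceAs (Decidable (∀ _, _))

theorem isInvariantInt_etaOmega : ∀ s, IsInvariantInt etaOmegaInt (su3Basis s) := by decide +kernel

theorem isInvariantInt_reOmega : ∀ s, IsInvariantInt reOmegaInt (su3Basis s) := by decide +kernel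

theorem isInvariantInt_etaI : ∀ s, IsInvariantInt etaIInt (su3Basis s) := by decide +kernel

/-- The components `l (0, Jeᵀ, -eᵀ; -Je, 0, 0; e, 0, 0) + d (0, 0, 0; 0, -[e], [Je]; 0, [Je], [e]) +
μ e₀ 𝓘`; for `l = 1 + δ`, `d = δ` and `μ = 1 - δ + m` this is the matrix `B + δ C + m e₀ 𝓘`. -/
def torsionTensor (l d μ : ℝ) (a b j : Fin 7) : ℝ :=
  l * etaOmegaInt a b j - d * reOmegaInt a b j + μ * etaIInt a b j

/-- The components of the matrix `(0, p eᵀ, p Jeᵀ; -p e, q [Je], q [e]; -p Je, q [e], -q [Je])`. -/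
def curvatureTensor (p q : ℝ) (a b j : Fin 7) : ℝ :=
  p * etaMetricInt a b j + q * imOmegaInt a b j

theorem kronInt_cast (i j : Fin 7) : (kronInt i j : ℝ) = kron i j := by
  simp [kronInt, kron]

theorem omegaInt_cast (i j : Fin 7) : (omegaInt i j : ℝ) = omegaCoeff i j := by
  simp [omegaInt, omegaCoeff, kronInt_cast]

theorem torsionTensor_zero (l d μ : ℝ) (a b : Fin 7) :
    torsionTensor l d μ a b 0 = -μ * omegaCoeff a b := by
  have h : ∀ a b, etaOmegaInt a b 0 = 0 ∧ reOmegaInt a b 0 = 0 ∧ etaIInt a b 0 = -omegaInt a b := by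
    decide +kernel
  obtain ⟨h1, h2, h3⟩ := h a b
  rw [torsionTensor, h1, h2, h3, ← omegaInt_cast]
  push_cast
  ring

/-- The tensor `B + δ C + m e₀ 𝓘` is built from `e₀`, `ω` and `Ω`, hence `𝔰𝔲(3)`-invariant. -/
theorem torsionTensor_invariant (l d μ : ℝ) {g : Fin 7 → Fin 7 → ℝ} (hg : IsSU3 g)
    (a b i : Fin 7) :
    ∑ c, torsionTensor l d μ a b c * g c i
      = ∑ c, (g a c * torsionTensor l d μ c b i - torsionTensor l d μ a c i * g c b) := by
  have key : ∀ {X}, (∀ s, IsInvariantInt X (su3Basis s)) →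
      ∑ c, (X a b c : ℝ) * g c i = ∑ c, (g a c * X c b i - X a c i * g c b) := by
    intro X hX
    have h : ∀ s, ∑ c, (X a b c : ℝ) * su3Basis s c i
        = ∑ c, (su3Basis s a c * X c b i - X a c i * su3Basis s c b : ℝ) :=
      fun s => by
        have h := hX s a b i
        rw [sumSeven_eq, sumSeven_eq] at h
        exact_mod_cast h
    obtain ⟨γ, hγ⟩ := hg.exists_eq_sum_basis
    simp only [hγ, Finset.mul_sum, Finset.sum_mul,
      ← Finset.sum_sub_distrib]
    rw [Finset.sum_comm, Finset.sum_comm (s := Finset.univ (α := Fin 7))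
      (t := Finset.univ (α := Fin 8))]
    refine Finset.sum_congr rfl fun s _ => ?_
    have h1 := congrArg (γ s * ·) (h s)
    simp only [Finset.mul_sum] at h1
    refine Eq.trans (Finset.sum_congr rfl fun c _ => by ring) (h1.trans ?_)
    exact Finset.sum_congr rfl fun c _ => by ring
  have h1 := key isInvariantInt_etaOmega
  have h2 := key isInvariantInt_reOmega
  have h3 := key isInvariantInt_etaI
  simp only [torsionTensor]
  calc _ = l * ∑ c, (etaOmegaInt a b c : ℝ) * g c i - d * ∑ c, (reOmegaInt a b c : ℝ) * g c i
        + μ * ∑ c, (etaIInt a b c : ℝ) * g c i := by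
        simp only [Finset.mul_sum, ← Finset.sum_sub_distrib, ← Finset.sum_add_distrib]
        exact Finset.sum_congr rfl fun c _ => by ring
    _ = _ := by
        rw [h1, h2, h3]
        simp only [Finset.mul_sum, ← Finset.sum_sub_distrib, ← Finset.sum_add_distrib]
        exact Finset.sum_congr rfl fun c _ => by ring

theorem psiContraction_add (r s : Fin 7 → Fin 7 → ℝ) (c : Fin 7) :
    psiContraction (fun i j => r i j + s i j) c = psiContraction r c + psiContraction s c := by
  fin_cases c <;> simp [psiContraction] <;> ring

theorem psiContraction_const_mul (t : ℝ) (r : Fin 7 → Fin 7 → ℝ) (c : Fin 7) :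
    psiContraction (fun i j => t * r i j) c = t * psiContraction r c := by
  fin_cases c <;> simp [psiContraction] <;> ring

theorem psiContractionInt_cast (r : Fin 7 → Fin 7 → ℤ) (c : Fin 7) :
    psiContraction (fun i j => (r i j : ℝ)) c = (psiContractionInt r c : ℝ) := by
  fin_cases c <;> simp [psiContraction, psiContractionInt]

theorem psiContraction_omegaCoeff (c : Fin 7) :
    psiContraction omegaCoeff c = -3 * kron 0 c := by
  fin_cases c <;> simp [psiContraction, omegaCoeff, kron]
  norm_num

theorem e0OmegaSq_curvatureTensor (p q : ℝ) (a b c : Fin 7) :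
    e0OmegaSq (curvatureTensor p q a b) c =
      p * e0OmegaSq (etaMetricInt a b) c + q * e0OmegaSq (imOmegaInt a b) c := by
  fin_cases c <;> simp [e0OmegaSq, curvatureTensor] <;> ring

/-- The wedge product of `T ∧ T` with `ψ` for the matrix `T = B + δ C + m e₀ 𝓘`. -/
theorem psiContraction_torsionTensor_sq (δ m : ℝ) (a b c : Fin 7) :
    psiContraction (fun i j => ∑ l,
      (torsionTensor (1 + δ) δ (1 - δ + m) a l i * torsionTensor (1 + δ) δ (1 - δ + m) l b j
      - torsionTensor (1 + δ) δ (1 - δ + m) a l j * torsionTensor (1 + δ) δ (1 - δ + m) l b i)) c =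
      (1 - δ) * (1 + 3 * δ) * omegaCoeff a b * kron 0 c +
      e0OmegaSq (curvatureTensor ((1 + m - 5 * δ) * (1 + δ)) (δ ^ 2 - 2 * (2 + m) * δ - 1) a b)
        c := by
  set l : ℝ := 1 + δ with hl
  set μ : ℝ := 1 - δ + m with hμ
  have h : ∀ i j, ∑ s, (torsionTensor l δ μ a s i * torsionTensor l δ μ s b j
      - torsionTensor l δ μ a s j * torsionTensor l δ μ s b i) =
      l ^ 2 * bracketInt etaOmegaInt etaOmegaInt a b i j
      + (δ ^ 2 * bracketInt reOmegaInt reOmegaInt a b i j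
      + (μ ^ 2 * bracketInt etaIInt etaIInt a b i j
      + ((-(l * δ)) * bracketInt etaOmegaInt reOmegaInt a b i j
      + ((-(l * δ)) * bracketInt reOmegaInt etaOmegaInt a b i j
      + ((l * μ) * bracketInt etaOmegaInt etaIInt a b i j
      + ((l * μ) * bracketInt etaIInt etaOmegaInt a b i j
      + ((-(δ * μ)) * bracketInt reOmegaInt etaIInt a b i j
      + (-(δ * μ)) * bracketInt etaIInt reOmegaInt a b i j))))))) := by
    intro i j
    simp only [bracketInt, sumSeven_eq, Int.cast_sum, Finset.mul_sum, ← Finset.sum_add_distrib]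
    refine Finset.sum_congr rfl fun s _ => ?_
    simp only [torsionTensor]
    push_cast
    ring
  simp only [h]
  simp only [psiContraction_add, psiContraction_const_mul, psiContractionInt_cast]
  have e1 := congrArg (Int.cast : ℤ → ℝ) (psiContractionInt_eta_eta a b c)
  have e2 := congrArg (Int.cast : ℤ → ℝ) (psiContractionInt_re_re a b c)
  have e3 := congrArg (Int.cast : ℤ → ℝ) (psiContractionInt_I_I a b c)
  have e4 := congrArg (Int.cast : ℤ → ℝ) (psiContractionInt_eta_re a b c)
  have e5 := congrArg (Int.cast : ℤ → ℝ) (psiContractionInt_eta_I a b c)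
  have e6 := congrArg (Int.cast : ℤ → ℝ) (psiContractionInt_re_I a b c)
  push_cast at e1 e2 e3 e4 e5 e6
  rw [e0OmegaSq_curvatureTensor]
  rw [omegaInt_cast, kronInt_cast] at e1 e2
  linear_combination l ^ 2 * e1 + δ ^ 2 * e2 + μ ^ 2 * e3 - l * δ * e4 + l * μ * e5 - δ * μ * e6

end pointwise

/-! ### Entries of the connection and curvature matrices -/

section entries

theorem imOmegaInt_cast (i j k : Fin 7) : (imOmegaInt i j k : ℝ) = imOmegaCoeff i j k := by
  simp [imOmegaInt, imOmegaCoeff, detInt, kronDet, kronInt_cast]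

theorem torsionTensor_eq (l d μ : ℝ) (a b j : Fin 7) :
    torsionTensor l d μ a b j = l * (kron 0 a * omegaCoeff b j - kron 0 b * omegaCoeff a j)
      - d * (kronDet 1 2 3 a b j - kronDet 1 5 6 a b j - kronDet 4 2 6 a b j - kronDet 4 5 3 a b j)
      - μ * (omegaCoeff a b * kron 0 j) := by
  simp only [torsionTensor, etaOmegaInt, reOmegaInt, etaIInt, detInt, kronDet]
  push_cast
  simp only [kronInt_cast, omegaInt_cast]
  ring

theorem curvatureTensor_eq (p q : ℝ) (a b j : Fin 7) :
    curvatureTensor p q a b j = p * (kron 0 a * kron b j - kron 0 b * kron a j)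
      + q * imOmegaCoeff a b j := by
  simp only [curvatureTensor, etaMetricInt, imOmegaInt_cast]
  push_cast
  simp only [kronInt_cast]

/-- The inverse of `Idx.toFin`. -/
def Idx.ofFin : Fin 7 → Idx :=
  ![Sum.inl (), Sum.inr (Sum.inl 0), Sum.inr (Sum.inl 1), Sum.inr (Sum.inl 2),
    Sum.inr (Sum.inr 0), Sum.inr (Sum.inr 1), Sum.inr (Sum.inr 2)]

theorem Idx.ofFin_toFin : ∀ a : Idx, Idx.ofFin a.toFin = a := by decide

theorem Idx.toFin_ofFin : ∀ a : Fin 7, (Idx.ofFin a).toFin = a := by decide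

/-- The bijection between the two index types of the coframe. -/
def Idx.equivFin : Idx ≃ Fin 7 where
  toFun := Idx.toFin
  invFun := Idx.ofFin
  left_inv := Idx.ofFin_toFin
  right_inv := Idx.toFin_ofFin

section

variable {V : Type*} [AddCommGroup V] [Module ℝ V] (e₀ : V) (e Je : Fin 3 → V)

theorem sum_kron_mul_smul (t : ℝ) (a : Fin 7) (α : Fin 7 → V) :
    ∑ j, (t * kron a j) • α j = t • α a := by
  simp [kron]

/-- The tensor `torsionTensor` describes the matrix `B + δ C + m e₀ 𝓘`. -/
theorem sum_torsionTensor_smul (t δ m : ℝ) (a b : Fin 7) :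
    (t • blocks Je (-e) (-Je) e 0 (-Matrix.diagonal fun _ => e₀) (Matrix.diagonal fun _ => e₀) 0
      + (t * δ) • blocks Je (-e) (-Je) e (-box e) ((Matrix.diagonal fun _ => e₀) + box Je)
        ((-Matrix.diagonal fun _ => e₀) + box Je) (box e)
      + (t * m) • blocks 0 0 0 0 0 (-Matrix.diagonal fun _ => e₀) (Matrix.diagonal fun _ => e₀) 0 :
        Matrix Idx Idx V) (Idx.ofFin a) (Idx.ofFin b) =
      ∑ j, (t * torsionTensor (1 + δ) δ (1 - δ + m) a b j) •
        (Sum.elim (fun _ => e₀) (Sum.elim e Je) (Idx.ofFin j) : V) := by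
  have hk : ∀ a, kron a a = 1 := fun a => if_pos rfl
  have hk' : ∀ a b, a ≠ b → kron a b = 0 := fun a b h => if_neg h
  simp only [torsionTensor_eq, omegaCoeff, kronDet]
  fin_cases a <;> fin_cases b <;>
    simp [hk, hk', mul_add, mul_sub, add_smul, sub_smul, ← mul_assoc, sum_kron_mul_smul,
      blocks, box, Idx.ofFin] <;>
    try module

/-- The tensor `curvatureTensor` describes the second matrix in the formula for `R ∧ ψ`. -/
theorem sum_curvatureTensor_smul (p q : ℝ) (a b : Fin 7) :
    blocks (p • e) (p • Je) (-p • e) (-p • Je) (q • box Je) (q • box e) (q • box e)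
      (-q • box Je) (Idx.ofFin a) (Idx.ofFin b) =
      ∑ j, curvatureTensor p q a b j •
        (Sum.elim (fun _ => e₀) (Sum.elim e Je) (Idx.ofFin j) : V) := by
  have hk : ∀ a, kron a a = 1 := fun a => if_pos rfl
  have hk' : ∀ a b, a ≠ b → kron a b = 0 := fun a b h => if_neg h
  simp only [curvatureTensor_eq, imOmegaCoeff, kronDet]
  fin_cases a <;> fin_cases b <;>
    simp [hk, hk', sum_kron_mul_smul, blocks, box, Idx.ofFin]

end

variable {K : Type*} [TopologicalSpace K] [ChartedSpace (EuclideanSpace ℝ (Fin 7)) K]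
  [IsManifold (𝓡 7) ∞ K]

namespace ContactCalabiYau.SU3Coframe

variable {S : ContactCalabiYau K} (c : S.SU3Coframe) {ε : ℝ} {x : K}

/-- The coframe `(e₀, e, Je)` numbered by `0, …, 6`. -/
noncomputable def cof (ε : ℝ) (a : Fin 7) : Form K 1 ℝ := c.coframe ε (Idx.ofFin a)

/-- The matrix of the transverse Levi-Civita connection, extended by zero. -/
noncomputable def conn (Γ : Matrix (Fin 3 ⊕ Fin 3) (Fin 3 ⊕ Fin 3) (Form K 1 ℝ)) (a b : Fin 7) :
    Form K 1 ℝ :=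
  (Matrix.fromBlocks 0 0 0 Γ : Matrix Idx Idx (Form K 1 ℝ)) (Idx.ofFin a) (Idx.ofFin b)

theorem θ_ofFin (Γ : Matrix (Fin 3 ⊕ Fin 3) (Fin 3 ⊕ Fin 3) (Form K 1 ℝ)) (ε δ m k : ℝ)
    (a b : Fin 7) :
    c.θ Γ ε δ m k (Idx.ofFin a) (Idx.ofFin b) = conn Γ a b +
      ∑ j, (k * ε / 2 * torsionTensor (1 + δ) δ (1 - δ + m) a b j) • c.cof ε j := by
  have h := sum_torsionTensor_smul (S.e₀ ε) c.e c.Je (k * ε / 2) δ m a b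
  refine Eq.trans ?_ (congrArg (conn Γ a b + ·) h)
  rw [θ, show k * ε * δ / 2 = k * ε / 2 * δ by ring, show k * m * ε / 2 = k * ε / 2 * m by ring,
    add_assoc, add_assoc]
  simp only [add_assoc]
  rfl

omit [IsManifold (𝓡 7) ∞ K] in
theorem timesI_ofFin {n : ℕ} (α : Form K n ℝ) (a b : Fin 7) :
    timesI α (Idx.ofFin a) (Idx.ofFin b) = (-omegaCoeff a b) • α := by
  fin_cases a <;> fin_cases b <;>
    simp [timesI, blocks, Idx.ofFin, omegaCoeff, kron]

theorem blocks_ofFin (p q : ℝ) (ε : ℝ) (a b : Fin 7) :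
    blocks (p • c.e) (p • c.Je) (-p • c.e) (-p • c.Je) (q • box c.Je) (q • box c.e) (q • box c.e)
      (-q • box c.Je) (Idx.ofFin a) (Idx.ofFin b) =
      ∑ j, curvatureTensor p q a b j • c.cof ε j :=
  sum_curvatureTensor_smul (S.e₀ ε) c.e c.Je p q a b

end ContactCalabiYau.SU3Coframe

end entries

/-! ### Structure equations -/

section structure_equations

theorem IsSU3.add {A B : Fin 7 → Fin 7 → ℝ} (hA : IsSU3 A) (hB : IsSU3 B) :
    IsSU3 fun a b => A a b + B a b := by
  obtain ⟨⟨a1, a2⟩, a3⟩ := hA.symm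
  obtain ⟨⟨a4, a5⟩, a6⟩ := hA.diag
  obtain ⟨⟨b1, b2⟩, b3⟩ := hB.symm
  obtain ⟨⟨b4, b5⟩, b6⟩ := hB.diag
  refine ⟨fun a b => ?_, fun b => ?_, ?_, ?_, ?_⟩
  · rw [hA.skew, hB.skew]; ring
  · rw [hA.zero, hB.zero, add_zero]
  · simp [a1, a2, a3, b1, b2, b3]
  · simp [a4, a5, a6, b4, b5, b6]
  · linarith [hA.trace, hB.trace]

variable {K : Type*} [TopologicalSpace K] [ChartedSpace (EuclideanSpace ℝ (Fin 7)) K]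
  [IsManifold (𝓡 7) ∞ K]

/-- A `1`-form is determined by its values on a basis. -/
theorem ContinuousAlternatingMap.ext_one {M ι : Type*} [AddCommGroup M] [Module ℝ M]
    [TopologicalSpace M] (f : Module.Basis ι ℝ M) {α β : M [⋀^Fin 1]→L[ℝ] ℝ}
    (h : ∀ i, α ![f i] = β ![f i]) : α = β := by
  have h1 : α.toFunctional = β.toFunctional := f.ext h
  refine ContinuousAlternatingMap.ext fun v => ?_
  have h2 : v = ![v 0] := funext fun i => by rw [Subsingleton.elim i 0]; rfl
  rw [h2]
  exact congrArg (fun l => l (v 0)) h1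

namespace ContactCalabiYau

theorem smoothAt_η (S : ContactCalabiYau K) (x : K) : S.η.SmoothAt x := S.smooth_η x trivial

theorem d_omega (S : ContactCalabiYau K) (x : K) : S.omega.d x = 0 :=
  Form.d_d (Filter.Eventually.of_forall fun z => S.smoothAt_η z)

namespace SU3Coframe

variable {S : ContactCalabiYau K} (c : S.SU3Coframe) {ε : ℝ} {x : K}

theorem eventually_mem (hx : x ∈ c.U) : ∀ᶠ z in 𝓝 x, z ∈ c.U := c.isOpen_U.mem_nhds hx

theorem smoothAt_e (i : Fin 3) (hx : x ∈ c.U) : (c.e i).SmoothAt x := c.smooth_e i x hx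

theorem smoothAt_Je (i : Fin 3) (hx : x ∈ c.U) : (c.Je i).SmoothAt x :=
  smoothAt_JForm S (c.smoothAt_e i hx)

theorem smoothAt_cof (a : Fin 7) (hx : x ∈ c.U) : (c.cof ε a).SmoothAt x := by
  fin_cases a
  exacts [(S.smoothAt_η x).const_smul ε, c.smoothAt_e 0 hx, c.smoothAt_e 1 hx, c.smoothAt_e 2 hx,
    c.smoothAt_Je 0 hx, c.smoothAt_Je 1 hx, c.smoothAt_Je 2 hx]

theorem IsDualFrame.cof_apply {f : Fin 7 → TangentSpace (𝓡 7) x} (hf : c.IsDualFrame ε x f)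
    (a j : Fin 7) : c.cof ε a x ![f j] = kron a j := by
  have h := hf (Idx.ofFin a) j
  rwa [Idx.toFin_ofFin] at h

/-- The closedness of `ω` in terms of the derivatives of an `SU(3)`-coframe. -/
theorem dOmegaCoeff_eq_zero {f : Fin 7 → TangentSpace (𝓡 7) x} (hf : c.IsDualFrame ε x f)
    (hx : x ∈ c.U) (i j k : Fin 7) :
    dOmegaCoeff (fun a i j => (c.cof ε a).d x ![f i, f j]) i j k = 0 := by
  have h1 := S.d_omega x
  rw [Form.d_congr (β := ∑ i, c.e i ∧ᶠ c.Je i)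
    ((c.eventually_mem hx).mono fun z hz => c.omega_eq z hz),
    Form.d_sum fun i _ => (c.smoothAt_e i hx).wedge (c.smoothAt_Je i hx)] at h1
  have h2 : ∀ a : Fin 3, (c.e a ∧ᶠ c.Je a).d x ![f i, f j, f k] =
      ((c.e a).d x ![f i, f j] * c.Je a x ![f k] - (c.e a).d x ![f i, f k] * c.Je a x ![f j]
        + (c.e a).d x ![f j, f k] * c.Je a x ![f i])
      - (c.e a x ![f i] * (c.Je a).d x ![f j, f k] - c.e a x ![f j] * (c.Je a).d x ![f i, f k]
        + c.e a x ![f k] * (c.Je a).d x ![f i, f j]) := fun a => by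
    rw [Form.d_wedge_one_one (c.smoothAt_e a hx) (c.smoothAt_Je a hx)]
    exact congrArg₂ (fun p q : ℝ => p - q)
      (wedgeAlt_two_one ((c.e a).d x) (c.Je a x) ![f i, f j, f k])
      (wedgeAlt_one_two (c.e a x) ((c.Je a).d x) ![f i, f j, f k])
  have h3 : ∑ a, (c.e a ∧ᶠ c.Je a).d x ![f i, f j, f k] = 0 := by
    rw [← ContinuousAlternatingMap.sum_apply]
    exact congrArg (fun α => α ![f i, f j, f k]) h1
  simp only [h2, hf.e_apply, hf.Je_apply] at h3
  rw [← h3]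
  refine Finset.sum_congr rfl fun a _ => ?_
  fin_cases a <;> rfl

/-- The closedness of `Ω` in terms of the derivatives of an `SU(3)`-coframe. -/
theorem dUpsilonCoeff_eq_zero {f : Fin 7 → TangentSpace (𝓡 7) x} (hf : c.IsDualFrame ε x f)
    (hx : x ∈ c.U) (i j k l : Fin 7) :
    dUpsilonCoeff (fun a i j => ((c.cof ε a).d x ![f i, f j] : ℂ) +
      Complex.I * ((c.cof ε (a + 3)).d x ![f i, f j] : ℂ)) i j k l = 0 := by
  let t (a : Fin 3) : Form K 1 ℂ := (c.e a).toComplex + Complex.I • (c.Je a).toComplex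
  have ht : ∀ a, (t a).SmoothAt x := fun a =>
    (c.smoothAt_e a hx).toComplex.add (c.smoothAt_Je a hx).toComplex.I_smul
  have hta : ∀ a i, t a x ![f i] = complexKron (![1, 2, 3] a) i := fun a i => by
    change (c.e a x ![f i] : ℂ) + Complex.I * (c.Je a x ![f i] : ℂ) = _
    rw [hf.e_apply, hf.Je_apply]
    fin_cases a <;> rfl
  have htd : ∀ a i j, (t a).d x ![f i, f j] = ((c.e a).d x ![f i, f j] : ℂ) +
      Complex.I * ((c.Je a).d x ![f i, f j] : ℂ) := fun a i j => by
    rw [Form.d_add (c.smoothAt_e a hx).toComplex (c.smoothAt_Je a hx).toComplex.I_smul]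
    refine congrArg₂ (· + ·) (Form.d_toComplex (c.smoothAt_e a hx) _) ?_
    exact (Form.d_I_smul (c.smoothAt_Je a hx).toComplex _).trans
      (congrArg _ (Form.d_toComplex (c.smoothAt_Je a hx) _))
  have h1 : (t 0 ∧ᶠ t 1 ∧ᶠ t 2 : Form K 3 ℂ).d x = 0 := by
    have h0 : S.Ω.d x = 0 := by rw [S.dΩ]; rfl
    exact (Form.d_congr ((c.eventually_mem hx).mono fun z hz => (c.Omega_eq z hz).symm)).trans h0
  rw [Form.d_wedge_two_one ((ht 0).wedge (ht 1)) (ht 2), Form.d_wedge_one_one (ht 0) (ht 1)] at h1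
  have h2 := congrArg (fun α => α ![f i, f j, f k, f l]) h1
  have h3 := (congrArg₂ (· + ·) (wedgeAlt_three_one
      (wedgeAlt ((t 0).d x) (t 1 x) - wedgeAlt (t 0 x) ((t 1).d x)) (t 2 x) ![f i, f j, f k, f l])
    (wedgeAlt_two_two (wedgeAlt (t 0 x) (t 1 x)) ((t 2).d x) ![f i, f j, f k, f l])).symm.trans h2
  have w2 := fun i j => wedgeAlt_one_one (t 0 x) (t 1 x) ![f i, f j]
  have w3 := fun i j k => congrArg₂ (fun p q : ℂ => p - q)
    (wedgeAlt_two_one ((t 0).d x) (t 1 x) ![f i, f j, f k])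
    (wedgeAlt_one_two (t 0 x) ((t 1).d x) ![f i, f j, f k])
  have w3 : ∀ i j k, (wedgeAlt ((t 0).d x) (t 1 x) - wedgeAlt (t 0 x) ((t 1).d x))
      ![f i, f j, f k] = _ := w3
  simp only [Matrix.cons_val] at h3 w2 w3
  simp only [w2, w3] at h3
  simp only [hta, htd] at h3
  simp only [Matrix.cons_val] at h3
  refine Eq.trans ?_ h3
  change wedgeCoeff (fun i j => ((c.e 0).d x ![f i, f j] : ℂ) +
      Complex.I * ((c.Je 0).d x ![f i, f j] : ℂ)) _ _ i j k l - wedgeCoeff (fun i j =>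
      ((c.e 1).d x ![f i, f j] : ℂ) + Complex.I * ((c.Je 1).d x ![f i, f j] : ℂ)) _ _ i j k l +
      wedgeCoeff (fun i j => ((c.e 2).d x ![f i, f j] : ℂ) +
      Complex.I * ((c.Je 2).d x ![f i, f j] : ℂ)) _ _ i j k l = _
  simp only [wedgeCoeff]
  ring

end SU3Coframe

end ContactCalabiYau

end structure_equations

/-! ### Curvature of the connection -/

section curvature

variable {K : Type*} [TopologicalSpace K] [ChartedSpace (EuclideanSpace ℝ (Fin 7)) K]
  [IsManifold (𝓡 7) ∞ K]

namespace ContactCalabiYau.SU3Coframe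

variable {S : ContactCalabiYau K} {c : S.SU3Coframe} {ε : ℝ} {x : K}

omit [IsManifold (𝓡 7) ∞ K] in
theorem conn_zero_left (Γ : Matrix (Fin 3 ⊕ Fin 3) (Fin 3 ⊕ Fin 3) (Form K 1 ℝ)) (b : Fin 7) :
    conn Γ 0 b = 0 := by
  fin_cases b <;> rfl

omit [IsManifold (𝓡 7) ∞ K] in
theorem conn_zero_right (Γ : Matrix (Fin 3 ⊕ Fin 3) (Fin 3 ⊕ Fin 3) (Form K 1 ℝ)) (a : Fin 7) :
    conn Γ a 0 = 0 := by
  fin_cases a <;> rfl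

namespace IsTransverseLeviCivita

variable {Γ : Matrix (Fin 3 ⊕ Fin 3) (Fin 3 ⊕ Fin 3) (Form K 1 ℝ)}
  (hΓ : c.IsTransverseLeviCivita Γ)
include hΓ

theorem smoothAt_conn (a b : Fin 7) (hx : x ∈ c.U) : (conn Γ a b).SmoothAt x := by
  have h0 : (0 : Form K 1 ℝ).SmoothAt x := Form.SmoothAt.zero
  obtain ⟨a, rfl⟩ := Idx.toFin_surjective a
  obtain ⟨b, rfl⟩ := Idx.toFin_surjective b
  rw [conn, Idx.ofFin_toFin, Idx.ofFin_toFin]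
  rcases a with _ | a <;> rcases b with _ | b
  exacts [h0, h0, h0, hΓ.smooth a b x hx]

theorem conn_skew (a b : Fin 7) (hx : x ∈ c.U) : conn Γ b a x = -conn Γ a b x := by
  have h0 : (0 : Form K 1 ℝ) x = -(0 : Form K 1 ℝ) x := neg_zero.symm
  obtain ⟨a, rfl⟩ := Idx.toFin_surjective a
  obtain ⟨b, rfl⟩ := Idx.toFin_surjective b
  rw [conn, conn, Idx.ofFin_toFin, Idx.ofFin_toFin]
  rcases a with _ | a <;> rcases b with _ | b
  exacts [h0, h0, h0, hΓ.skew a b x hx]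

/-- The structure equations of the coframe `(e₀, e, Je)`. -/
theorem d_cof (a : Fin 7) (hx : x ∈ c.U) :
    (c.cof ε a).d x =
      (((kron 0 a * ε) • S.omega - ∑ b, conn Γ a b ∧ᶠ c.cof ε b : Form K 2 ℝ)) x := by
  obtain ⟨a, rfl⟩ := Idx.toFin_surjective a
  have hsum : (∑ b, conn Γ a.toFin b ∧ᶠ c.cof ε b : Form K 2 ℝ) x =
      (∑ b : Idx, (Matrix.fromBlocks 0 0 0 Γ : Matrix Idx Idx (Form K 1 ℝ)) a b ∧ᶠ c.coframe ε b :
        Form K 2 ℝ) x := by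
    refine congrArg (fun α : Form K 2 ℝ => α x) ?_
    refine (Fintype.sum_equiv Idx.equivFin _ _ fun b => ?_).symm
    change _ = conn Γ a.toFin b.toFin ∧ᶠ c.cof ε b.toFin
    rw [conn, cof, Idx.ofFin_toFin, Idx.ofFin_toFin]
  have hwz : ∀ β : Form K 1 ℝ, ((0 : Form K 1 ℝ) ∧ᶠ β : Form K 2 ℝ) = 0 := fun β => by
    funext y
    refine ContinuousAlternatingMap.ext fun v => (wedgeAlt_one_one _ _ v).trans ?_
    change (0 : ℝ) * _ - 0 * _ = 0
    ring
  change _ = ((kron 0 a.toFin * ε) • S.omega) x - (∑ b, conn Γ a.toFin b ∧ᶠ c.cof ε b : Form K 2 ℝ) x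
  rw [hsum, cof, Idx.ofFin_toFin, Fintype.sum_sum_type]
  rcases a with _ | a
  · simp only [Matrix.fromBlocks_apply₁₁, Matrix.fromBlocks_apply₁₂, Matrix.zero_apply, hwz,
      Finset.sum_const_zero, add_zero]
    have h1 := Form.d_smul ε S.η x
    refine h1.trans ?_
    have h2 : kron 0 (Idx.toFin (Sum.inl ())) = 1 := if_pos rfl
    rw [h2, one_mul]
    exact (sub_zero _).symm
  · have h3 : ∀ a, 0 ≠ Idx.toFin (Sum.inr a) := by decide
    have h2 : kron 0 (Idx.toFin (Sum.inr a)) = 0 := if_neg (h3 a)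
    simp only [Matrix.fromBlocks_apply₂₁, Matrix.fromBlocks_apply₂₂, Matrix.zero_apply, hwz,
      Finset.sum_const_zero, zero_add, h2, zero_mul, zero_smul]
    exact (hΓ.torsion_free a x hx).trans (zero_sub _).symm

theorem d_cof_apply {f : Fin 7 → TangentSpace (𝓡 7) x} (hf : c.IsDualFrame ε x f)
    (hx : x ∈ c.U) (a i j : Fin 7) :
    (c.cof ε a).d x ![f i, f j] = kron 0 a * ε * omegaCoeff i j +
      torsionCoeff (fun a b i => conn Γ a b x ![f i]) a i j := by
  rw [hΓ.d_cof a hx, ← hf.omega_apply hx]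
  have h1 : (∑ b, conn Γ a b ∧ᶠ c.cof ε b : Form K 2 ℝ) x ![f i, f j] =
      ∑ b, (conn Γ a b x ![f i] * kron b j - conn Γ a b x ![f j] * kron b i) := by
    rw [Finset.sum_apply, ContinuousAlternatingMap.sum_apply]
    refine Finset.sum_congr rfl fun b _ => (wedgeAlt_one_one _ _ _).trans ?_
    rw [← hf.cof_apply, ← hf.cof_apply]
    rfl
  have h2 : (∑ b, conn Γ a b ∧ᶠ c.cof ε b : Form K 2 ℝ) x ![f i, f j] =
      conn Γ a j x ![f i] - conn Γ a i x ![f j] := by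
    rw [h1, Finset.sum_sub_distrib]
    simp [kron]
  change kron 0 a * ε * S.omega x ![f i, f j] - (∑ b, conn Γ a b ∧ᶠ c.cof ε b : Form K 2 ℝ) x ![f i, f j] = _
  rw [h2, torsionCoeff]
  ring

theorem torsionCoeff_conn {f : Fin 7 → TangentSpace (𝓡 7) x} (hf : c.IsDualFrame ε x f)
    (hx : x ∈ c.U) {a : Fin 7} (ha : a ≠ 0) (i j : Fin 7) :
    torsionCoeff (fun a b i => conn Γ a b x ![f i]) a i j = (c.cof ε a).d x ![f i, f j] := by
  rw [hΓ.d_cof_apply hf hx, kron, if_neg ha.symm]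
  ring

/-- The holonomy of the transverse Levi-Civita connection reduces to `SU(3)`. -/
theorem isSU3_conn {f : Fin 7 → TangentSpace (𝓡 7) x} (hf : c.IsDualFrame ε x f)
    (hx : x ∈ c.U) (i : Fin 7) : IsSU3 fun a b => conn Γ a b x ![f i] := by
  refine isSU3_of_closed (G := fun a b i => conn Γ a b x ![f i]) (fun a b i => ?_) (fun b i => ?_)
    (fun i j k => ?_) (fun i j k l => ?_) i
  · rw [hΓ.conn_skew a b hx]
    rfl
  · rw [conn_zero_left]
    rfl
  · rw [← c.dOmegaCoeff_eq_zero hf hx i j k]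
    have hne : ∀ a : Fin 3, (![1, 2, 3] a : Fin 7) ≠ 0 ∧ (![1, 2, 3] a + 3 : Fin 7) ≠ 0 := by decide
    refine Finset.sum_congr rfl fun a _ => ?_
    simp only [hΓ.torsionCoeff_conn hf hx (hne a).1, hΓ.torsionCoeff_conn hf hx (hne a).2]
  · rw [← c.dUpsilonCoeff_eq_zero hf hx i j k l]
    have hT : ∀ a : Fin 7, a ≠ 0 → a + 3 ≠ 0 →
        complexTorsionCoeff (fun a b i => conn Γ a b x ![f i]) a = fun i j =>
          ((c.cof ε a).d x ![f i, f j] : ℂ)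
            + Complex.I * ((c.cof ε (a + 3)).d x ![f i, f j] : ℂ) := fun a h1 h2 => by
      funext i j
      rw [complexTorsionCoeff, hΓ.torsionCoeff_conn hf hx h1, hΓ.torsionCoeff_conn hf hx h2]
    rw [dUpsilonCoeff, hT 1 (by decide) (by decide), hT 2 (by decide) (by decide),
      hT 3 (by decide) (by decide)]
    rfl

theorem isSU3_d_conn (hε : 0 < ε) {f : Fin 7 → TangentSpace (𝓡 7) x} (hx : x ∈ c.U)
    (i j : Fin 7) : IsSU3 fun a b => (conn Γ a b).d x ![f i, f j] := by
  have hev := c.eventually_mem hx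
  -- The linear relations hold between the `1`-forms on `U`, hence for their derivatives.
  have hrel : ∀ a b a' b', (∀ A, IsSU3 A → A a b = A a' b') →
      (conn Γ a b).d x = (conn Γ a' b').d x := fun a b a' b' h => by
    refine Form.d_congr (hev.mono fun z hz => ?_)
    obtain ⟨g, hg⟩ := c.exists_isDualFrame hε hz
    exact ContinuousAlternatingMap.ext_one g fun i => h _ (hΓ.isSU3_conn hg hz i)
  have hap : ∀ a b a' b', (∀ A, IsSU3 A → A a b = A a' b') →
      (conn Γ a b).d x ![f i, f j] = (conn Γ a' b').d x ![f i, f j] := fun a b a' b' h => by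
    rw [hrel a b a' b' h]
  refine ⟨fun a b => ?_, fun b => ?_, ⟨⟨?_, ?_⟩, ?_⟩, ⟨⟨?_, ?_⟩, ?_⟩, ?_⟩
  · have h1 : (conn Γ b a).d x = (-conn Γ a b).d x :=
      Form.d_congr (hev.mono fun z hz => hΓ.conn_skew a b hz)
    rw [h1, Form.d_neg]
    rfl
  · rw [conn_zero_left, Form.d_zero]
    rfl
  · exact hap _ _ _ _ fun A h => h.symm.1.1
  · exact hap _ _ _ _ fun A h => h.symm.1.2
  · exact hap _ _ _ _ fun A h => h.symm.2
  · exact hap _ _ _ _ fun A h => h.diag.1.1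
  · exact hap _ _ _ _ fun A h => h.diag.1.2
  · exact hap _ _ _ _ fun A h => h.diag.2
  · have h1 : (conn Γ 1 4 + conn Γ 2 5 + conn Γ 3 6).d x = (0 : Form K 1 ℝ).d x := by
      refine Form.d_congr (hev.mono fun z hz => ?_)
      obtain ⟨g, hg⟩ := c.exists_isDualFrame hε hz
      exact ContinuousAlternatingMap.ext_one g fun i => (hΓ.isSU3_conn hg hz i).trace
    have s := fun a b => hΓ.smoothAt_conn a b hx
    rw [Form.d_add ((s 1 4).add (s 2 5)) (s 3 6), Form.d_add (s 1 4) (s 2 5), Form.d_zero] at h1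
    exact congrArg (fun α => α ![f i, f j]) h1

/-- The components of the curvature of the transverse Levi-Civita connection. -/
noncomputable def _root_.ContactCalabiYau.SU3Coframe.riem
    (Γ : Matrix (Fin 3 ⊕ Fin 3) (Fin 3 ⊕ Fin 3) (Form K 1 ℝ)) {x : K}
    (f : Fin 7 → TangentSpace (𝓡 7) x) (a b i j : Fin 7) : ℝ :=
  (conn Γ a b).d x ![f i, f j] + ∑ l, (conn Γ a l x ![f i] * conn Γ l b x ![f j]
    - conn Γ a l x ![f j] * conn Γ l b x ![f i])

theorem isSU3_riem (hε : 0 < ε) {f : Fin 7 → TangentSpace (𝓡 7) x} (hf : c.IsDualFrame ε x f)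
    (hx : x ∈ c.U) (i j : Fin 7) : IsSU3 fun a b => riem Γ f a b i j :=
  (hΓ.isSU3_d_conn hε hx i j).add ((hΓ.isSU3_conn hf hx i).commutator (hΓ.isSU3_conn hf hx j))

/-- The first Bianchi identity, from `d (d E_a) = 0`. -/
theorem bianchi {f : Fin 7 → TangentSpace (𝓡 7) x} (hf : c.IsDualFrame ε x f)
    (hx : x ∈ c.U) (a i j k : Fin 7) :
    riem Γ f a k i j - riem Γ f a j i k + riem Γ f a i j k = 0 := by
  have hev := c.eventually_mem hx
  have sA := fun a b => hΓ.smoothAt_conn a b hx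
  have sE := fun a => c.smoothAt_cof (ε := ε) a hx
  have h1 : (c.cof ε a).d.d x = 0 := Form.d_d (hev.mono fun z hz => c.smoothAt_cof a hz)
  have sω : S.omega.SmoothAt x :=
    Form.SmoothAt.d (Filter.Eventually.of_forall fun z => S.smoothAt_η z)
  have h2 : (c.cof ε a).d.d x = ((kron 0 a * ε) • S.omega -
      ∑ b, conn Γ a b ∧ᶠ c.cof ε b : Form K 2 ℝ).d x :=
    Form.d_congr (hev.mono fun z hz => hΓ.d_cof a hz)
  have sW : ∀ b, (conn Γ a b ∧ᶠ c.cof ε b : Form K 2 ℝ).SmoothAt x := fun b => (sA a b).wedge (sE b)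
  have h3 : (∑ b, conn Γ a b ∧ᶠ c.cof ε b : Form K 2 ℝ).d x = 0 := by
    rw [h1, sub_eq_add_neg, Form.d_add (sω.const_smul _) (Form.SmoothAt.sum fun b _ => sW b).neg,
      Form.d_smul, S.d_omega, smul_zero, zero_add, Form.d_neg] at h2
    exact neg_eq_zero.1 h2.symm
  rw [Form.d_sum fun b _ => sW b] at h3
  have h4 : ∑ b, (conn Γ a b ∧ᶠ c.cof ε b : Form K 2 ℝ).d x ![f i, f j, f k] = 0 := by
    rw [← ContinuousAlternatingMap.sum_apply]
    exact congrArg (fun α => α ![f i, f j, f k]) h3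
  have h5 : ∀ b, (conn Γ a b ∧ᶠ c.cof ε b : Form K 2 ℝ).d x ![f i, f j, f k] =
      ((conn Γ a b).d x ![f i, f j] * c.cof ε b x ![f k]
        - (conn Γ a b).d x ![f i, f k] * c.cof ε b x ![f j]
        + (conn Γ a b).d x ![f j, f k] * c.cof ε b x ![f i])
      - (conn Γ a b x ![f i] * (c.cof ε b).d x ![f j, f k]
        - conn Γ a b x ![f j] * (c.cof ε b).d x ![f i, f k]
        + conn Γ a b x ![f k] * (c.cof ε b).d x ![f i, f j]) := fun b => by
    rw [Form.d_wedge_one_one (sA a b) (sE b)]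
    exact congrArg₂ (fun p q : ℝ => p - q)
      (wedgeAlt_two_one ((conn Γ a b).d x) (c.cof ε b x) ![f i, f j, f k])
      (wedgeAlt_one_two (conn Γ a b x) ((c.cof ε b).d x) ![f i, f j, f k])
  have h6 : ∀ b i j k, conn Γ a b x ![f i] * (c.cof ε b).d x ![f j, f k] =
      conn Γ a b x ![f i] * torsionCoeff (fun a b i => conn Γ a b x ![f i]) b j k :=
    fun b i j k => by
    by_cases hb : b = 0
    · have h0 : conn Γ a b x ![f i] = 0 := by
        rw [hb, conn_zero_right]
        rfl
      rw [h0, zero_mul, zero_mul]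
    · rw [hΓ.torsionCoeff_conn hf hx hb]
  simp only [h5, h6, hf.cof_apply, torsionCoeff] at h4
  rw [Finset.sum_sub_distrib, Finset.sum_add_distrib, Finset.sum_sub_distrib] at h4
  have h7 : ∀ u : Fin 7 → ℝ, ∀ k, ∑ b, u b * kron b k = u k := fun u k => by simp [kron]
  rw [h7 fun b => (conn Γ a b).d x ![f i, f j], h7 fun b => (conn Γ a b).d x ![f i, f k],
    h7 fun b => (conn Γ a b).d x ![f j, f k]] at h4
  refine Eq.trans ?_ h4
  simp only [riem]
  have h8 : ∀ p q r s t u v : ℝ, s - t + u = -v → p + s - (q + t) + (r + u) = p - q + r - v :=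
    fun p q r s t u v h => by linarith
  refine h8 _ _ _ _ _ _ _ ?_
  rw [← Finset.sum_sub_distrib, ← Finset.sum_add_distrib, ← Finset.sum_neg_distrib]
  exact Finset.sum_congr rfl fun l _ => by ring

/-- The curvature of the transverse Levi-Civita connection is annihilated by `ψ`. -/
theorem psiContraction_riem (hε : 0 < ε) {f : Fin 7 → TangentSpace (𝓡 7) x}
    (hf : c.IsDualFrame ε x f) (hx : x ∈ c.U) (a b k : Fin 7) :
    psiContraction (riem Γ f a b) k = 0 := by
  refine psiContraction_eq_zero_of_bianchi (hΓ.isSU3_riem hε hf hx) (fun a b i j => ?_)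
    (hΓ.bianchi hf hx) a b k
  have h1 : (conn Γ a b).d x ![f j, f i] = -(conn Γ a b).d x ![f i, f j] :=
    ContinuousAlternatingMap.map_swap_two _ _ _
  rw [riem, riem, h1, neg_add, ← Finset.sum_neg_distrib]
  exact congrArg _ (Finset.sum_congr rfl fun l _ => by ring)

omit hΓ in
theorem θ_apply {f : Fin 7 → TangentSpace (𝓡 7) x} (hf : c.IsDualFrame ε x f)
    (δ m k : ℝ) (a b i : Fin 7) :
    c.θ Γ ε δ m k (Idx.ofFin a) (Idx.ofFin b) x ![f i] = conn Γ a b x ![f i] +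
      k * ε / 2 * torsionTensor (1 + δ) δ (1 - δ + m) a b i := by
  rw [θ_ofFin]
  have h : (∑ j, (k * ε / 2 * torsionTensor (1 + δ) δ (1 - δ + m) a b j) • c.cof ε j :
      Form K 1 ℝ) x ![f i] = ∑ j, (k * ε / 2 * torsionTensor (1 + δ) δ (1 - δ + m) a b j) *
      kron j i := by
    rw [Finset.sum_apply, ContinuousAlternatingMap.sum_apply]
    refine Finset.sum_congr rfl fun j _ => ?_
    rw [← hf.cof_apply]
    rfl
  refine (congrArg (conn Γ a b x ![f i] + ·) h).trans ?_
  simp [kron]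

theorem d_θ_apply {f : Fin 7 → TangentSpace (𝓡 7) x} (hf : c.IsDualFrame ε x f) (hx : x ∈ c.U)
    (δ m k : ℝ) (a b i j : Fin 7) :
    (c.θ Γ ε δ m k (Idx.ofFin a) (Idx.ofFin b)).d x ![f i, f j] =
      (conn Γ a b).d x ![f i, f j] + k * ε / 2 * (-(1 - δ + m) * omegaCoeff a b * ε * omegaCoeff i j
        + ∑ l, torsionTensor (1 + δ) δ (1 - δ + m) a b l *
          (conn Γ l i x ![f j] - conn Γ l j x ![f i])) := by
  have sE := fun l (t : ℝ) => (c.smoothAt_cof (ε := ε) l hx).const_smul t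
  rw [θ_ofFin, Form.d_add (hΓ.smoothAt_conn a b hx) (Form.SmoothAt.sum fun l _ => sE l _),
    Form.d_sum fun l _ => sE l _]
  have h : (∑ l, Form.d ((k * ε / 2 * torsionTensor (1 + δ) δ (1 - δ + m) a b l) • c.cof ε l) x)
      ![f i, f j] = ∑ l, k * ε / 2 * (torsionTensor (1 + δ) δ (1 - δ + m) a b l *
        (kron 0 l * ε * omegaCoeff i j + (conn Γ l i x ![f j] - conn Γ l j x ![f i]))) := by
    rw [ContinuousAlternatingMap.sum_apply]
    refine Finset.sum_congr rfl fun l _ => ?_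
    rw [Form.d_smul, ← mul_assoc]
    exact congrArg (k * ε / 2 * torsionTensor (1 + δ) δ (1 - δ + m) a b l * ·)
      (hΓ.d_cof_apply hf hx l i j)
  refine (congrArg ((conn Γ a b).d x ![f i, f j] + ·) h).trans ?_
  have h0 : -(1 - δ + m) * omegaCoeff a b * ε * omegaCoeff i j =
      ∑ l, torsionTensor (1 + δ) δ (1 - δ + m) a b l * (kron 0 l * ε * omegaCoeff i j) := by
    rw [← torsionTensor_zero (1 + δ) δ]
    simp [kron, mul_assoc]
  rw [h0, ← Finset.sum_add_distrib, Finset.mul_sum]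
  exact congrArg _ (Finset.sum_congr rfl fun l _ => by ring)

/-- The components of the curvature of `θ`.  As the torsion tensor is parallel for the transverse
Levi-Civita connection, the mixed terms reduce to the contribution of `de₀ = ε ω`. -/
theorem curvature_apply {f : Fin 7 → TangentSpace (𝓡 7) x}
    (hf : c.IsDualFrame ε x f) (hx : x ∈ c.U) (δ m k : ℝ) (a b i j : Fin 7) :
    curvature (c.θ Γ ε δ m k) (Idx.ofFin a) (Idx.ofFin b) x ![f i, f j] =
      riem Γ f a b i j + (-(k * ε / 2 * (1 - δ + m) * omegaCoeff a b * ε) * omegaCoeff i j +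
      (k * ε / 2) ^ 2 * ∑ l,
      (torsionTensor (1 + δ) δ (1 - δ + m) a l i * torsionTensor (1 + δ) δ (1 - δ + m) l b j
      - torsionTensor (1 + δ) δ (1 - δ + m) a l j * torsionTensor (1 + δ) δ (1 - δ + m) l b i)) := by
  have h1 : (∑ l, c.θ Γ ε δ m k (Idx.ofFin a) l ∧ᶠ c.θ Γ ε δ m k l (Idx.ofFin b) : Form K 2 ℝ) x
      ![f i, f j] = ∑ l : Fin 7, (c.θ Γ ε δ m k (Idx.ofFin a) (Idx.ofFin l) x ![f i]
        * c.θ Γ ε δ m k (Idx.ofFin l) (Idx.ofFin b) x ![f j]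
        - c.θ Γ ε δ m k (Idx.ofFin a) (Idx.ofFin l) x ![f j]
        * c.θ Γ ε δ m k (Idx.ofFin l) (Idx.ofFin b) x ![f i]) := by
    rw [Finset.sum_apply, ContinuousAlternatingMap.sum_apply]
    refine (Fintype.sum_equiv Idx.equivFin.symm _ _ fun l => ?_).symm
    exact (wedgeAlt_one_one (c.θ Γ ε δ m k (Idx.ofFin a) (Idx.ofFin l) x)
      (c.θ Γ ε δ m k (Idx.ofFin l) (Idx.ofFin b) x) ![f i, f j]).symm
  have h2 : curvature (c.θ Γ ε δ m k) (Idx.ofFin a) (Idx.ofFin b) x ![f i, f j] =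
      (c.θ Γ ε δ m k (Idx.ofFin a) (Idx.ofFin b)).d x ![f i, f j] +
      (∑ l, c.θ Γ ε δ m k (Idx.ofFin a) l ∧ᶠ c.θ Γ ε δ m k l (Idx.ofFin b) : Form K 2 ℝ) x
      ![f i, f j] := rfl
  rw [h2, h1, hΓ.d_θ_apply hf hx]
  simp only [θ_apply hf, riem]
  set n := torsionTensor (1 + δ) δ (1 - δ + m)
  have hi := torsionTensor_invariant (1 + δ) δ (1 - δ + m) (hΓ.isSU3_conn hf hx i) a b j
  have hj := torsionTensor_invariant (1 + δ) δ (1 - δ + m) (hΓ.isSU3_conn hf hx j) a b i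
  have h3 : ∑ l, n a b l * (conn Γ l i x ![f j] - conn Γ l j x ![f i]) =
      ∑ l, (conn Γ a l x ![f j] * n l b i - n a l i * conn Γ l b x ![f j])
      - ∑ l, (conn Γ a l x ![f i] * n l b j - n a l j * conn Γ l b x ![f i]) := by
    rw [← hi, ← hj, ← Finset.sum_sub_distrib]
    exact Finset.sum_congr rfl fun l _ => by ring
  rw [h3]
  have h4 : ∀ p q r s t u v : ℝ, t = v + k * ε / 2 * (u - r) + (k * ε / 2) ^ 2 * s →
      p + k * ε / 2 * (q + (r - u)) + t = p + v + (k * ε / 2 * q + (k * ε / 2) ^ 2 * s) :=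
    fun p q r s t u v h => by rw [h]; ring
  refine (h4 _ _ _ _ _ _ _ ?_).trans (congrArg₂ (· + ·) rfl (congrArg₂ (· + ·) ?_ rfl))
  · rw [← Finset.sum_sub_distrib, Finset.mul_sum, Finset.mul_sum, ← Finset.sum_add_distrib,
      ← Finset.sum_add_distrib]
    exact Finset.sum_congr rfl fun l _ => by ring
  · ring

set_option maxRecDepth 8000 in
/-- The components of `R ∧ ψ` in a dual frame. -/
theorem curvatureWedgePsi_apply (hε : 0 < ε) {f : Fin 7 → TangentSpace (𝓡 7) x}
    (hf : c.IsDualFrame ε x f) (hx : x ∈ c.U) (δ m k : ℝ) (a b n : Fin 7) :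
    c.curvatureWedgePsi Γ ε δ m k (Idx.ofFin a) (Idx.ofFin b) x (fun i => f (n.succAbove i)) =
      (k * ε ^ 2 * (6 * (1 - δ + m) + k * (1 - δ) * (1 + 3 * δ)) / 4) *
          (omegaCoeff a b * kron 0 n)
        + (k ^ 2 * ε ^ 2 / 4) * e0OmegaSq
          (curvatureTensor ((1 + m - 5 * δ) * (1 + δ)) (δ ^ 2 - 2 * (2 + m) * δ - 1) a b) n := by
  have h0 : c.curvatureWedgePsi Γ ε δ m k (Idx.ofFin a) (Idx.ofFin b) x =
      wedgeAlt (curvature (c.θ Γ ε δ m k) (Idx.ofFin a) (Idx.ofFin b) x)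
        ((1 / 2 : ℝ) • wedgeAlt (S.omega x) (S.omega x) - ε • wedgeAlt (S.η x) (S.Ω.im x)) := rfl
  rw [h0]
  have h1 := wedge_psi_apply (f := f) (curvature (c.θ Γ ε δ m k) (Idx.ofFin a) (Idx.ofFin b) x)
    (hf.omega_apply hx) hf.eta_apply (hf.im_Omega_apply hx) n
  refine h1.trans ?_
  simp only [hΓ.curvature_apply hf hx]
  rw [psiContraction_add, hΓ.psiContraction_riem hε hf hx, psiContraction_add,
    psiContraction_const_mul, psiContraction_const_mul, psiContraction_torsionTensor_sq,
    psiContraction_omegaCoeff]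
  ring

set_option maxRecDepth 8000 in
theorem curvatureWedgePsi_eq (hε : 0 < ε) (hx : x ∈ c.U) (δ m k : ℝ) (a b : Fin 7) :
    c.curvatureWedgePsi Γ ε δ m k (Idx.ofFin a) (Idx.ofFin b) x =
      ((k * ε ^ 2 * (6 * (1 - δ + m) + k * (1 - δ) * (1 + 3 * δ)) / 4) •
          timesI ((1 / 6 : ℝ) • S.omega3)
        + (k ^ 2 * ε ^ 2 / 4) •
          (blocks
            (((1 + m - 5 * δ) * (1 + δ)) • c.e)
            (((1 + m - 5 * δ) * (1 + δ)) • c.Je)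
            (((5 * δ - 1 - m) * (1 + δ)) • c.e)
            (((5 * δ - 1 - m) * (1 + δ)) • c.Je)
            ((δ ^ 2 - 2 * (2 + m) * δ - 1) • box c.Je)
            ((δ ^ 2 - 2 * (2 + m) * δ - 1) • box c.e)
            ((δ ^ 2 - 2 * (2 + m) * δ - 1) • box c.e)
            (-(δ ^ 2 - 2 * (2 + m) * δ - 1) • box c.Je)).map
              fun α => (S.e₀ ε ∧ᶠ ((1 / 2 : ℝ) • S.omega2) ∧ᶠ α : Form K 6 ℝ))
        (Idx.ofFin a) (Idx.ofFin b) x := by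
  obtain ⟨f, hf⟩ := c.exists_isDualFrame hε hx
  have hp : (5 * δ - 1 - m) * (1 + δ) = -((1 + m - 5 * δ) * (1 + δ)) := by ring
  rw [hp]
  simp only [Matrix.add_apply, Matrix.smul_apply, Matrix.map_apply]
  rw [timesI_ofFin, c.blocks_ofFin _ _ ε]
  set M := curvatureTensor ((1 + m - 5 * δ) * (1 + δ)) (δ ^ 2 - 2 * (2 + m) * δ - 1)
  refine ContinuousAlternatingMap.ext_six f fun n => ?_
  refine (hΓ.curvatureWedgePsi_apply hε hf hx δ m k a b n).trans ?_
  have h2 := omega_cubed_apply (hf.omega_apply hx) n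
  have h3 := e0_omega_sq_apply (hf.omega_apply hx) hf.eta_apply ((∑ j, M a b j • c.cof ε j :
    Form K 1 ℝ) x) n
  have h4 : ∀ i, (∑ j, M a b j • c.cof ε j : Form K 1 ℝ) x ![f i] = M a b i := fun i => by
    have h : (∑ j, M a b j • c.cof ε j : Form K 1 ℝ) x ![f i] = ∑ j, M a b j * kron j i := by
      rw [Finset.sum_apply, ContinuousAlternatingMap.sum_apply]
      refine Finset.sum_congr rfl fun j _ => ?_
      rw [← hf.cof_apply]
      rfl
    rw [h]
    simp [kron]
  simp only [h4] at h3
  have h5 : ∀ (C₁ C₂ w : ℝ) (α β : Form K 6 ℝ) (v : Fin 6 → TangentSpace (𝓡 7) x),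
      (C₁ • (w • α) + C₂ • β) x v = C₁ * (w * α x v) + C₂ * β x v := fun _ _ _ _ _ _ => rfl
  refine Eq.trans ?_ (h5 _ _ _ _ _ _).symm
  have h6 : ∀ C₁ C₂ w X Y X' Y' Z : ℝ, X = X' → Y = Y' → Z = C₁ * (w * X') + C₂ * Y' →
      Z = C₁ * (w * X) + C₂ * Y := fun _ _ _ _ _ _ _ _ h h' h'' => by rw [h, h', h'']
  refine h6 _ _ _ _ _ _ _ _ h2 h3 ?_
  change _ = _ + _ * e0OmegaSq (M a b) n
  ring

end IsTransverseLeviCivita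

end ContactCalabiYau.SU3Coframe

end curvature

/-! ### Unitary frames at a point -/

section unitary

/-- A continuous alternating map as a linear function of its first argument. -/
def ContinuousAlternatingMap.headLinear {M F : Type*} [AddCommGroup M] [Module ℝ M]
    [TopologicalSpace M] [NormedAddCommGroup F] [NormedSpace ℝ F] {n : ℕ}
    (α : M [⋀^Fin (n + 1)]→L[ℝ] F) (v : Fin n → M) : M →ₗ[ℝ] F where
  toFun u := α (Matrix.vecCons u v)
  map_add' u w := α.vecCons_add v u w
  map_smul' r u := α.vecCons_smul v r u

variable {K : Type*} [TopologicalSpace K] [ChartedSpace (EuclideanSpace ℝ (Fin 7)) K]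
  [IsManifold (𝓡 7) ∞ K]

namespace ContactCalabiYau

variable (S : ContactCalabiYau K) (x : K)

/-- The form `ω` at a point, as a bilinear form. -/
noncomputable def om : TangentSpace (𝓡 7) x →ₗ[ℝ] TangentSpace (𝓡 7) x →ₗ[ℝ] ℝ :=
  LinearMap.mk₂ ℝ (fun u v => S.omega x ![u, v])
    (fun u u' v => ((S.omega x).headLinear ![v]).map_add u u')
    (fun r u v => ((S.omega x).headLinear ![v]).map_smul r u)
    (fun u v v' => by
      rw [ContinuousAlternatingMap.map_swap_two _ (v + v') u,
        ContinuousAlternatingMap.map_swap_two _ v u, ContinuousAlternatingMap.map_swap_two _ v' u,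
        ← neg_add]
      exact congrArg Neg.neg (((S.omega x).headLinear ![u]).map_add v v'))
    (fun r u v => by
      rw [ContinuousAlternatingMap.map_swap_two _ (r • v) u,
        ContinuousAlternatingMap.map_swap_two _ v u, smul_neg]
      exact congrArg Neg.neg (((S.omega x).headLinear ![u]).map_smul r v))

/-- The contact form at a point, as a linear functional. -/
noncomputable def et : TangentSpace (𝓡 7) x →ₗ[ℝ] ℝ := (S.η x).toFunctional

variable {x} (u v w : TangentSpace (𝓡 7) x)

theorem et_ξ : S.et x (S.ξ x) = 1 := S.η_ξ x

theorem et_J : S.et x (S.J x v) = 0 := S.η_J x v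

theorem om_swap : S.om x v u = -S.om x u v :=
  (S.omega x).map_swap_two u v

theorem om_ξ_left : S.om x (S.ξ x) v = 0 := S.dη_ξ x v

theorem om_ξ_right : S.om x v (S.ξ x) = 0 := by rw [om_swap, om_ξ_left, neg_zero]

theorem om_J_J : S.om x (S.J x u) (S.J x v) = S.om x u v := S.dη_J x u v

theorem J_J : S.J x (S.J x v) = -v + S.et x v • S.ξ x := S.J_sq x v

theorem om_J_left : S.om x (S.J x u) v = -S.om x u (S.J x v) := by
  have h := S.om_J_J u (S.J x v)
  rw [J_J, map_add, map_neg, map_smul, om_ξ_right, smul_zero, add_zero] at h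
  rw [← h, neg_neg]

theorem om_J_right_symm : S.om x u (S.J x v) = S.om x v (S.J x u) := by
  rw [← neg_inj, ← om_J_left, om_swap]

variable {v} in
theorem om_J_pos (h : S.et x v = 0) (hv : v ≠ 0) : 0 < S.om x v (S.J x v) := S.dη_pos x v h hv

/-- The vectors `F i`, `J (F i)`, `i < n`, are horizontal and orthonormal for the transverse metric
`ω(·, J ·)`. -/
def IsUnitary (x : K) (n : ℕ) (F : ℕ → TangentSpace (𝓡 7) x) : Prop :=
  ∀ i < n, S.et x (F i) = 0 ∧ ∀ j < n,
    S.om x (F i) (S.J x (F j)) = (if i = j then 1 else 0) ∧ S.om x (F i) (F j) = 0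

variable {S} {F : ℕ → TangentSpace (𝓡 7) x}

/-- The expansion of a vector in a unitary frame. -/
theorem IsUnitary.expand (hF : S.IsUnitary x 3 F) (v : TangentSpace (𝓡 7) x) :
    v = S.et x v • S.ξ x + ∑ i : Fin 3,
      (S.om x v (S.J x (F i)) • F i + (-S.om x v (F i)) • S.J x (F i)) := by
  let L : TangentSpace (𝓡 7) x →ₗ[ℝ] ℝ × (Fin 3 → ℝ) × (Fin 3 → ℝ) :=
    (S.et x).prod ((LinearMap.pi fun i : Fin 3 => (S.om x).flip (S.J x (F i))).prod
      (LinearMap.pi fun i : Fin 3 => -(S.om x).flip (F i)))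
  let R : ℝ × (Fin 3 → ℝ) × (Fin 3 → ℝ) → TangentSpace (𝓡 7) x := fun p =>
    p.1 • S.ξ x + ∑ i : Fin 3, (p.2.1 i • F i + p.2.2 i • S.J x (F i))
  have h0 : ∀ i : Fin 3, S.et x (F i) = 0 := fun i => (hF i i.2).1
  have h1 : ∀ i j : Fin 3, S.om x (F i) (S.J x (F j)) = if i = j then 1 else 0 := fun i j => by
    rw [((hF i i.2).2 j j.2).1]
    simp [Fin.ext_iff]
  have h2 : ∀ i j : Fin 3, S.om x (F i) (F j) = 0 := fun i j => ((hF i i.2).2 j j.2).2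
  have hLR : ∀ p, L (R p) = p := fun p => by
    refine Prod.ext ?_ (Prod.ext (funext fun j => ?_) (funext fun j => ?_))
    · change S.et x (R p) = p.1
      simp [R, et_ξ, et_J, h0]
    · change S.om x (R p) (S.J x (F j)) = p.2.1 j
      simp [R, om_ξ_left, om_J_J, h1, h2]
    · change -S.om x (R p) (F j) = p.2.2 j
      simp [R, om_ξ_left, om_J_left, h1, h2]
  have hfin : Module.finrank ℝ (TangentSpace (𝓡 7) x) =
      Module.finrank ℝ (ℝ × (Fin 3 → ℝ) × (Fin 3 → ℝ)) := by
    simp only [Module.finrank_prod, Module.finrank_fin_fun, Module.finrank_self]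
    exact finrank_euclideanSpace_fin
  have : FiniteDimensional ℝ (TangentSpace (𝓡 7) x) :=
    inferInstanceAs (FiniteDimensional ℝ (EuclideanSpace ℝ (Fin 7)))
  have hinj : Function.Injective L :=
    (LinearMap.injective_iff_surjective_of_finrank_eq_finrank hfin).2 fun p => ⟨R p, hLR p⟩
  exact (hinj (hLR (L v))).symm

/-- The components of `ω` in a unitary frame. -/
theorem IsUnitary.om_eq (hF : S.IsUnitary x 3 F) (u v : TangentSpace (𝓡 7) x) :
    S.om x u v = ∑ i : Fin 3, (S.om x u (S.J x (F i)) * -S.om x v (F i)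
      - S.om x v (S.J x (F i)) * -S.om x u (F i)) := by
  conv_lhs => rw [hF.expand v]
  simp only [map_add, map_sum, map_smul, om_ξ_right, smul_eq_mul]
  rw [mul_zero, zero_add]
  exact Finset.sum_congr rfl fun i _ => by ring

/-- `Ω` is determined by its value on a unitary frame. -/
theorem IsUnitary.Omega_eq (hF : S.IsUnitary x 3 F) {t : ℕ → TangentSpace (𝓡 7) x → ℂ}
    (ht : ∀ i v, t i v = S.om x v (S.J x (F i)) + Complex.I * ((-S.om x v (F i) : ℝ) : ℂ))
    (u v w : TangentSpace (𝓡 7) x) :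
    S.Ω x ![u, v, w] =
      S.Ω x ![F 0, F 1, F 2] *
        ((t 0 u * t 1 v - t 0 v * t 1 u) * t 2 w - (t 0 u * t 1 w - t 0 w * t 1 u) * t 2 v
        + (t 0 v * t 1 w - t 0 w * t 1 v) * t 2 u) := by
  have h1 : ∀ u v w : TangentSpace (𝓡 7) x,
      S.Ω x ![u, v, w] = ∑ i : Fin 3, t i u * S.Ω x ![F i, v, w] := fun u v w => by
    have h := congrArg ((S.Ω x).headLinear ![v, w]) (hF.expand u)
    simp only [map_add, map_sum, map_smul] at h
    have h2 : (S.Ω x).headLinear ![v, w] (S.ξ x) = 0 := S.Ω_ξ x v w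
    have h3 : ∀ i : Fin 3, (S.Ω x).headLinear ![v, w] (S.J x (F i)) =
      Complex.I * (S.Ω x).headLinear ![v, w] (F i) := fun i => S.Ω_J x (F i) v w
    rw [h2, smul_zero, zero_add] at h
    refine h.trans (Finset.sum_congr rfl fun i _ => ?_)
    rw [h3, Complex.real_smul, Complex.real_smul]
    change _ = t i u * (S.Ω x).headLinear ![v, w] (F i)
    rw [ht]
    ring
  have s1 : ∀ u v w : TangentSpace (𝓡 7) x, S.Ω x ![v, u, w] = -S.Ω x ![u, v, w] :=
    fun u v w => ContinuousAlternatingMap.map_swap_three_left _ _ _ _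
  have s2 : ∀ u v w : TangentSpace (𝓡 7) x, S.Ω x ![u, w, v] = -S.Ω x ![u, v, w] :=
    fun u v w => ContinuousAlternatingMap.map_swap_three_right _ _ _ _
  have z1 : ∀ u w : TangentSpace (𝓡 7) x, S.Ω x ![u, u, w] = 0 := fun u w =>
    self_eq_neg.1 (s1 u u w)
  have z2 : ∀ u w : TangentSpace (𝓡 7) x, S.Ω x ![u, w, w] = 0 := fun u w =>
    self_eq_neg.1 (s2 u w w)
  have z3 : ∀ u w : TangentSpace (𝓡 7) x, S.Ω x ![u, w, u] = 0 := fun u w => by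
    rw [s1, z2, neg_zero]
  have h2 : ∀ u v w : TangentSpace (𝓡 7) x,
      S.Ω x ![u, v, w] = ∑ i : Fin 3, t i v * S.Ω x ![u, F i, w] := fun u v w => by
    rw [s1 v u w, h1, ← Finset.sum_neg_distrib]
    exact Finset.sum_congr rfl fun i _ => by rw [s1 u (F i) w]; ring
  have h3 : ∀ u v w : TangentSpace (𝓡 7) x,
      S.Ω x ![u, v, w] = ∑ i : Fin 3, t i w * S.Ω x ![u, v, F i] := fun u v w => by
    rw [s2 u w v, h2, ← Finset.sum_neg_distrib]
    exact Finset.sum_congr rfl fun i _ => by rw [s2 u v (F i)]; ring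
  have e1 : S.Ω x ![F 1, F 0, F 2] = -S.Ω x ![F 0, F 1, F 2] := s1 _ _ _
  have e2 : S.Ω x ![F 0, F 2, F 1] = -S.Ω x ![F 0, F 1, F 2] := s2 _ _ _
  have e3 : S.Ω x ![F 1, F 2, F 0] = S.Ω x ![F 0, F 1, F 2] := by rw [s2, e1, neg_neg]
  have e4 : S.Ω x ![F 2, F 0, F 1] = S.Ω x ![F 0, F 1, F 2] := by rw [s1, e2, neg_neg]
  have e5 : S.Ω x ![F 2, F 1, F 0] = -S.Ω x ![F 0, F 1, F 2] := by rw [s1, e3]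
  rw [h1]
  simp only [h2 _ v w, h3 _ _ w]
  simp only [Fin.sum_univ_three, Fin.val_zero, Fin.val_one, Fin.val_two, z1, z2, z3, e1, e2, e3, e4,
    e5]
  ring

set_option maxRecDepth 8000 in
/-- The normalisation of `Ω` makes it of unit length on unitary frames. -/
theorem IsUnitary.norm_Omega (hF : S.IsUnitary x 3 F) :
    (S.Ω x ![F 0, F 1, F 2]).re ^ 2 + (S.Ω x ![F 0, F 1, F 2]).im ^ 2 = 1 := by
  set l := S.Ω x ![F 0, F 1, F 2] with hl
  let f : Fin 7 → TangentSpace (𝓡 7) x :=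
    ![S.ξ x, F 0, F 1, F 2, S.J x (F 0), S.J x (F 1), S.J x (F 2)]
  let t (i : ℕ) (v : TangentSpace (𝓡 7) x) : ℂ :=
    S.om x v (S.J x (F i)) + Complex.I * ((-S.om x v (F i) : ℝ) : ℂ)
  have g1 : ∀ i j : Fin 3, S.om x (F i) (S.J x (F j)) = if i = j then 1 else 0 := fun i j => by
    rw [((hF i i.2).2 j j.2).1]
    simp [Fin.ext_iff]
  have g2 : ∀ i j : Fin 3, S.om x (F i) (F j) = 0 := fun i j => ((hF i i.2).2 j j.2).2
  have hu : ∀ (i : Fin 3) j, S.om x (f j) (S.J x (F i)) = kron (![1, 2, 3] i) j := by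
    intro i j
    fin_cases j
    · exact (S.om_ξ_left _).trans (by fin_cases i <;> simp [kron])
    · exact (g1 0 i).trans (by fin_cases i <;> simp [kron])
    · exact (g1 1 i).trans (by fin_cases i <;> simp [kron])
    · exact (g1 2 i).trans (by fin_cases i <;> simp [kron])
    · exact (S.om_J_J _ _).trans ((g2 0 i).trans (by fin_cases i <;> simp [kron]))
    · exact (S.om_J_J _ _).trans ((g2 1 i).trans (by fin_cases i <;> simp [kron]))
    · exact (S.om_J_J _ _).trans ((g2 2 i).trans (by fin_cases i <;> simp [kron]))
  have hJ : ∀ u v, -S.om x (S.J x u) v = S.om x u (S.J x v) := fun u v => by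
    rw [om_J_left, neg_neg]
  have hv : ∀ (i : Fin 3) j, -S.om x (f j) (F i) = kron (![4, 5, 6] i) j := by
    intro i j
    fin_cases j
    · exact (congrArg Neg.neg (S.om_ξ_left _)).trans (by fin_cases i <;> simp [kron])
    · exact (congrArg Neg.neg (g2 0 i)).trans (by fin_cases i <;> simp [kron])
    · exact (congrArg Neg.neg (g2 1 i)).trans (by fin_cases i <;> simp [kron])
    · exact (congrArg Neg.neg (g2 2 i)).trans (by fin_cases i <;> simp [kron])
    · exact (hJ _ _).trans ((g1 0 i).trans (by fin_cases i <;> simp [kron]))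
    · exact (hJ _ _).trans ((g1 1 i).trans (by fin_cases i <;> simp [kron]))
    · exact (hJ _ _).trans ((g1 2 i).trans (by fin_cases i <;> simp [kron]))
  have hω : ∀ i j, S.omega x ![f i, f j] = omegaCoeff i j := fun i j => by
    refine (hF.om_eq (f i) (f j)).trans ?_
    simp only [hu, hv, omegaCoeff, Fin.sum_univ_three, Matrix.cons_val]
  have hΩ : ∀ i j k, S.Ω x ![f i, f j, f k] = l *
      ((complexKron 1 i * complexKron 2 j - complexKron 1 j * complexKron 2 i) * complexKron 3 k
      - (complexKron 1 i * complexKron 2 k - complexKron 1 k * complexKron 2 i) * complexKron 3 j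
      + (complexKron 1 j * complexKron 2 k - complexKron 1 k * complexKron 2 j) * complexKron 3 i) :=
    fun i j k => by
    rw [hF.Omega_eq (t := t) (fun _ _ => rfl)]
    have h0 : ∀ j, t 0 (f j) = complexKron 1 j := fun j =>
      congrArg₂ (fun p q : ℝ => (p : ℂ) + Complex.I * (q : ℂ)) (hu 0 j) (hv 0 j)
    have h1 : ∀ j, t 1 (f j) = complexKron 2 j := fun j =>
      congrArg₂ (fun p q : ℝ => (p : ℂ) + Complex.I * (q : ℂ)) (hu 1 j) (hv 1 j)
    have h2 : ∀ j, t 2 (f j) = complexKron 3 j := fun j =>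
      congrArg₂ (fun p q : ℝ => (p : ℂ) + Complex.I * (q : ℂ)) (hu 2 j) (hv 2 j)
    simp only [h0, h1, h2]
    rfl
  have h1 := omega_cubed_apply hω 0
  have h2 := congrArg (fun α : Form K 6 ℝ => α x fun i => f ((0 : Fin 7).succAbove i)) S.volume_eq
  have h3 := wedgeAlt_three_three (S.Ω.re x) (S.Ω.im x) fun i => f ((0 : Fin 7).succAbove i)
  have h4 : ∀ u v w, S.Ω.re x ![u, v, w] = (S.Ω x ![u, v, w]).re := fun _ _ _ => rfl
  have h5 : ∀ u v w, S.Ω.im x ![u, v, w] = (S.Ω x ![u, v, w]).im := fun _ _ _ => rfl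
  have h6 : -kron 0 0 = (1 / 4 : ℝ) * wedgeAlt (S.Ω.re x) (S.Ω.im x)
      fun i => f ((0 : Fin 7).succAbove i) := h1.symm.trans h2
  rw [h3] at h6
  simp only [h4, h5, hΩ] at h6
  simp [kron, complexKron, Fin.succAbove] at h6
  linarith

end ContactCalabiYau

end unitary

/-! ### Smooth unitary vector fields -/

section gramSchmidt

variable {K : Type*} [TopologicalSpace K] [ChartedSpace (EuclideanSpace ℝ (Fin 7)) K]

namespace Form

theorem VfSmoothAt.zero (x : K) : VfSmoothAt (fun _ : K => 0) x := by
  refine ContDiffAt.congr_of_eventuallyEq (contDiffAt_const (c := 0)) (.of_forall fun y => ?_)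
  exact map_zero (mfderiv (𝓡 7) 𝓘(ℝ, EuclideanSpace ℝ (Fin 7)) (extChartAt (𝓡 7) x)
    ((extChartAt (𝓡 7) x).symm y))

theorem VfSmoothAt.sum_range {X : ℕ → ∀ x : K, TangentSpace (𝓡 7) x} {x : K} {n : ℕ}
    (h : ∀ i < n, VfSmoothAt (X i) x) : VfSmoothAt (fun z => ∑ i ∈ Finset.range n, X i z) x := by
  induction n with
  | zero => simpa using VfSmoothAt.zero x
  | succ n ih =>
    simp only [Finset.sum_range_succ]
    exact (ih fun i hi => h i (by omega)).add (h n (by omega))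

theorem FunSmoothAt.neg {g : K → ℝ} {x : K} (hg : FunSmoothAt g x) :
    FunSmoothAt (fun z => -g z) x := ContDiffAt.neg hg

theorem FunSmoothAt.inv_sqrt {g : K → ℝ} {x : K} (hg : FunSmoothAt g x) (h : 0 < g x) :
    FunSmoothAt (fun z => (√(g z))⁻¹) x := by
  have hx : g ((extChartAt (𝓡 7) x).symm (extChartAt (𝓡 7) x x)) = g x := by
    rw [extChartAt_to_inv]
  refine ContDiffAt.inv (ContDiffAt.sqrt hg ?_) ?_
  · rw [hx]
    exact h.ne'
  · rw [hx]
    exact (Real.sqrt_pos.2 h).ne'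

theorem SmoothAt.im {n : ℕ} {α : Form K n ℂ} {x : K} (hα : α.SmoothAt x) : α.im.SmoothAt x :=
  contDiffAt_of_apply fun v =>
    Complex.imCLM.contDiff.contDiffAt.comp _ (ContDiffAt.apply_const hα v)

end Form

variable [IsManifold (𝓡 7) ∞ K]

namespace ContactCalabiYau

variable {S : ContactCalabiYau K} {x : K}

open Form

theorem smoothAt_omega (S : ContactCalabiYau K) (x : K) : S.omega.SmoothAt x :=
  SmoothAt.d (.of_forall fun z => S.smoothAt_η z)

theorem smoothAt_Ω (S : ContactCalabiYau K) (x : K) : S.Ω.SmoothAt x := S.smooth_Ω x trivial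

theorem _root_.Form.VfSmoothAt.J {X : ∀ x : K, TangentSpace (𝓡 7) x} (hX : VfSmoothAt X x) :
    VfSmoothAt (fun z => S.J z (X z)) x := VfSmoothAt.end_apply (S.endSmoothAt_J x) hX

theorem funSmoothAt_two {α : Form K 2 ℝ} (hα : α.SmoothAt x)
    {X Y : ∀ x : K, TangentSpace (𝓡 7) x} (hX : VfSmoothAt X x) (hY : VfSmoothAt Y x) :
    FunSmoothAt (fun z => α z ![X z, Y z]) x := by
  have h := FunSmoothAt.apply (X := ![X, Y]) hα (fun j => by fin_cases j <;> assumption)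
  refine (congrArg (FunSmoothAt · x) (funext fun z => ?_)).mp h
  exact congrArg (α z) (funext fun j => by fin_cases j <;> rfl)

theorem funSmoothAt_om {X Y : ∀ x : K, TangentSpace (𝓡 7) x} (hX : VfSmoothAt X x)
    (hY : VfSmoothAt Y x) : FunSmoothAt (fun z => S.om z (X z) (Y z)) x :=
  funSmoothAt_two (S.smoothAt_omega x) hX hY

theorem funSmoothAt_et {X : ∀ x : K, TangentSpace (𝓡 7) x} (hX : VfSmoothAt X x) :
    FunSmoothAt (fun z => S.et z (X z)) x := by
  have h := FunSmoothAt.apply (X := ![X]) (S.smoothAt_η x) (fun j => by fin_cases j; assumption)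
  refine (congrArg (FunSmoothAt · x) (funext fun z => ?_)).mp h
  exact congrArg (S.η z) (funext fun j => by fin_cases j; rfl)

theorem funSmoothAt_three {α : Form K 3 ℝ} (hα : α.SmoothAt x)
    {X Y Z : ∀ x : K, TangentSpace (𝓡 7) x} (hX : VfSmoothAt X x)
    (hY : VfSmoothAt Y x) (hZ : VfSmoothAt Z x) :
    FunSmoothAt (fun z => α z ![X z, Y z, Z z]) x := by
  have h := FunSmoothAt.apply (X := ![X, Y, Z]) hα (fun j => by fin_cases j <;> assumption)
  refine (congrArg (FunSmoothAt · x) (funext fun z => ?_)).mp h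
  exact congrArg (α z) (funext fun j => by fin_cases j <;> rfl)

variable (S) in
/-- The component of `v` orthogonal to `ξ` and to the vectors `F i`, `J (F i)`, `i < n`. -/
noncomputable def orth (n : ℕ) (F : ℕ → TangentSpace (𝓡 7) x) (v : TangentSpace (𝓡 7) x) :
    TangentSpace (𝓡 7) x :=
  v + -S.et x v • S.ξ x + ∑ i ∈ Finset.range n,
    (-S.om x v (S.J x (F i)) • F i + S.om x v (F i) • S.J x (F i))

theorem orth_spec {n : ℕ} {F : ℕ → TangentSpace (𝓡 7) x} (hF : S.IsUnitary x n F)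
    (v : TangentSpace (𝓡 7) x) : S.et x (S.orth n F v) = 0 ∧ ∀ j < n,
      S.om x (S.orth n F v) (S.J x (F j)) = 0 ∧ S.om x (S.orth n F v) (F j) = 0 := by
  have hs : ∀ (c : ℕ → ℝ) j, j < n → ∑ i ∈ Finset.range n, c i * (if i = j then 1 else 0) = c j :=
    fun c j hj => by simp [hj]
  refine ⟨?_, fun j hj => ⟨?_, ?_⟩⟩
  · have h : ∀ i ∈ Finset.range n, S.et x (-S.om x v (S.J x (F i)) • F i
        + S.om x v (F i) • S.J x (F i)) = 0 := fun i hi => by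
      rw [map_add, map_smul, map_smul, (hF i (Finset.mem_range.1 hi)).1, et_J]
      simp
    rw [orth, map_add, map_sum, Finset.sum_eq_zero h, map_add, map_smul, et_ξ]
    simp
  · have h : ∀ i ∈ Finset.range n, S.om x (-S.om x v (S.J x (F i)) • F i
        + S.om x v (F i) • S.J x (F i)) (S.J x (F j)) =
        -S.om x v (S.J x (F i)) * (if i = j then 1 else 0) := fun i hi => by
      have h1 := (hF i (Finset.mem_range.1 hi)).2 j hj
      rw [map_add, map_smul, map_smul, LinearMap.add_apply, LinearMap.smul_apply,
        LinearMap.smul_apply, om_J_J, h1.1, h1.2]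
      simp
    rw [orth, map_add, map_sum, LinearMap.add_apply, LinearMap.sum_apply, Finset.sum_congr rfl h,
      hs _ j hj, map_add, map_smul, LinearMap.add_apply, LinearMap.smul_apply, om_ξ_left]
    simp
  · have h : ∀ i ∈ Finset.range n, S.om x (-S.om x v (S.J x (F i)) • F i
        + S.om x v (F i) • S.J x (F i)) (F j) =
        -S.om x v (F i) * (if i = j then 1 else 0) := fun i hi => by
      have h1 := (hF i (Finset.mem_range.1 hi)).2 j hj
      rw [map_add, map_smul, map_smul, LinearMap.add_apply, LinearMap.smul_apply,
        LinearMap.smul_apply, om_J_left, h1.1, h1.2]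
      split_ifs <;> simp
    rw [orth, map_add, map_sum, LinearMap.add_apply, LinearMap.sum_apply, Finset.sum_congr rfl h,
      hs _ j hj, map_add, map_smul, LinearMap.add_apply, LinearMap.smul_apply, om_ξ_left]
    simp

/-- There are non-zero vectors orthogonal to `ξ` and to fewer than three complex lines. -/
theorem exists_orth (S : ContactCalabiYau K) (x : K) {n : ℕ} (hn : n < 3)
    (F : ℕ → TangentSpace (𝓡 7) x) :
    ∃ v : TangentSpace (𝓡 7) x, v ≠ 0 ∧ S.orth n F v = v := by
  let L : TangentSpace (𝓡 7) x →ₗ[ℝ] ℝ × (Fin n → ℝ) × (Fin n → ℝ) :=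
    (S.et x).prod ((LinearMap.pi fun i : Fin n => (S.om x).flip (S.J x (F i))).prod
      (LinearMap.pi fun i : Fin n => (S.om x).flip (F i)))
  have : FiniteDimensional ℝ (TangentSpace (𝓡 7) x) :=
    inferInstanceAs (FiniteDimensional ℝ (EuclideanSpace ℝ (Fin 7)))
  have hfin : Module.finrank ℝ (ℝ × (Fin n → ℝ) × (Fin n → ℝ))
      < Module.finrank ℝ (TangentSpace (𝓡 7) x) := by
    have h7 : Module.finrank ℝ (TangentSpace (𝓡 7) x) = 7 := finrank_euclideanSpace_fin
    rw [h7]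
    simp only [Module.finrank_prod, Module.finrank_fin_fun, Module.finrank_self]
    omega
  obtain ⟨v, hv, hne⟩ := (Submodule.ne_bot_iff _).1 (LinearMap.ker_ne_bot_of_finrank_lt (f := L) hfin)
  have hL : L v = 0 := hv
  have h1 : S.et x v = 0 := congrArg Prod.fst hL
  have h2 : ∀ i ∈ Finset.range n, S.om x v (S.J x (F i)) = 0 := fun i hi =>
    congrFun (congrArg (fun p => p.2.1) hL) ⟨i, Finset.mem_range.1 hi⟩
  have h3 : ∀ i ∈ Finset.range n, S.om x v (F i) = 0 := fun i hi =>
    congrFun (congrArg (fun p => p.2.2) hL) ⟨i, Finset.mem_range.1 hi⟩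
  refine ⟨v, hne, ?_⟩
  rw [orth, h1, Finset.sum_eq_zero fun i hi => by rw [h2 i hi, h3 i hi]; simp]
  simp

/-- Smooth unitary vector fields exist near every point, by the Gram--Schmidt process. -/
theorem exists_unitary_fields (S : ContactCalabiYau K) (x₀ : K) {n : ℕ} (hn : n ≤ 3) :
    ∃ (U : Set K) (F : ℕ → ∀ x : K, TangentSpace (𝓡 7) x), IsOpen U ∧ x₀ ∈ U ∧
      ∀ x ∈ U, (∀ i < n, VfSmoothAt (F i) x) ∧ S.IsUnitary x n fun i => F i x := by
  induction n with
  | zero => exact ⟨Set.univ, fun _ x => 0, isOpen_univ, trivial, fun x _ =>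
      ⟨fun i hi => absurd hi (by omega), fun i hi => absurd hi (by omega)⟩⟩
  | succ n ih =>
    obtain ⟨U, F, hU, hx₀, hF⟩ := ih (by omega)
    obtain ⟨v, hv, hv'⟩ := S.exists_orth x₀ (n := n) (by omega) fun i => F i x₀
    -- A vector orthogonal to the given fields at `x₀` is extended constantly in the chart and
    -- projected; the result `w` does not vanish near `x₀` and is normalised there.
    let w : ∀ x : K, TangentSpace (𝓡 7) x := fun x =>
      S.orth n (fun i => F i x) (Form.constVf x₀ v x)
    let g : K → ℝ := fun x => S.om x (w x) (S.J x (w x))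
    have hw : ∀ x ∈ U ∩ (extChartAt (𝓡 7) x₀).source, VfSmoothAt w x := by
      rintro x ⟨hx, hx'⟩
      have hC := VfSmoothAt.constVf hx' v
      refine (hC.add (VfSmoothAt.fun_smul (funSmoothAt_et (S := S) hC).neg (S.vfSmoothAt_ξ x))).add
        (VfSmoothAt.sum_range fun i hi => ?_)
      have hi := (hF x hx).1 i hi
      exact (VfSmoothAt.fun_smul (funSmoothAt_om hC hi.J).neg hi).add
        (VfSmoothAt.fun_smul (funSmoothAt_om hC hi) hi.J)
    have hg : ∀ x ∈ U ∩ (extChartAt (𝓡 7) x₀).source, FunSmoothAt g x := fun x hx =>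
      funSmoothAt_om (hw x hx) (hw x hx).J
    have hUs : IsOpen (U ∩ (extChartAt (𝓡 7) x₀).source) :=
      hU.inter (isOpen_extChartAt_source x₀)
    refine ⟨{x ∈ U ∩ (extChartAt (𝓡 7) x₀).source | 0 < g x},
      Function.update F n fun x => (√(g x))⁻¹ • w x, ?_, ⟨⟨hx₀, mem_extChartAt_source x₀⟩, ?_⟩, ?_⟩
    · refine isOpen_iff_mem_nhds.2 fun x hx => ?_
      exact Filter.inter_mem (hUs.mem_nhds hx.1)
        ((hg x hx.1).continuousAt.eventually (lt_mem_nhds hx.2))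
    · have h1 : w x₀ = v :=
        (congrArg (S.orth n fun i => F i x₀) (Form.constVf_self x₀ v)).trans hv'
      have h2 := (orth_spec (hF x₀ hx₀).2 v).1
      rw [hv'] at h2
      change 0 < S.om x₀ (w x₀) (S.J x₀ (w x₀))
      rw [h1]
      exact S.om_J_pos h2 hv
    · rintro x ⟨hx, hgx⟩
      have hlt : ∀ i < n, Function.update F n (fun x => (√(g x))⁻¹ • w x) i = F i := fun i hi =>
        Function.update_of_ne hi.ne _ _
      have heq : Function.update F n (fun x => (√(g x))⁻¹ • w x) n = fun x => (√(g x))⁻¹ • w x :=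
        Function.update_self _ _ _
      have hsp := orth_spec (hF x hx.1).2 (Form.constVf x₀ v x)
      change S.et x (w x) = 0 ∧ ∀ j < n, S.om x (w x) (S.J x (F j x)) = 0 ∧ S.om x (w x) (F j x) = 0
        at hsp
      have hww : S.om x (w x) (w x) = 0 := self_eq_neg.1 (S.om_swap _ _)
      have hnorm : (√(g x))⁻¹ * ((√(g x))⁻¹ * g x) = 1 := by
        rw [← mul_assoc, ← mul_inv, Real.mul_self_sqrt hgx.le, inv_mul_cancel₀ hgx.ne']
      refine ⟨fun i hi => ?_, fun i hi => ?_⟩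
      · rcases Nat.lt_succ_iff_lt_or_eq.1 hi with hi | rfl
        · rw [hlt i hi]
          exact (hF x hx.1).1 i hi
        · rw [heq]
          exact VfSmoothAt.fun_smul ((hg x hx).inv_sqrt hgx) (hw x hx)
      · beta_reduce
        rcases Nat.lt_succ_iff_lt_or_eq.1 hi with hi | rfl
        · obtain ⟨h1, h2⟩ := (hF x hx.1).2 i hi
          rw [hlt i hi]
          refine ⟨h1, fun j hj => ?_⟩
          rcases Nat.lt_succ_iff_lt_or_eq.1 hj with hj | rfl
          · rw [hlt j hj]
            exact h2 j hj
          · rw [heq, if_neg hi.ne]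
            simp only [map_smul, smul_eq_mul]
            rw [om_J_right_symm, (hsp.2 i hi).1, om_swap, (hsp.2 i hi).2]
            simp
        · rw [heq]
          refine ⟨by rw [map_smul, hsp.1, smul_zero], fun j hj => ?_⟩
          beta_reduce
          rcases Nat.lt_succ_iff_lt_or_eq.1 hj with hj | rfl
          · rw [hlt j hj, if_neg hj.ne']
            simp only [map_smul, LinearMap.smul_apply, smul_eq_mul]
            rw [(hsp.2 j hj).1, (hsp.2 j hj).2]
            simp
          · rw [heq, if_pos rfl]
            simp only [map_smul, LinearMap.smul_apply, smul_eq_mul, hww]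
            exact ⟨hnorm, by simp⟩

/-- Unitary vector fields on which `Ω` takes the value `1`. -/
theorem exists_special_unitary_fields (S : ContactCalabiYau K) (x₀ : K) :
    ∃ (U : Set K) (F : ℕ → ∀ x : K, TangentSpace (𝓡 7) x), IsOpen U ∧ x₀ ∈ U ∧
      ∀ x ∈ U, (∀ i < 3, VfSmoothAt (F i) x) ∧ S.IsUnitary x 3 (fun i => F i x) ∧
        S.Ω x ![F 0 x, F 1 x, F 2 x] = 1 := by
  obtain ⟨U, F, hU, hx₀, hF⟩ := S.exists_unitary_fields x₀ le_rfl
  let a : K → ℝ := fun x => S.Ω.re x ![F 0 x, F 1 x, F 2 x]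
  let b : K → ℝ := fun x => S.Ω.im x ![F 0 x, F 1 x, F 2 x]
  -- The last field is rotated by the phase of `Ω`.
  let G : ∀ x : K, TangentSpace (𝓡 7) x := fun x => a x • F 2 x + -b x • S.J x (F 2 x)
  refine ⟨U, Function.update F 2 G, hU, hx₀, fun x hx => ?_⟩
  have h2 : Function.update F 2 G 2 = G := Function.update_self _ _ _
  have hlt : ∀ i < 2, Function.update F 2 G i = F i := fun i hi => Function.update_of_ne hi.ne _ _
  obtain ⟨hs, hu⟩ := hF x hx
  have hab : a x ^ 2 + b x ^ 2 = 1 := hu.norm_Omega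
  have sa : FunSmoothAt a x := funSmoothAt_three (S.smoothAt_Ω x).re (hs 0 (by omega))
    (hs 1 (by omega)) (hs 2 (by omega))
  have sb : FunSmoothAt b x := funSmoothAt_three (S.smoothAt_Ω x).im (hs 0 (by omega))
    (hs 1 (by omega)) (hs 2 (by omega))
  have hcases : ∀ i < 3, i < 2 ∨ i = 2 := fun i hi => by omega
  refine ⟨fun i hi => ?_, fun i hi => ?_, ?_⟩
  · rcases hcases i hi with hi | rfl
    · rw [hlt i hi]
      exact hs i (by omega)
    · rw [h2]
      exact (VfSmoothAt.fun_smul sa (hs 2 (by omega))).add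
        (VfSmoothAt.fun_smul sb.neg (hs 2 (by omega)).J)
  · have key : ∀ j < 2, S.om x (G x) (S.J x (F j x)) = 0 ∧ S.om x (G x) (F j x) = 0 := fun j hj => by
      have h := (hu 2 (by omega)).2 j (by omega)
      rw [if_neg hj.ne'] at h
      simp only [G, map_add, map_smul, LinearMap.add_apply, LinearMap.smul_apply, om_J_left, J_J,
        map_neg, om_ξ_right, h.1, h.2]
      simp
    beta_reduce
    rcases hcases i hi with hi | rfl
    · obtain ⟨h3, h4⟩ := hu i (by omega)
      rw [hlt i hi]
      refine ⟨h3, fun j hj => ?_⟩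
      rcases hcases j hj with hj | rfl
      · rw [hlt j hj]
        exact h4 j (by omega)
      · rw [h2, if_neg hi.ne, om_J_right_symm, (key i hi).1, om_swap, (key i hi).2]
        simp
    · have h := (hu 2 (by omega)).2 2 (by omega)
      rw [if_pos rfl] at h
      rw [h2]
      refine ⟨?_, fun j hj => ?_⟩
      · simp only [G, map_add, map_smul, et_J, (hu 2 (by omega)).1]
        simp
      · rcases hcases j hj with hj | rfl
        · rw [hlt j hj, if_neg hj.ne']
          exact key j hj
        · rw [h2, if_pos rfl]
          refine ⟨?_, self_eq_neg.1 (S.om_swap _ _)⟩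
          simp only [G, map_add, map_smul, LinearMap.add_apply, LinearMap.smul_apply,
            om_J_left, h.1, h.2, J_J, map_neg, om_ξ_right, smul_eq_mul]
          linear_combination hab
  · rw [h2, hlt 0 (by omega), hlt 1 (by omega)]
    -- As `Ω` is complex linear, its value on the rotated fields is `(a + i b) (a - i b)`.
    have s1 : ∀ v, S.Ω x ![F 0 x, F 1 x, v] = (S.Ω x).headLinear ![F 0 x, F 1 x] v := fun v => by
      change _ = S.Ω x ![v, F 0 x, F 1 x]
      rw [ContinuousAlternatingMap.map_swap_three_left _ (F 0 x) v,
        ContinuousAlternatingMap.map_swap_three_right _ (F 0 x) (F 1 x), neg_neg]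
    have s2 : (S.Ω x).headLinear ![F 0 x, F 1 x] (S.J x (F 2 x)) =
        Complex.I * (S.Ω x).headLinear ![F 0 x, F 1 x] (F 2 x) := S.Ω_J x _ _ _
    have s3 : S.Ω x ![F 0 x, F 1 x, F 2 x] = a x + b x * Complex.I :=
      (Complex.re_add_im _).symm
    rw [s1] at s3
    rw [s1, map_add, map_smul, map_smul, s2, s3, Complex.real_smul, Complex.real_smul]
    have hab' : (a x : ℂ) ^ 2 + (b x : ℂ) ^ 2 = 1 := by exact_mod_cast hab
    push_cast
    linear_combination hab' - (b x : ℂ) ^ 2 * Complex.I_sq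

end ContactCalabiYau

end gramSchmidt

/-! ### Existence of `SU(3)`-coframes -/

section existence

variable {K : Type*} [TopologicalSpace K] [ChartedSpace (EuclideanSpace ℝ (Fin 7)) K]
  [IsManifold (𝓡 7) ∞ K]

open Form

/-- A `2`-form is determined by its values on pairs of vectors of a basis. -/
theorem ContinuousAlternatingMap.ext_two {M ι : Type*} [AddCommGroup M] [Module ℝ M]
    [TopologicalSpace M] [Finite ι] (f : Module.Basis ι ℝ M) {α β : M [⋀^Fin 2]→L[ℝ] ℝ}
    (h : ∀ i j, α ![f i, f j] = β ![f i, f j]) : α = β := by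
  refine ContinuousAlternatingMap.toAlternatingMap_injective
    (Module.Basis.ext_alternating f fun v _ => ?_)
  have h2 : (fun i => f (v i)) = ![f (v 0), f (v 1)] := funext fun i => by fin_cases i <;> rfl
  change α (fun i => f (v i)) = β (fun i => f (v i))
  rw [h2]
  exact h _ _

namespace ContactCalabiYau

variable {S : ContactCalabiYau K}

/-- The vector fields `ξ, F₀, F₁, F₂, J F₀, J F₁, J F₂`. -/
noncomputable def frame (S : ContactCalabiYau K) (F : ℕ → ∀ x : K, TangentSpace (𝓡 7) x)
    (j : Fin 7) (x : K) : TangentSpace (𝓡 7) x :=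
  ![S.ξ x, F 0 x, F 1 x, F 2 x, S.J x (F 0 x), S.J x (F 1 x), S.J x (F 2 x)] j

/-- Every point has a transverse `SU(3)`-coframe with a smooth dual frame. -/
theorem exists_su3Coframe (S : ContactCalabiYau K) (x₀ : K) :
    ∃ (c : S.SU3Coframe) (W : Fin 7 → ∀ x : K, TangentSpace (𝓡 7) x), x₀ ∈ c.U ∧
      ∀ x ∈ c.U, (∀ j, VfSmoothAt (W j) x) ∧ c.IsDualFrame 1 x fun j => W j x := by
  obtain ⟨U, F, hU, hx₀, hF⟩ := S.exists_special_unitary_fields x₀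
  let e (i : Fin 3) : Form K 1 ℝ := -contract (fun z => S.J z (F i z)) S.omega
  have he : ∀ i x (v : TangentSpace (𝓡 7) x), e i x ![v] = S.om x v (S.J x (F i x)) :=
    fun i x v => (S.om_swap _ _).symm
  have hJe : ∀ i x (v : TangentSpace (𝓡 7) x), S.JForm (e i) x ![v] = -S.om x v (F i x) :=
    fun i x v => (S.JForm_apply (e i) x ![v]).trans
      (congrArg Neg.neg ((he i x (S.J x v)).trans (S.om_J_J _ _)))
  let c : S.SU3Coframe := {
    U := U
    isOpen_U := hU
    e := e
    smooth_e := fun i x hx => (SmoothAt.contract ((hF x hx).1 i i.2).J (S.smoothAt_omega x)).neg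
    horizontal := fun i x _ => (he i x _).trans (S.om_ξ_left _)
    omega_eq := fun x hx => by
      refine ContinuousAlternatingMap.ext fun v => ?_
      have hv : v = ![v 0, v 1] := funext fun i => by fin_cases i <;> rfl
      have h : (∑ i, e i ∧ᶠ S.JForm (e i) : Form K 2 ℝ) x v =
          ∑ i, wedgeAlt (e i x) (S.JForm (e i) x) v := by
        rw [Finset.sum_apply, ContinuousAlternatingMap.sum_apply]
        rfl
      rw [h, hv]
      refine ((hF x hx).2.1.om_eq (v 0) (v 1)).trans (Finset.sum_congr rfl fun i _ => ?_)
      refine Eq.trans ?_ (wedgeAlt_one_one (e i x) (S.JForm (e i) x) ![v 0, v 1]).symm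
      exact (congrArg₂ (· - ·) (congrArg₂ (· * ·) (he i x (v 0)) (hJe i x (v 1)))
        (congrArg₂ (· * ·) (he i x (v 1)) (hJe i x (v 0)))).symm
    Omega_eq := fun x hx => by
      refine ContinuousAlternatingMap.ext fun v => ?_
      have hv : v = ![v 0, v 1, v 2] := funext fun i => by fin_cases i <;> rfl
      rw [hv]
      refine ((hF x hx).2.1.Omega_eq (t := fun i v => S.om x v (S.J x (F i x)) +
        Complex.I * ((-S.om x v (F i x) : ℝ) : ℂ)) (fun _ _ => rfl) _ _ _).trans ?_
      rw [(hF x hx).2.2, one_mul]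
      have ht : ∀ (i : Fin 3) (v : TangentSpace (𝓡 7) x),
          (e i x ![v] : ℂ) + Complex.I * (S.JForm (e i) x ![v] : ℂ) =
            S.om x v (S.J x (F i x)) + Complex.I * ((-S.om x v (F i x) : ℝ) : ℂ) := fun i v => by
        rw [he, hJe]
      let t (i : Fin 3) : Form K 1 ℂ := (e i).toComplex + Complex.I • (S.JForm (e i)).toComplex
      have h2 : ∀ v w : TangentSpace (𝓡 7) x, wedgeAlt (t 0 x) (t 1 x) ![v, w] = _ :=
        fun v w => (wedgeAlt_one_one _ _ _).trans (congrArg₂ (· - ·)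
          (congrArg₂ (· * ·) (ht 0 v) (ht 1 w)) (congrArg₂ (· * ·) (ht 0 w) (ht 1 v)))
      refine Eq.trans ?_ (wedgeAlt_two_one (wedgeAlt (t 0 x) (t 1 x)) (t 2 x)
        ![v 0, v 1, v 2]).symm
      exact (congrArg₂ (· + ·) (congrArg₂ (· - ·)
        (congrArg₂ (· * ·) (h2 (v 0) (v 1)) (ht 2 (v 2)))
        (congrArg₂ (· * ·) (h2 (v 0) (v 2)) (ht 2 (v 1))))
        (congrArg₂ (· * ·) (h2 (v 1) (v 2)) (ht 2 (v 0)))).symm }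
  refine ⟨c, S.frame F, hx₀, fun x hx => ⟨fun j => ?_, fun a j => ?_⟩⟩
  · obtain ⟨hs, -⟩ := hF x hx
    fin_cases j
    exacts [S.vfSmoothAt_ξ x, hs 0 (by omega), hs 1 (by omega), hs 2 (by omega),
      (hs 0 (by omega)).J, (hs 1 (by omega)).J, (hs 2 (by omega)).J]
  · obtain ⟨-, hu, -⟩ := hF x hx
    have z : ∀ i : Fin 3, S.et x (F i x) = 0 := fun i => (hu i i.2).1
    have g1 : ∀ i j : Fin 3, S.om x (F i x) (S.J x (F j x)) = if i = j then 1 else 0 :=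
      fun i j => by
      have h := ((hu i i.2).2 j j.2).1
      beta_reduce at h
      rw [h]
      simp [Fin.ext_iff]
    have g2 : ∀ i j : Fin 3, S.om x (F i x) (F j x) = 0 := fun i j => ((hu i i.2).2 j j.2).2
    have hJ : ∀ u v, -S.om x (S.J x u) v = S.om x u (S.J x v) := fun u v => by
      rw [om_J_left, neg_neg]
    rcases a with a | i | i
    · refine (one_mul (S.et x (S.frame F j x))).trans ?_
      fin_cases j
      exacts [S.et_ξ, z 0, z 1, z 2, S.et_J _, S.et_J _, S.et_J _]
    · refine (he i x _).trans ?_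
      fin_cases j
      · exact (S.om_ξ_left _).trans (by fin_cases i <;> simp [kron, Idx.toFin])
      · exact (g1 0 i).trans (by fin_cases i <;> simp [kron, Idx.toFin])
      · exact (g1 1 i).trans (by fin_cases i <;> simp [kron, Idx.toFin])
      · exact (g1 2 i).trans (by fin_cases i <;> simp [kron, Idx.toFin])
      · exact (S.om_J_J _ _).trans ((g2 0 i).trans (by fin_cases i <;> simp [kron, Idx.toFin]))
      · exact (S.om_J_J _ _).trans ((g2 1 i).trans (by fin_cases i <;> simp [kron, Idx.toFin]))
      · exact (S.om_J_J _ _).trans ((g2 2 i).trans (by fin_cases i <;> simp [kron, Idx.toFin]))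
    · refine (hJe i x _).trans ?_
      fin_cases j
      · exact (congrArg Neg.neg (S.om_ξ_left _)).trans
          (by fin_cases i <;> simp [kron, Idx.toFin])
      · exact (congrArg Neg.neg (g2 0 i)).trans (by fin_cases i <;> simp [kron, Idx.toFin])
      · exact (congrArg Neg.neg (g2 1 i)).trans (by fin_cases i <;> simp [kron, Idx.toFin])
      · exact (congrArg Neg.neg (g2 2 i)).trans (by fin_cases i <;> simp [kron, Idx.toFin])
      · exact (hJ _ _).trans ((g1 0 i).trans (by fin_cases i <;> simp [kron, Idx.toFin]))
      · exact (hJ _ _).trans ((g1 1 i).trans (by fin_cases i <;> simp [kron, Idx.toFin]))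
      · exact (hJ _ _).trans ((g1 2 i).trans (by fin_cases i <;> simp [kron, Idx.toFin]))

end ContactCalabiYau

end existence

/-! ### Existence of the transverse Levi-Civita connection -/

section leviCivita

/-- The closedness of `ω` and `Ω` makes the derivative of a dual coframe along the Reeb field
skew: the Reeb flow preserves the transverse metric. -/
theorem skew_of_closed {T : Fin 7 → Fin 7 → Fin 7 → ℝ} (hT : ∀ a i j, T a j i = -T a i j)
    (h1 : ∀ i j k, dOmegaCoeff T i j k = 0)
    (h2 : ∀ i j k l,
      dUpsilonCoeff (fun a i j => (T a i j : ℂ) + Complex.I * (T (a + 3) i j : ℂ)) i j k l = 0)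
    {a b : Fin 7} (ha : a ≠ 0) (hb : b ≠ 0) : T b a 0 = -T a b 0 := by
  let e : Fin 3 → Fin 7 := ![1, 2, 3]
  let e' : Fin 3 → Fin 7 := ![4, 5, 6]
  -- `ι_ξ dω = 0` on the pairs `(e_j, Je_k)`.
  have A : ∀ j k, T (e k) 0 (e j) = -T (e' j) 0 (e' k) := fun j k => by
    have h := h1 0 (e j) (e' k)
    fin_cases j <;> fin_cases k <;>
      simp [dOmegaCoeff, kron, Fin.sum_univ_three, e, e'] at h ⊢ <;> linarith
  -- `ι_ξ dω = 0` on the pairs `(e_j, e_k)`.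
  have B : ∀ j k, T (e' j) 0 (e k) = T (e' k) 0 (e j) := fun j k => by
    have h := h1 0 (e j) (e k)
    fin_cases j <;> fin_cases k <;>
      simp [dOmegaCoeff, kron, Fin.sum_univ_three, e, e'] at h ⊢ <;> linarith
  -- The Reeb derivative of `e_j + i Je_j` is of type `(1, 0)`.
  have C : ∀ j k, (T (e j) 0 (e' k) : ℂ) + Complex.I * T (e' j) 0 (e' k) =
      Complex.I * (T (e j) 0 (e k) + Complex.I * T (e' j) 0 (e k)) := fun j k => by
    have hc := h2 0 (e k) (e' k) (e (-(j + k)))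
    have ht := h2 0 1 2 3
    have h4 := h2 0 4 2 3
    have h5 := h2 0 1 5 3
    have h6 := h2 0 1 2 6
    fin_cases j <;> fin_cases k <;>
      simp [dUpsilonCoeff, wedgeCoeff, complexKron, kron, e, e'] at hc ht h4 h5 h6 ⊢
    · linear_combination h4 - Complex.I * ht
    · linear_combination -hc
    · linear_combination hc
    · linear_combination hc
    · linear_combination h5 - Complex.I * ht
    · linear_combination -hc
    · linear_combination -hc
    · linear_combination hc
    · linear_combination h6 - Complex.I * ht
  have C1 : ∀ j k, T (e j) 0 (e' k) = -T (e' j) 0 (e k) := fun j k => by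
    simpa using congrArg Complex.re (C j k)
  have C2 : ∀ j k, T (e' j) 0 (e' k) = T (e j) 0 (e k) := fun j k => by
    simpa using congrArg Complex.im (C j k)
  have D : ∀ a b : Fin 7, a ≠ 0 → b ≠ 0 → T b 0 a = -T a 0 b := by
    have hcases : ∀ a : Fin 7, a ≠ 0 → ∃ j, a = e j ∨ a = e' j := by decide
    intro a b ha hb
    obtain ⟨j, rfl | rfl⟩ := hcases a ha <;> obtain ⟨k, rfl | rfl⟩ := hcases b hb
    · rw [A, C2]
    · rw [C1, B, neg_neg]
    · rw [C1, B]
    · rw [C2, A]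
  rw [hT b 0 a, hT a 0 b, D a b ha hb]

/-- The coefficients of the transverse Levi-Civita connection, by the Koszul formula, in terms of
the derivatives of the coframe. -/
noncomputable def koszul (T : Fin 7 → Fin 7 → Fin 7 → ℝ) (a b j : Fin 7) : ℝ :=
  if j = 0 then T a b 0 else (T a b j - T b a j - T j a b) / 2

/-- The coefficients of `koszul`, extended by zero along `e₀`, have torsion `T`. -/
theorem koszul_torsion {T : Fin 7 → Fin 7 → Fin 7 → ℝ} (hT : ∀ a i j, T a j i = -T a i j)
    (a i j : Fin 7) (h : i ≠ 0 ∨ j ≠ 0) :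
    (if i = 0 then 0 else koszul T a i j) - (if j = 0 then 0 else koszul T a j i) = T a i j := by
  by_cases hi : i = 0 <;> by_cases hj : j = 0 <;> simp only [koszul, hi, hj, if_true, if_false]
  · simp_all
  · rw [hT a 0 j]
    ring
  · ring
  · rw [hT a i j]
    ring

variable {K : Type*} [TopologicalSpace K] [ChartedSpace (EuclideanSpace ℝ (Fin 7)) K]
  [IsManifold (𝓡 7) ∞ K]

open Form

namespace ContactCalabiYau.SU3Coframe

variable {S : ContactCalabiYau K} (c : S.SU3Coframe)

/-- A frame dual to the coframe agrees with any dual basis. -/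
theorem IsDualFrame.eq_basis {c : S.SU3Coframe} {ε : ℝ} {x : K}
    {f : Module.Basis (Fin 7) ℝ (TangentSpace (𝓡 7) x)} {g : Fin 7 → TangentSpace (𝓡 7) x}
    (hf : c.IsDualFrame ε x f) (hg : c.IsDualFrame ε x g) : g = f := by
  funext j
  refine f.ext_elem fun i => ?_
  have h1 : (c.cof ε i x).toFunctional = f.coord i := f.ext fun j => by
    refine (hf.cof_apply c i j).trans ?_
    simp [kron, Finsupp.single_apply, eq_comm]
  have h2 : ∀ v, f.repr v i = (c.cof ε i x).toFunctional v := fun v => by rw [h1]; rfl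
  rw [h2, h2]
  exact (hg.cof_apply c i j).trans (hf.cof_apply c i j).symm

/-- The transverse Levi-Civita connection exists for a coframe with a smooth dual frame. -/
theorem exists_isTransverseLeviCivita {W : Fin 7 → ∀ x : K, TangentSpace (𝓡 7) x}
    (hW : ∀ x ∈ c.U, (∀ j, VfSmoothAt (W j) x) ∧ c.IsDualFrame 1 x fun j => W j x) :
    ∃ Γ, c.IsTransverseLeviCivita Γ := by
  -- The normalisation of `e₀` is irrelevant here, so `ε = 1`.
  let T (x : K) (a i j : Fin 7) : ℝ := (c.cof 1 a).d x ![W i x, W j x]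
  have hT : ∀ x a i j, T x a j i = -T x a i j := fun x a i j =>
    ContinuousAlternatingMap.map_swap_two _ _ _
  have hTs : ∀ x ∈ c.U, ∀ a i j, FunSmoothAt (fun x => T x a i j) x := fun x hx a i j =>
    funSmoothAt_two (SmoothAt.d ((c.eventually_mem hx).mono fun z hz => c.smoothAt_cof a hz))
      ((hW x hx).1 i) ((hW x hx).1 j)
  have hks : ∀ x ∈ c.U, ∀ a b j, FunSmoothAt (fun x => koszul (T x) a b j) x := fun x hx a b j => by
    by_cases hj : j = 0
    · simpa only [koszul, hj, if_true] using hTs x hx a b 0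
    · simp only [koszul, hj, if_false]
      exact ContDiffAt.div_const
        (ContDiffAt.sub (ContDiffAt.sub (hTs x hx a b j) (hTs x hx b a j)) (hTs x hx j a b)) 2
  have hskew : ∀ x ∈ c.U, ∀ {a b}, a ≠ 0 → b ≠ 0 → ∀ j,
      koszul (T x) b a j = -koszul (T x) a b j := fun x hx a b ha hb j => by
    by_cases hj : j = 0
    · simp only [koszul, hj, if_true]
      exact skew_of_closed (hT x) (c.dOmegaCoeff_eq_zero (hW x hx).2 hx)
        (c.dUpsilonCoeff_eq_zero (hW x hx).2 hx) ha hb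
    · simp only [koszul, hj, if_false]
      rw [hT x j a b]
      ring
  have hne : ∀ a : Fin 3 ⊕ Fin 3, Idx.toFin (Sum.inr a) ≠ 0 := by decide
  let Γ : Matrix (Fin 3 ⊕ Fin 3) (Fin 3 ⊕ Fin 3) (Form K 1 ℝ) := fun a b =>
    ∑ j, fun x => koszul (T x) (Idx.toFin (Sum.inr a)) (Idx.toFin (Sum.inr b)) j • c.cof 1 j x
  have hΓ : ∀ a b x, Γ a b x =
      ∑ j, koszul (T x) (Idx.toFin (Sum.inr a)) (Idx.toFin (Sum.inr b)) j • c.cof 1 j x :=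
    fun a b x => Finset.sum_apply _ _ _
  refine ⟨Γ, fun a b x hx => ?_, fun a b x hx => ?_, fun a x hx => ?_⟩
  · exact SmoothAt.sum fun j _ => SmoothAt.fun_smul (hks x hx _ _ j) (c.smoothAt_cof j hx)
  · rw [hΓ, hΓ, ← Finset.sum_neg_distrib]
    exact Finset.sum_congr rfl fun j _ => by rw [hskew x hx (hne a) (hne b), neg_smul]
  · obtain ⟨f, hf⟩ := c.exists_isDualFrame one_pos hx
    refine ContinuousAlternatingMap.ext_two f fun i j => ?_
    have hWf : (fun j => W j x) = f := hf.eq_basis (hW x hx).2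
    have hWf' : ∀ j, W j x = f j := congrFun hWf
    have hΓf : ∀ a b i, Γ a b x ![f i] =
        koszul (T x) (Idx.toFin (Sum.inr a)) (Idx.toFin (Sum.inr b)) i := fun a b i => by
      rw [hΓ, ContinuousAlternatingMap.sum_apply]
      refine (Finset.sum_congr rfl fun j _ => congrArg (koszul (T x) (Idx.toFin (Sum.inr a))
        (Idx.toFin (Sum.inr b)) j * ·) (hf.cof_apply c j i)).trans ?_
      simp [kron]
    have hd : (Sum.elim c.e c.Je a).d x ![f i, f j] = T x (Idx.toFin (Sum.inr a)) i j := by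
      change _ = (c.cof 1 (Idx.toFin (Sum.inr a))).d x ![W i x, W j x]
      rw [hWf', hWf', cof, Idx.ofFin_toFin]
      rfl
    have hE : ∀ b j, Sum.elim c.e c.Je b x ![f j] = kron (Idx.toFin (Sum.inr b)) j := fun b j =>
      hf (Sum.inr b) j
    have h1 : (∑ b, Γ a b ∧ᶠ Sum.elim c.e c.Je b : Form K 2 ℝ) x ![f i, f j] =
        ∑ b, (koszul (T x) (Idx.toFin (Sum.inr a)) (Idx.toFin (Sum.inr b)) i *
          kron (Idx.toFin (Sum.inr b)) j -
          koszul (T x) (Idx.toFin (Sum.inr a)) (Idx.toFin (Sum.inr b)) j *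
          kron (Idx.toFin (Sum.inr b)) i) := by
      rw [Finset.sum_apply, ContinuousAlternatingMap.sum_apply]
      refine Finset.sum_congr rfl fun b _ => (wedgeAlt_one_one _ _ _).trans ?_
      exact congrArg₂ (· - ·) (congrArg₂ (· * ·) (hΓf a b i) (hE b j))
        (congrArg₂ (· * ·) (hΓf a b j) (hE b i))
    have h2 : ∀ (g : Fin 7 → ℝ) j, ∑ b : Fin 3 ⊕ Fin 3, g (Idx.toFin (Sum.inr b)) *
        kron (Idx.toFin (Sum.inr b)) j = if j = 0 then 0 else g j := fun g j => by
      fin_cases j <;> simp [Fin.sum_univ_three, Idx.toFin, kron]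
    change _ = -((∑ b, Γ a b ∧ᶠ Sum.elim c.e c.Je b : Form K 2 ℝ) x ![f i, f j])
    rw [hd, h1, Finset.sum_sub_distrib, h2 (fun b => koszul (T x) (Idx.toFin (Sum.inr a)) b i) j,
      h2 (fun b => koszul (T x) (Idx.toFin (Sum.inr a)) b j) i, neg_sub]
    by_cases h : i ≠ 0 ∨ j ≠ 0
    · exact (koszul_torsion (hT x) _ i j h).symm
    · push Not at h
      obtain ⟨rfl, rfl⟩ := h
      exact (self_eq_neg.1 (hT x _ 0 0)).trans (sub_zero 0).symm

end ContactCalabiYau.SU3Coframe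

end leviCivita

/-! ### The connection is not a `G₂`-instanton -/

section main

/-- The three coefficients in `R ∧ ψ` do not vanish together. If the second vanishes because
`m = 5δ - 1`, the third is `-(9δ² + 2δ + 1) < 0`; if it vanishes because `δ = -1`, the third forces
`m = -2`, and then the first is `-4k`. -/
theorem coefficients_ne_zero {δ m k : ℝ} (hk : k ≠ 0)
    (h1 : 6 * (1 - δ + m) + k * (1 - δ) * (1 + 3 * δ) = 0)
    (h2 : (1 + m - 5 * δ) * (1 + δ) = 0) : δ ^ 2 - 2 * (2 + m) * δ - 1 ≠ 0 := by
  intro h3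
  rcases mul_eq_zero.1 h2 with h | h
  · obtain rfl : m = 5 * δ - 1 := by linarith
    nlinarith [sq_nonneg (δ + 1 / 9)]
  · obtain rfl : δ = -1 := by linarith
    obtain rfl : m = -2 := by linarith
    exact hk (by linarith)

variable {K : Type*} [TopologicalSpace K] [ChartedSpace (EuclideanSpace ℝ (Fin 7)) K]
  [IsManifold (𝓡 7) ∞ K]

/-- The three coefficients in `R ∧ ψ` would have to vanish in some coframe near a point. -/
theorem ContactCalabiYau.not_isG2Instanton [Nonempty K] (S : ContactCalabiYau K) {ε k : ℝ}
    (δ m : ℝ) (hε : 0 < ε) (hk : k ≠ 0) : ¬S.IsG2Instanton ε δ m k := by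
  intro h
  obtain ⟨x⟩ := ‹Nonempty K›
  obtain ⟨c, W, hx, hW⟩ := S.exists_su3Coframe x
  obtain ⟨Γ, hΓ⟩ := c.exists_isTransverseLeviCivita hW
  obtain ⟨f, hf⟩ := c.exists_isDualFrame hε hx
  have h0 := fun a b n => (hΓ.curvatureWedgePsi_apply hε hf hx δ m k a b n).symm.trans
    (congrArg (fun α => α fun i => f (n.succAbove i))
      (h c Γ hΓ x hx (Idx.ofFin a) (Idx.ofFin b)))
  beta_reduce at h0
  -- These three components are, up to non-zero factors, the three coefficients of `R ∧ ψ`.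
  have h1 := h0 1 4 0
  have h2 := h0 0 1 4
  have h3 := h0 1 2 3
  simp only [curvatureTensor_eq, omegaCoeff, imOmegaCoeff, kronDet, kron, e0OmegaSq] at h1 h2 h3
  simp [hε.ne', hk] at h1 h2 h3
  exact coefficients_ne_zero hk h1 (mul_eq_zero.2 h2) (by linarith)

end main

theorem mainTheorem2 {K : Type*} [TopologicalSpace K]
    [ChartedSpace (EuclideanSpace ℝ (Fin 7)) K] [IsManifold (𝓡 7) ∞ K] [Nonempty K]
    (S : ContactCalabiYau K) (ε δ m k : ℝ) (hε : 0 < ε) (hk : k ≠ 0) :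
    (∀ (c : S.SU3Coframe) (Γ : Matrix (Fin 3 ⊕ Fin 3) (Fin 3 ⊕ Fin 3) (Form K 1 ℝ)),
      c.IsTransverseLeviCivita Γ → ∀ x ∈ c.U, ∀ a b,
        c.curvatureWedgePsi Γ ε δ m k a b x =
          ((k * ε ^ 2 * (6 * (1 - δ + m) + k * (1 - δ) * (1 + 3 * δ)) / 4) •
              timesI ((1 / 6 : ℝ) • S.omega3)
            + (k ^ 2 * ε ^ 2 / 4) •
              (blocks
                (((1 + m - 5 * δ) * (1 + δ)) • c.e)
                (((1 + m - 5 * δ) * (1 + δ)) • c.Je)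
                (((5 * δ - 1 - m) * (1 + δ)) • c.e)
                (((5 * δ - 1 - m) * (1 + δ)) • c.Je)
                ((δ ^ 2 - 2 * (2 + m) * δ - 1) • box c.Je)
                ((δ ^ 2 - 2 * (2 + m) * δ - 1) • box c.e)
                ((δ ^ 2 - 2 * (2 + m) * δ - 1) • box c.e)
                (-(δ ^ 2 - 2 * (2 + m) * δ - 1) • box c.Je)).map
                  fun α => (S.e₀ ε ∧ᶠ ((1 / 2 : ℝ) • S.omega2) ∧ᶠ α : Form K 6 ℝ)) a b x)
    ∧ ¬ S.IsG2Instanton ε δ m k := by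
  refine ⟨fun c Γ hΓ x hx a b => ?_, S.not_isG2Instanton δ m hε hk⟩
  rw [← Idx.ofFin_toFin a, ← Idx.ofFin_toFin b]
  exact hΓ.curvatureWedgePsi_eq hε hx δ m k a.toFin b.toFin
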